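/- Let $n\ge 3$ and let $M$ be a nonempty smooth $n$-manifold (Hausdorff, second countable, without boundary; not necessarily connected or compact). Let $\mathrm{Metr}(M)$ be the set of smooth Riemannian metrics on $M$. For $g\in\mathrm{Metr}(M)$, let $\mu_g$ and $\mathrm{scal}_g$ denote the Riemannian measure and the scalar curvature of $g$, let $p=\frac{2n}{n-2}$ and $a_n=\frac{4(n-1)}{n-2}$, and for every compactly supported, not identically vanishing $v\in C^\infty(M,\mathbb{R}_{\ge0})$ let $$E_g(v)=\frac{1}{\|v\|_{L^p(g)}^2}\int_M\big(a_n|dv|_g^2+\mathrm{scal}_g\,v^2\big)\,d\mu_g .$$ The Yamabe constant of $g$ is $$Y_M(g)=\inf\{E_g(v) : v\in C_c^\infty(M,\mathbb{R}_{\ge0}),\ v\not\equiv0\}\in\mathbb{R}\cup\{-\infty\}.$$ For $k\in\mathbb{N}\cup\{\infty\}$ (with $0\in\mathbb{N}$), the compact-open $C^k$-topology on $\mathrm{Metr}(M)$ is the coarsest topology for which the $k$-jet prolongation $g\mapsto j^kg$ is continuous with respect to the compact-open topology; equivalently, it is the topology of uniform convergence, on compact subsets of the ranges of charts, of the metric coefficients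 together with their partial derivatives of all finite orders $\le k$. Theorem. 1. $Y_M$ is upper semicontinuous with respect to the compact-open $C^2$-topology on $\mathrm{Metr}(M)$. 2. Let $g\in\mathrm{Metr}(M)$. If $M$ is compact or $Y_M(g)=-\infty$, then $Y_M$ is continuous at $g$ with respect to the compact-open $C^2$-topology. 3. Let $g\in\mathrm{Metr}(M)$. If $M$ is noncompact and $Y_M(g)>-\infty$, then for every $k\in\mathbb{N}\cup\{\infty\}$, $Y_M$ is not continuous at $g$ with respect to the compact-open $C^k$-topology on $\mathrm{Metr}(M)$. -/

import Mathlib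

open scoped Manifold ContDiff Topology

noncomputable section

namespace Yamabe

/-- The model space `ℝⁿ` with its Euclidean norm. -/
abbrev E (n : ℕ) : Type := EuclideanSpace ℝ (Fin n)

/-- The `i`-th standard basis vector of `ℝⁿ`. -/
abbrev basisVec {n : ℕ} (i : Fin n) : E n := EuclideanSpace.single i (1 : ℝ)

/-- The `i`-th partial derivative of a function on (an open subset of) `ℝⁿ`. -/
def pderiv {n : ℕ} (i : Fin n) (f : E n → ℝ) (y : E n) : ℝ := fderiv ℝ f y (basisVec i)

/-! ### Riemannian geometry of a matrix-valued function on an open subset of `ℝⁿ` -/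

section Coordinates

variable {n : ℕ}

/-- The entry `g^{ij}` of the inverse of the matrix `(g_{ij})`. -/
def invCoeff (G : Fin n → Fin n → E n → ℝ) (i j : Fin n) (y : E n) : ℝ :=
  (Matrix.of fun a b => G a b y)⁻¹ i j

/-- The Christoffel symbol
`Γ^k_{ij} = ½ ∑_l g^{kl} (∂_i g_{jl} + ∂_j g_{il} - ∂_l g_{ij})`. -/
def christoffel (G : Fin n → Fin n → E n → ℝ) (k i j : Fin n) (y : E n) : ℝ :=
  (1 / 2 : ℝ) * ∑ l, invCoeff G k l y *
    (pderiv i (G j l) y + pderiv j (G i l) y - pderiv l (G i j) y)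

/-- The Ricci tensor
`R_{ij} = ∑_k (∂_k Γ^k_{ij} - ∂_j Γ^k_{ik}) + ∑_{k,l} (Γ^k_{kl} Γ^l_{ij} - Γ^k_{jl} Γ^l_{ik})`,
with the sign for which round spheres have positive Ricci curvature. -/
def ricci (G : Fin n → Fin n → E n → ℝ) (i j : Fin n) (y : E n) : ℝ :=
  (∑ k, (pderiv k (christoffel G k i j) y - pderiv j (christoffel G k i k) y)) +
    ∑ k, ∑ l, (christoffel G k k l y * christoffel G l i j y -
      christoffel G k j l y * christoffel G l i k y)

/-- The scalar curvature `∑_{i,j} g^{ij} R_{ij}`. -/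
def scalCoord (G : Fin n → Fin n → E n → ℝ) (y : E n) : ℝ :=
  ∑ i, ∑ j, invCoeff G i j y * ricci G i j y

/-- The squared norm `∑_{i,j} g^{ij} ∂_i f ∂_j f` of the differential of `f`. -/
def normSqCoord (G : Fin n → Fin n → E n → ℝ) (f : E n → ℝ) (y : E n) : ℝ :=
  ∑ i, ∑ j, invCoeff G i j y * pderiv i f y * pderiv j f y

end Coordinates

section Manifold

variable {n : ℕ} {M : Type*} [TopologicalSpace M] [ChartedSpace (E n) M]

variable (n M) in
/-- The set of smooth Riemannian metrics on the smooth `n`-manifold `M`. -/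
abbrev Metr [IsManifold (𝓡 n) ∞ M] : Type _ :=
  Bundle.ContMDiffRiemannianMetric (𝓡 n) ∞ (E n) (fun x : M => TangentSpace (𝓡 n) x)

variable (n M) in
/-- The smooth charts of `M`: all members of its maximal smooth atlas. -/
abbrev charts : Set (OpenPartialHomeomorph M (E n)) :=
  IsManifold.maximalAtlas (𝓡 n) ∞ M

/-- The coordinate vector field `∂_i` of the chart `e`, at the point with coordinates `y`. -/
def coordVec (e : OpenPartialHomeomorph M (E n)) (i : Fin n) (y : E n) :
    TangentSpace (𝓡 n) (e.symm y) :=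
  mfderiv (𝓡 n) (𝓡 n) e.symm y (basisVec i)

variable [IsManifold (𝓡 n) ∞ M]

/-- The coefficient `g_{ij} = g(∂_i, ∂_j)` of the metric `g` in the chart `e`, as a function of the
coordinates. It is meaningful on `e.target`. -/
def coeff (g : Metr n M) (e : OpenPartialHomeomorph M (E n)) (i j : Fin n) (y : E n) : ℝ :=
  g.inner (e.symm y) (coordVec e i y) (coordVec e j y)

/-- The scalar curvature of `g`, computed in the preferred chart at each point. -/
def scal (g : Metr n M) (x : M) : ℝ :=
  scalCoord (coeff g (chartAt (E n) x)) (chartAt (E n) x x)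

/-- The function `|dv|_g²`, computed in the preferred chart at each point. -/
def normSqD (g : Metr n M) (v : M → ℝ) (x : M) : ℝ :=
  normSqCoord (coeff g (chartAt (E n) x)) (v ∘ (chartAt (E n) x).symm) (chartAt (E n) x x)

/-! ### The compact-open `C^k`-topology -/

theorem contMDiffOn_coordVec {e : OpenPartialHomeomorph M (E n)} (he : e ∈ charts n M)
    (i : Fin n) :
    ContMDiffOn (𝓡 n) (𝓡 n).tangent ∞
      (fun y => (⟨e.symm y, coordVec e i y⟩ : TangentBundle (𝓡 n) M)) e.target := by
  have : IsManifold (𝓡 n) 1 M := IsManifold.of_le (n := ∞) (by exact_mod_cast le_top)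
  have hs : UniqueMDiffOn (𝓡 n) e.target := e.open_target.uniqueMDiffOn
  have h1 := (contMDiffOn_symm_of_mem_maximalAtlas he).contMDiffOn_tangentMapWithin
    (m := ∞) le_rfl hs
  have h2 : ContMDiff (𝓡 n) (𝓡 n).tangent ∞
      (fun y : E n => (⟨y, basisVec i⟩ : TangentBundle (𝓡 n) (E n))) := by
    intro x
    rw [Bundle.contMDiffAt_totalSpace]
    refine ⟨contMDiffAt_id, ?_⟩
    simpa using contMDiffAt_const
  have h3 := h1.comp h2.contMDiffOn (s := e.target) (fun y hy => hy)
  refine h3.congr fun y hy => ?_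
  simp only [Function.comp_def, tangentMapWithin, coordVec]
  rw [mfderivWithin_of_isOpen e.open_target hy]

theorem contDiffOn_coeff (g : Metr n M) {e : OpenPartialHomeomorph M (E n)}
    (he : e ∈ charts n M) (i j : Fin n) : ContDiffOn ℝ ∞ (coeff g e i j) e.target := by
  intro y hy
  have h := ContMDiffWithinAt.clm_bundle_apply₂ (F₁ := E n) (F₂ := E n) (F₃ := ℝ)
    (E₃ := Bundle.Trivial M ℝ)
    (g.contMDiff.contMDiffAt.comp_contMDiffWithinAt y
      (contMDiffOn_symm_of_mem_maximalAtlas he y hy))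
    (contMDiffOn_coordVec he i y hy) (contMDiffOn_coordVec he j y hy)
  simp only [Bundle.contMDiffWithinAt_totalSpace] at h
  exact h.2.contDiffWithinAt

/-- The fibre, in coordinates, of the bundle of `k`-jets of symmetric 2-tensors (`k ≤ ∞`): for
every entry `(i, j)` the derivatives of all finite orders `l ≤ k`, with the product topology. -/
abbrev JetFiber (n : ℕ) (k : ℕ∞) : Type :=
  Fin n → Fin n → (l : {l : ℕ // (l : ℕ∞) ≤ k}) → (E n) [×(l : ℕ)]→L[ℝ] ℝ

/-- The `k`-jet prolongation of the metric `g` in the chart `e`, as a continuous map on the range of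
the chart. -/
def jet (k : ℕ∞) (e : OpenPartialHomeomorph M (E n)) (he : e ∈ charts n M) (g : Metr n M) :
    C(e.target, JetFiber n k) where
  toFun y i j l := iteratedFDeriv ℝ l (coeff g e i j) y
  continuous_toFun := by
    refine continuous_pi fun i => continuous_pi fun j => continuous_pi fun l => ?_
    have h : ContinuousOn (iteratedFDeriv ℝ l (coeff g e i j)) e.target :=
      ((contDiffOn_coeff g he i j).continuousOn_iteratedFDerivWithin (m := (l : ℕ))
        (by exact_mod_cast le_top) e.open_target.uniqueDiffOn).congr
          fun y hy => (iteratedFDerivWithin_of_isOpen _ e.open_target hy).symm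
    exact continuousOn_iff_continuous_domRestrict.1 h

variable (n M) in
/-- The compact-open `C^k`-topology on the set of Riemannian metrics: the coarsest topology for
which, for every smooth chart, the `k`-jet prolongation in this chart is continuous as a map
into the space of continuous maps on the range of the chart with the compact-open topology. -/
@[reducible]
def compactOpen (k : ℕ∞) : TopologicalSpace (Metr n M) :=
  ⨅ (e : OpenPartialHomeomorph M (E n)) (he : e ∈ charts n M),
    TopologicalSpace.induced (jet k e he) ContinuousMap.compactOpen

/-! ### The Yamabe constant -/

section Measure

variable [MeasurableSpace M]

/-- The Riemannian measure of `g` on the domain of the chart `e`: the image of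
`√(det g_{ij}) dy` under the inverse of the chart (it vanishes outside of the domain of `e`). -/
def chartMeasure (g : Metr n M) (e : OpenPartialHomeomorph M (E n)) :
    MeasureTheory.Measure M :=
  ((MeasureTheory.volume.restrict e.target).withDensity fun y =>
    ENNReal.ofReal (Real.sqrt (Matrix.of fun i j => coeff g e i j y).det)).map e.symm

/-- The Riemannian measure `μ_g`. The measures `chartMeasure g e` agree on overlaps of chart
domains, so their supremum is the measure on `M` which restricts to each of them. -/
def riemMeasure (g : Metr n M) : MeasureTheory.Measure M :=
  ⨆ (e : OpenPartialHomeomorph M (E n)) (_ : e ∈ charts n M), chartMeasure g e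

variable (n M) in
/-- The test functions: smooth, compactly supported, nonnegative, not identically zero. -/
structure TestFunction where
  toFun : M → ℝ
  smooth : ContMDiff (𝓡 n) 𝓘(ℝ, ℝ) ∞ toFun
  compactSupport : HasCompactSupport toFun
  nonneg : ∀ x, 0 ≤ toFun x
  ne_zero : ∃ x, toFun x ≠ 0

/-- The constant `p_n = 2n / (n - 2)`. -/
def critExp (n : ℕ) : ℝ := 2 * n / (n - 2)

/-- The constant `a_n = 4(n - 1) / (n - 2)`. -/
def gradConst (n : ℕ) : ℝ := 4 * (n - 1) / (n - 2)

/-- The `L^p`-norm `(∫ |v|^p dμ_g)^{1/p}`. -/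
def lpNorm (g : Metr n M) (p : ℝ) (v : M → ℝ) : ℝ :=
  (∫ x, |v x| ^ p ∂(riemMeasure g)) ^ (1 / p)

/-- The Yamabe functional
`E_g(v) = (∫ (a_n |dv|_g² + scal_g v²) dμ_g) / ‖v‖²_{L^p(g)}` with `p = p_n`. -/
def functional (g : Metr n M) (v : M → ℝ) : ℝ :=
  (∫ x, (gradConst n * normSqD g v x + scal g x * v x ^ 2) ∂(riemMeasure g)) /
    lpNorm g (critExp n) v ^ 2

/-- The Yamabe constant `Y_M(g)`, the infimum of the Yamabe functional over all test
functions; it may be `-∞`. -/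
def yam (g : Metr n M) : EReal :=
  ⨅ v : TestFunction n M, ((functional g v.toFun : ℝ) : EReal)

end Measure

end Manifold

end Yamabe

end

/-! For a fixed test function $v$, the number $E_g(v)$ involves only the restriction of $g$ to the
compact support of $v$. In a chart the scalar curvature is built from $g^{-1}$ and the derivatives
of $g$ of order at most two, so scalar curvature, gradient norm and measure vary continuously,
uniformly on compact sets, in the $C^2$-topology (`IsC2Family.eventually_isClose`). Hence $g\mapsto
E_g(v)$ is continuous (`IsC2Family.tendsto_functional`), and $Y_M$, an infimum of continuous
functions, is upper semicontinuous (`IsC2Family.eventually_yam_lt`).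

At a metric with $Y_M(g)=-\infty$ lower semicontinuity is vacuous. On a compact manifold the
comparison holds on all of $M$, uniformly in $v$. The gradient error is multiplicative, and the
curvature error is at most a multiple of $\varepsilon\int v^2$, which Hölder's inequality on a space
of finite volume bounds by $\|v\|_{L^p}^2$ (`exists_integral_sq_le`). So a lower bound for $E_{g_0}$
survives with a small loss (`IsC2Family.eventually_lt_yam`).

On a noncompact manifold the compact-open topologies do not control the ends. Outside any compact
set there is a coordinate patch in which $g$ can be replaced by $\sum_i c_i e^{2\lambda_i
y_o}dy_i^2$ with $\lambda_o=0$ and $\sum_i\lambda_i=0$. This metric has constant volume density and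
constant scalar curvature $-\sum_i\lambda_i^2/c_o$ (`scalCoord_diagMetric`). Large $\lambda$
followed by small $c_o$ drives the energy of one fixed bump function to $-\infty$
(`exists_functional_le`). Modifying $g$ off an exhaustion by compact sets gives metrics converging
to $g$ in every $C^k$ whose Yamabe constants tend to $-\infty$ (`exists_seq_tendsto_yam_le`), which
contradicts continuity at a metric with $Y_M(g)>-\infty$.

All of this is computed in arbitrary charts, while curvature and gradient norm are defined through
preferred charts and the measure as a supremum over charts. The independence of the chart comes from
the transformation laws `IsPullback.scalCoord_eq`, `IsPullback.normSqCoord_eq` and from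
`riemMeasure_restrict`. -/

noncomputable section

namespace Yamabe

/-! ### Partial derivatives -/

section PDeriv

variable {n : ℕ}

theorem pderiv_congr {i : Fin n} {f h : E n → ℝ} {y : E n} (hfh : f =ᶠ[𝓝 y] h) :
    pderiv i f y = pderiv i h y := by
  simp only [pderiv, hfh.fderiv_eq]

theorem pderiv_const (i : Fin n) (c : ℝ) (y : E n) : pderiv i (fun _ => c) y = 0 := by
  simp [pderiv]

theorem pderiv_add {i : Fin n} {f h : E n → ℝ} {y : E n} (hf : DifferentiableAt ℝ f y)
    (hh : DifferentiableAt ℝ h y) :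
    pderiv i (fun z => f z + h z) y = pderiv i f y + pderiv i h y := by
  simp only [pderiv]
  rw [fderiv_fun_add hf hh]; rfl

theorem pderiv_sub {i : Fin n} {f h : E n → ℝ} {y : E n} (hf : DifferentiableAt ℝ f y)
    (hh : DifferentiableAt ℝ h y) :
    pderiv i (fun z => f z - h z) y = pderiv i f y - pderiv i h y := by
  simp only [pderiv]
  rw [fderiv_fun_sub hf hh]; rfl

theorem pderiv_mul {i : Fin n} {f h : E n → ℝ} {y : E n} (hf : DifferentiableAt ℝ f y)
    (hh : DifferentiableAt ℝ h y) :
    pderiv i (fun z => f z * h z) y = pderiv i f y * h y + f y * pderiv i h y := by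
  simp only [pderiv]
  rw [fderiv_fun_mul hf hh]
  simp only [add_apply, smul_apply, smul_eq_mul]
  ring

theorem pderiv_const_mul {i : Fin n} {f : E n → ℝ} {y : E n} (c : ℝ)
    (hf : DifferentiableAt ℝ f y) :
    pderiv i (fun z => c * f z) y = c * pderiv i f y := by
  rw [pderiv_mul (by fun_prop) hf, pderiv_const]; ring

theorem pderiv_sum {ι : Type*} (s : Finset ι) {i : Fin n} {f : ι → E n → ℝ} {y : E n}
    (hf : ∀ a ∈ s, DifferentiableAt ℝ (f a) y) :
    pderiv i (fun z => ∑ a ∈ s, f a z) y = ∑ a ∈ s, pderiv i (f a) y := by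
  simp only [pderiv]
  rw [fderiv_fun_sum hf]
  simp

theorem sum_smul_basisVec (v : E n) : ∑ a, v a • basisVec a = v := by
  ext j
  simp [Finset.sum_apply, Pi.single_apply]

theorem fderiv_eq_sum_pderiv (f : E n → ℝ) (y v : E n) :
    fderiv ℝ f y v = ∑ a, v a * pderiv a f y := by
  conv_lhs => rw [← sum_smul_basisVec v]
  simp [pderiv, map_sum]

theorem pderiv_comp {i : Fin n} {f : E n → ℝ} {φ : E n → E n} {y : E n}
    (hf : DifferentiableAt ℝ f (φ y)) (hφ : DifferentiableAt ℝ φ y) :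
    pderiv i (fun z => f (φ z)) y =
      ∑ a, pderiv i (fun z => φ z a) y * pderiv a f (φ y) := by
  have h1 : pderiv i (fun z => f (φ z)) y = fderiv ℝ f (φ y) (fderiv ℝ φ y (basisVec i)) := by
    simp only [pderiv]
    rw [show (fun z => f (φ z)) = f ∘ φ from rfl, fderiv_comp _ hf hφ]; rfl
  rw [h1, fderiv_eq_sum_pderiv]
  refine Finset.sum_congr rfl fun a _ => ?_
  congr 1
  have h2 : HasFDerivAt (fun z => φ z a)
      ((EuclideanSpace.proj a : E n →L[ℝ] ℝ).comp (fderiv ℝ φ y)) y :=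
    (EuclideanSpace.proj a : E n →L[ℝ] ℝ).hasFDerivAt.comp y hφ.hasFDerivAt
  simp only [pderiv]
  rw [h2.fderiv]; rfl

theorem contDiffOn_pderiv {U : Set (E n)} (hU : IsOpen U) {f : E n → ℝ} (hf : ContDiffOn ℝ ∞ f U)
    (i : Fin n) : ContDiffOn ℝ ∞ (pderiv i f) U :=
  (hf.fderiv_of_isOpen hU (m := ∞) (by simp)).clm_apply contDiffOn_const

theorem differentiableAt_of_contDiffOn {F : Type*} [NormedAddCommGroup F] [NormedSpace ℝ F]
    {U : Set (E n)} (hU : IsOpen U) {f : E n → F} (hf : ContDiffOn ℝ ∞ f U) {y : E n}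
    (hy : y ∈ U) : DifferentiableAt ℝ f y :=
  ((hf y hy).contDiffAt (hU.mem_nhds hy)).differentiableAt (by simp)

theorem pderiv_pderiv {f : E n → ℝ} {y : E n} {U : Set (E n)} (hU : IsOpen U)
    (hf : ContDiffOn ℝ ∞ f U) (hy : y ∈ U) (i j : Fin n) :
    pderiv i (pderiv j f) y = fderiv ℝ (fderiv ℝ f) y (basisVec i) (basisVec j) := by
  have h : DifferentiableAt ℝ (fderiv ℝ f) y :=
    differentiableAt_of_contDiffOn hU (hf.fderiv_of_isOpen hU (m := ∞) (by simp)) hy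
  have h2 : HasFDerivAt (fun z => fderiv ℝ f z (basisVec j)) _ y :=
    h.hasFDerivAt.clm_apply (hasFDerivAt_const (basisVec j) y)
  have h3 : pderiv j f = fun z => fderiv ℝ f z (basisVec j) := rfl
  rw [h3]
  conv_lhs => rw [pderiv]
  rw [h2.fderiv]
  simp

theorem pderiv_comm {f : E n → ℝ} {y : E n} {U : Set (E n)} (hU : IsOpen U)
    (hf : ContDiffOn ℝ ∞ f U) (hy : y ∈ U) (i j : Fin n) :
    pderiv i (pderiv j f) y = pderiv j (pderiv i f) y := by
  rw [pderiv_pderiv hU hf hy, pderiv_pderiv hU hf hy]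
  have h : ContDiffAt ℝ ∞ f y := (hf y hy).contDiffAt (hU.mem_nhds hy)
  exact (h.isSymmSndFDerivAt (by
    simpa using WithTop.coe_le_coe.2 (le_top : (2 : ℕ∞) ≤ ⊤))).eq _ _

end PDeriv

/-! ### Entrywise derivatives of matrix-valued functions -/

section MatrixDeriv

variable {n : ℕ}

/-- The entrywise partial derivative of a matrix-valued function. -/
def matD (i : Fin n) (A : E n → Matrix (Fin n) (Fin n) ℝ) (y : E n) : Matrix (Fin n) (Fin n) ℝ :=
  Matrix.of fun a b => pderiv i (fun z => A z a b) y

/-- Entrywise differentiability of a matrix-valued function. -/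
def MatDiffAt (A : E n → Matrix (Fin n) (Fin n) ℝ) (y : E n) : Prop :=
  ∀ a b, DifferentiableAt ℝ (fun z => A z a b) y

theorem MatDiffAt.mul {A B : E n → Matrix (Fin n) (Fin n) ℝ} {y : E n} (hA : MatDiffAt A y)
    (hB : MatDiffAt B y) : MatDiffAt (fun z => A z * B z) y := by
  intro a b
  simp only [Matrix.mul_apply]
  exact DifferentiableAt.fun_sum fun c _ => (hA a c).fun_mul (hB c b)

theorem matD_congr {i : Fin n} {A B : E n → Matrix (Fin n) (Fin n) ℝ} {y : E n}
    (h : A =ᶠ[𝓝 y] B) : matD i A y = matD i B y := by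
  ext a b
  exact pderiv_congr (h.mono fun z hz => by simp only [hz])

theorem matD_add {i : Fin n} {A B : E n → Matrix (Fin n) (Fin n) ℝ} {y : E n} (hA : MatDiffAt A y)
    (hB : MatDiffAt B y) : matD i (fun z => A z + B z) y = matD i A y + matD i B y := by
  ext a b
  exact pderiv_add (hA a b) (hB a b)

theorem matD_mul {i : Fin n} {A B : E n → Matrix (Fin n) (Fin n) ℝ} {y : E n} (hA : MatDiffAt A y)
    (hB : MatDiffAt B y) :
    matD i (fun z => A z * B z) y = matD i A y * B y + A y * matD i B y := by
  ext a b
  simp only [matD, Matrix.mul_apply, Matrix.of_apply, Matrix.add_apply]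
  rw [pderiv_sum _ fun c _ => (hA a c).fun_mul (hB c b), ← Finset.sum_add_distrib]
  exact Finset.sum_congr rfl fun c _ => pderiv_mul (hA a c) (hB c b)

end MatrixDeriv

/-! ### Coordinate metrics -/

section CoordMetric

variable {n : ℕ}

/-- The matrix of the coefficients of a metric in coordinates. -/
def gram (G : Fin n → Fin n → E n → ℝ) (y : E n) : Matrix (Fin n) (Fin n) ℝ :=
  Matrix.of fun a b => G a b y

/-- A smooth Riemannian metric on an open subset of `ℝⁿ`. -/
structure IsCoordMetric (G : Fin n → Fin n → E n → ℝ) (U : Set (E n)) : Prop where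
  isOpen : IsOpen U
  smooth : ∀ i j, ContDiffOn ℝ ∞ (G i j) U
  symm : ∀ y ∈ U, ∀ i j, G i j y = G j i y
  posDef : ∀ y ∈ U, (gram G y).PosDef

/-- The matrix `(Γ^k_{ij})_{k,i}`. -/
def chr (G : Fin n → Fin n → E n → ℝ) (j : Fin n) (y : E n) : Matrix (Fin n) (Fin n) ℝ :=
  Matrix.of fun k i => christoffel G k i j y

/-- The Christoffel symbols of the first kind. -/
def chrLow (G : Fin n → Fin n → E n → ℝ) (i : Fin n) (y : E n) : Matrix (Fin n) (Fin n) ℝ :=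
  Matrix.of fun l j => (1 / 2 : ℝ) * (pderiv i (G j l) y + pderiv j (G i l) y - pderiv l (G i j) y)

/-- The curvature matrices `∂_k Γ_j - ∂_j Γ_k + [Γ_k, Γ_j]`. -/
def curv (G : Fin n → Fin n → E n → ℝ) (k j : Fin n) (y : E n) : Matrix (Fin n) (Fin n) ℝ :=
  matD k (chr G j) y - matD j (chr G k) y + (chr G k y * chr G j y - chr G j y * chr G k y)

theorem invCoeff_eq (G : Fin n → Fin n → E n → ℝ) (i j : Fin n) (y : E n) :
    invCoeff G i j y = (gram G y)⁻¹ i j := rfl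

namespace IsCoordMetric

variable {G : Fin n → Fin n → E n → ℝ} {U : Set (E n)}

theorem differentiableAt (hG : IsCoordMetric G U) {y : E n} (hy : y ∈ U) (i j : Fin n) :
    DifferentiableAt ℝ (G i j) y :=
  differentiableAt_of_contDiffOn hG.isOpen (hG.smooth i j) hy

theorem det_pos (hG : IsCoordMetric G U) {y : E n} (hy : y ∈ U) : 0 < (gram G y).det :=
  (hG.posDef y hy).det_pos

theorem isUnit_det (hG : IsCoordMetric G U) {y : E n} (hy : y ∈ U) : IsUnit (gram G y).det :=
  (hG.det_pos hy).ne'.isUnit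

theorem mono (hG : IsCoordMetric G U) {V : Set (E n)} (hV : IsOpen V) (hVU : V ⊆ U) :
    IsCoordMetric G V :=
  ⟨hV, fun i j => (hG.smooth i j).mono hVU, fun y hy => hG.symm y (hVU hy),
    fun y hy => hG.posDef y (hVU hy)⟩

theorem pderiv_symm (hG : IsCoordMetric G U) {y : E n} (hy : y ∈ U) (k i j : Fin n) :
    pderiv k (G i j) y = pderiv k (G j i) y :=
  pderiv_congr (Filter.mem_of_superset (hG.isOpen.mem_nhds hy) fun z hz => hG.symm z hz i j)

theorem contDiffOn_det (hG : IsCoordMetric G U) :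
    ContDiffOn ℝ ∞ (fun y => (gram G y).det) U := by
  simp only [Matrix.det_apply, gram, Matrix.of_apply]
  refine ContDiffOn.sum fun σ _ => ?_
  exact (contDiffOn_prod fun i _ => hG.smooth _ _).const_smul _

theorem contDiffOn_invCoeff (hG : IsCoordMetric G U) (i j : Fin n) :
    ContDiffOn ℝ ∞ (invCoeff G i j) U := by
  have h : ∀ y ∈ U, invCoeff G i j y = ((gram G y).det)⁻¹ * (gram G y).adjugate i j := by
    intro y hy
    rw [invCoeff_eq, Matrix.inv_def, Matrix.smul_apply, Ring.inverse_eq_inv', smul_eq_mul]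
  refine ContDiffOn.congr ?_ h
  refine (hG.contDiffOn_det.inv fun y hy => (hG.det_pos hy).ne').mul ?_
  simp only [Matrix.adjugate_apply, Matrix.det_apply, gram]
  refine ContDiffOn.sum fun σ _ => ?_
  refine (contDiffOn_prod fun k _ => ?_).const_smul _
  simp only [Matrix.updateRow_apply]
  split_ifs
  · exact contDiffOn_const
  · exact hG.smooth _ _

theorem contDiffOn_christoffel (hG : IsCoordMetric G U) (k i j : Fin n) :
    ContDiffOn ℝ ∞ (christoffel G k i j) U := by
  refine contDiffOn_const.mul (ContDiffOn.sum fun l _ => (hG.contDiffOn_invCoeff k l).mul ?_)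
  exact ((contDiffOn_pderiv hG.isOpen (hG.smooth _ _) _).add
    (contDiffOn_pderiv hG.isOpen (hG.smooth _ _) _)).sub
    (contDiffOn_pderiv hG.isOpen (hG.smooth _ _) _)

theorem contDiffOn_ricci (hG : IsCoordMetric G U) (i j : Fin n) :
    ContDiffOn ℝ ∞ (ricci G i j) U := by
  have hc := hG.contDiffOn_christoffel
  refine (ContDiffOn.sum fun k _ => ?_).add
    (ContDiffOn.sum fun k _ => ContDiffOn.sum fun l _ => ?_)
  · exact (contDiffOn_pderiv hG.isOpen (hc _ _ _) _).sub
      (contDiffOn_pderiv hG.isOpen (hc _ _ _) _)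
  · exact ((hc _ _ _).mul (hc _ _ _)).sub ((hc _ _ _).mul (hc _ _ _))

theorem contDiffOn_scalCoord (hG : IsCoordMetric G U) : ContDiffOn ℝ ∞ (scalCoord G) U :=
  ContDiffOn.sum fun i _ => ContDiffOn.sum fun j _ =>
    (hG.contDiffOn_invCoeff i j).mul (hG.contDiffOn_ricci i j)

theorem matDiffAt_chr (hG : IsCoordMetric G U) {y : E n} (hy : y ∈ U) (j : Fin n) :
    MatDiffAt (chr G j) y :=
  fun k i => differentiableAt_of_contDiffOn hG.isOpen (hG.contDiffOn_christoffel k i j) hy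

theorem christoffel_symm (hG : IsCoordMetric G U) {y : E n} (hy : y ∈ U) (k i j : Fin n) :
    christoffel G k i j y = christoffel G k j i y := by
  simp only [christoffel]
  congr 1
  refine Finset.sum_congr rfl fun l _ => ?_
  rw [hG.pderiv_symm hy l i j]
  ring

/-- Writing Ricci as a contraction of matrix-valued curvature replaces index bookkeeping by matrix
algebra in the change of coordinates. The symmetry of the Christoffel symbols matches the index
order used in `chr`. -/
theorem ricci_eq (hG : IsCoordMetric G U) {y : E n} (hy : y ∈ U) (i j : Fin n) :
    ricci G i j y = ∑ k, curv G k j y k i := by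
  simp only [ricci, curv, Matrix.add_apply, Matrix.sub_apply, Matrix.mul_apply, matD, chr,
    Matrix.of_apply]
  rw [Finset.sum_add_distrib]
  congr 1
  refine Finset.sum_congr rfl fun k _ => ?_
  rw [← Finset.sum_sub_distrib]
  refine Finset.sum_congr rfl fun l _ => ?_
  rw [hG.christoffel_symm hy k l k, hG.christoffel_symm hy l i j, hG.christoffel_symm hy k l j,
    hG.christoffel_symm hy l i k, hG.christoffel_symm hy l j i, hG.christoffel_symm hy l k i]

theorem chr_eq (hG : IsCoordMetric G U) {y : E n} (hy : y ∈ U) (j : Fin n) :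
    chr G j y = (gram G y)⁻¹ * chrLow G j y := by
  ext k i
  simp only [chr, Matrix.of_apply, Matrix.mul_apply, chrLow]
  rw [hG.christoffel_symm hy]
  simp only [christoffel, invCoeff_eq, Finset.mul_sum]
  exact Finset.sum_congr rfl fun l _ => by ring

theorem gram_mul_chr (hG : IsCoordMetric G U) {y : E n} (hy : y ∈ U) (j : Fin n) :
    gram G y * chr G j y = chrLow G j y := by
  rw [hG.chr_eq hy, ← Matrix.mul_assoc, Matrix.mul_nonsing_inv _ (hG.isUnit_det hy),
    Matrix.one_mul]

end IsCoordMetric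

end CoordMetric

/-! ### Change of coordinates -/

section Pullback

variable {n : ℕ}

/-- The Jacobian matrix. -/
def jac (φ : E n → E n) (y : E n) : Matrix (Fin n) (Fin n) ℝ :=
  Matrix.of fun a i => pderiv i (fun z => φ z a) y

/-- The metric `G` on `U` is the pullback of the metric `H` on `V` under the local
diffeomorphism `φ`. -/
structure IsPullback (φ : E n → E n) (G : Fin n → Fin n → E n → ℝ) (U : Set (E n))
    (H : Fin n → Fin n → E n → ℝ) (V : Set (E n)) : Prop where
  left : IsCoordMetric G U
  right : IsCoordMetric H V
  smooth : ContDiffOn ℝ ∞ φ U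
  mapsTo : Set.MapsTo φ U V
  gram_eq : ∀ y ∈ U, gram G y = (jac φ y).transpose * gram H (φ y) * jac φ y

namespace IsPullback

variable {φ : E n → E n} {G H : Fin n → Fin n → E n → ℝ} {U V : Set (E n)}

theorem contDiffOn_coord (h : IsPullback φ G U H V) (a : Fin n) :
    ContDiffOn ℝ ∞ (fun z => φ z a) U :=
  (EuclideanSpace.proj a : E n →L[ℝ] ℝ).contDiff.comp_contDiffOn h.smooth

theorem contDiffOn_jac (h : IsPullback φ G U H V) (a i : Fin n) :
    ContDiffOn ℝ ∞ (fun z => jac φ z a i) U :=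
  contDiffOn_pderiv h.left.isOpen (h.contDiffOn_coord a) i

theorem matDiffAt_jac (h : IsPullback φ G U H V) {y : E n} (hy : y ∈ U) : MatDiffAt (jac φ) y :=
  fun a i => differentiableAt_of_contDiffOn h.left.isOpen (h.contDiffOn_jac a i) hy

theorem matD_jac_symm (h : IsPullback φ G U H V) {y : E n} (hy : y ∈ U) (i j a : Fin n) :
    matD i (jac φ) y a j = matD j (jac φ) y a i :=
  pderiv_comm h.left.isOpen (h.contDiffOn_coord a) hy i j

theorem pderiv_comp (h : IsPullback φ G U H V) {y : E n} (hy : y ∈ U) {f : E n → ℝ}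
    (hf : DifferentiableAt ℝ f (φ y)) (i : Fin n) :
    pderiv i (fun z => f (φ z)) y = ∑ a, jac φ y a i * pderiv a f (φ y) :=
  Yamabe.pderiv_comp hf (differentiableAt_of_contDiffOn h.left.isOpen h.smooth hy)

theorem isUnit_det_jac (h : IsPullback φ G U H V) {y : E n} (hy : y ∈ U) :
    IsUnit (jac φ y).det := by
  have h1 := (h.left.det_pos hy).ne'
  rw [h.gram_eq y hy, Matrix.det_mul] at h1
  exact (right_ne_zero_of_mul h1).isUnit

theorem coeff_eq (h : IsPullback φ G U H V) {y : E n} (hy : y ∈ U) (i j : Fin n) :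
    G i j y = ∑ a, ∑ b, jac φ y a i * jac φ y b j * H a b (φ y) := by
  have := congrFun (congrFun (h.gram_eq y hy) i) j
  simp only [gram, Matrix.of_apply, Matrix.mul_apply, Matrix.transpose_apply,
    Finset.sum_mul] at this
  rw [this, Finset.sum_comm]
  exact Finset.sum_congr rfl fun a _ => Finset.sum_congr rfl fun b _ => by ring

/-- Product and chain rule applied to $G=J^{T}(H\circ\varphi)J$. The symmetry of $H$ gives both sums
with second derivatives of $\varphi$ the same shape, so that they can cancel later. -/
theorem pderiv_coeff (h : IsPullback φ G U H V) {y : E n} (hy : y ∈ U) (i j l : Fin n) :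
    pderiv i (G j l) y =
      (∑ a, ∑ b, matD i (jac φ) y a j * jac φ y b l * H a b (φ y)) +
      (∑ a, ∑ b, matD i (jac φ) y a l * jac φ y b j * H a b (φ y)) +
      ∑ a, ∑ b, ∑ c, jac φ y c i * jac φ y a j * jac φ y b l * pderiv c (H a b) (φ y) := by
  have hφ := differentiableAt_of_contDiffOn h.left.isOpen h.smooth hy
  have hH : ∀ a b, DifferentiableAt ℝ (fun z => H a b (φ z)) y := fun a b =>
    (h.right.differentiableAt (h.mapsTo hy) a b).comp y hφ
  have hJ := h.matDiffAt_jac hy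
  have h1 : pderiv i (G j l) y =
      pderiv i (fun z => ∑ a, ∑ b, jac φ z a j * jac φ z b l * H a b (φ z)) y :=
    pderiv_congr (Filter.mem_of_superset (h.left.isOpen.mem_nhds hy)
      fun z hz => h.coeff_eq hz j l)
  have h2 : ∀ a b, DifferentiableAt ℝ (fun z => jac φ z a j * jac φ z b l) y :=
    fun a b => (hJ a j).fun_mul (hJ b l)
  have hsw : (∑ a, ∑ b, matD i (jac φ) y a l * jac φ y b j * H a b (φ y)) =
      ∑ a, ∑ b, jac φ y a j * matD i (jac φ) y b l * H a b (φ y) := by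
    rw [Finset.sum_comm]
    refine Finset.sum_congr rfl fun a _ => Finset.sum_congr rfl fun b _ => ?_
    rw [h.right.symm _ (h.mapsTo hy) b a]; ring
  rw [h1, pderiv_sum _ fun a _ => DifferentiableAt.fun_sum fun b _ => (h2 a b).fun_mul (hH a b),
    hsw, ← Finset.sum_add_distrib, ← Finset.sum_add_distrib]
  refine Finset.sum_congr rfl fun a _ => ?_
  rw [pderiv_sum _ fun b _ => (h2 a b).fun_mul (hH a b), ← Finset.sum_add_distrib,
    ← Finset.sum_add_distrib]
  refine Finset.sum_congr rfl fun b _ => ?_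
  rw [pderiv_mul (h2 a b) (hH a b), pderiv_mul (hJ a j) (hJ b l),
    h.pderiv_comp hy (h.right.differentiableAt (h.mapsTo hy) a b) i, Finset.mul_sum]
  simp only [matD, Matrix.of_apply]
  rw [add_mul]
  congr 1
  exact Finset.sum_congr rfl fun c _ => by ring

/-- The connection matrices of `H`, pulled back as a matrix-valued one-form. -/
def conn (φ : E n → E n) (H : Fin n → Fin n → E n → ℝ) (i : Fin n) (y : E n) :
    Matrix (Fin n) (Fin n) ℝ :=
  ∑ a, jac φ y a i • chr H a (φ y)

/-- In the alternating sum of three derivatives of $G$, the terms with second derivatives of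
$\varphi$ cancel in pairs because mixed partials commute; only one matching pair survives and
absorbs the factor ½. Lowering the index avoids differentiating or inverting anything else. -/
theorem chrLow_eq (h : IsPullback φ G U H V) {y : E n} (hy : y ∈ U) (i : Fin n) :
    chrLow G i y = (jac φ y).transpose * gram H (φ y) * matD i (jac φ) y +
      ∑ c, jac φ y c i • ((jac φ y).transpose * chrLow H c (φ y) * jac φ y) := by
  ext l j
  have hT : ((jac φ y).transpose * gram H (φ y) * matD i (jac φ) y) l j =
      ∑ a, ∑ b, matD i (jac φ) y a j * jac φ y b l * H a b (φ y) := by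
    simp only [gram, Matrix.of_apply, Matrix.mul_apply, Matrix.transpose_apply, Finset.sum_mul]
    refine Finset.sum_congr rfl fun a _ => Finset.sum_congr rfl fun b _ => ?_
    rw [h.right.symm _ (h.mapsTo hy) b a]; ring
  have hB : (∑ c, jac φ y c i • ((jac φ y).transpose * chrLow H c (φ y) * jac φ y)) l j =
      ∑ a, ∑ b, ∑ c, (1 / 2 : ℝ) * (jac φ y c i * jac φ y a j * jac φ y b l *
        (pderiv c (H a b) (φ y) + pderiv a (H c b) (φ y) - pderiv b (H c a) (φ y))) := by
    simp only [Matrix.sum_apply, Matrix.smul_apply, Matrix.mul_apply, Matrix.transpose_apply,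
      chrLow, Matrix.of_apply, smul_eq_mul, Finset.sum_mul, Finset.mul_sum]
    rw [Finset.sum_comm]
    refine Finset.sum_congr rfl fun a _ => ?_
    rw [Finset.sum_comm]
    exact Finset.sum_congr rfl fun b _ => Finset.sum_congr rfl fun c _ => by ring
  have hB2 : (∑ a, ∑ b, ∑ c, jac φ y c j * jac φ y a i * jac φ y b l * pderiv c (H a b) (φ y)) =
      ∑ a, ∑ b, ∑ c, jac φ y c i * jac φ y a j * jac φ y b l * pderiv a (H c b) (φ y) := by
    rw [Finset.sum_congr rfl fun a _ => Finset.sum_comm, Finset.sum_comm]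
    refine Finset.sum_congr rfl fun a _ => ?_
    rw [Finset.sum_comm]
    exact Finset.sum_congr rfl fun b _ => Finset.sum_congr rfl fun c _ => by ring
  have hB3 : (∑ a, ∑ b, ∑ c, jac φ y c l * jac φ y a i * jac φ y b j * pderiv c (H a b) (φ y)) =
      ∑ a, ∑ b, ∑ c, jac φ y c i * jac φ y a j * jac φ y b l * pderiv b (H c a) (φ y) := by
    rw [Finset.sum_comm]
    refine Finset.sum_congr rfl fun a _ => ?_
    rw [Finset.sum_comm]
    exact Finset.sum_congr rfl fun b _ => Finset.sum_congr rfl fun c _ => by ring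
  have hP : ∀ i j l, (∑ a, ∑ b, matD i (jac φ) y a j * jac φ y b l * H a b (φ y)) =
      ∑ a, ∑ b, matD j (jac φ) y a i * jac φ y b l * H a b (φ y) := fun i j l =>
    Finset.sum_congr rfl fun a _ => Finset.sum_congr rfl fun b _ => by
      rw [h.matD_jac_symm hy i j a]
  rw [Matrix.add_apply, hT, hB]
  simp only [chrLow, Matrix.of_apply]
  rw [h.pderiv_coeff hy i j l, h.pderiv_coeff hy j i l, h.pderiv_coeff hy l i j, hB2, hB3,
    hP j i l, hP l i j, hP l j i]
  simp only [← Finset.mul_sum, mul_add, mul_sub, Finset.sum_add_distrib, Finset.sum_sub_distrib]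
  ring

/-- The transformation law of the Christoffel symbols. -/
theorem jac_mul_chr (h : IsPullback φ G U H V) {y : E n} (hy : y ∈ U) (i : Fin n) :
    jac φ y * chr G i y = matD i (jac φ) y + conn φ H i y * jac φ y := by
  -- The matrix $J^{T}H$ is invertible, so the law may be checked after lowering the upper index,
  -- where `chrLow_eq` applies.
  have hu : IsUnit (((jac φ y).transpose * gram H (φ y))).det := by
    rw [Matrix.det_mul, Matrix.det_transpose]
    exact (h.isUnit_det_jac hy).mul (h.right.isUnit_det (h.mapsTo hy))
  have key : ((jac φ y).transpose * gram H (φ y)) * (jac φ y * chr G i y) =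
      ((jac φ y).transpose * gram H (φ y)) * (matD i (jac φ) y + conn φ H i y * jac φ y) := by
    rw [← Matrix.mul_assoc, ← h.gram_eq y hy, h.left.gram_mul_chr hy, h.chrLow_eq hy,
      Matrix.mul_add]
    congr 1
    rw [conn, Finset.sum_mul, Finset.mul_sum]
    refine Finset.sum_congr rfl fun c _ => ?_
    rw [← h.right.gram_mul_chr (h.mapsTo hy)]
    simp only [Matrix.mul_assoc, Matrix.smul_mul, Matrix.mul_smul]
  have := congrArg (((jac φ y).transpose * gram H (φ y))⁻¹ * ·) key
  simpa only [Matrix.nonsing_inv_mul_cancel_left _ _ hu] using this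

end IsPullback

end Pullback

/-! ### Transformation of curvature, contractions and volume density -/

section Pullback

variable {n : ℕ}

namespace IsPullback

variable {φ : E n → E n} {G H : Fin n → Fin n → E n → ℝ} {U V : Set (E n)}

theorem matDiffAt_chr_comp (h : IsPullback φ G U H V) {y : E n} (hy : y ∈ U) (a : Fin n) :
    MatDiffAt (fun z => chr H a (φ z)) y := fun k i =>
  (h.right.matDiffAt_chr (h.mapsTo hy) a k i).comp y
    (differentiableAt_of_contDiffOn h.left.isOpen h.smooth hy)

theorem matDiffAt_conn (h : IsPullback φ G U H V) {y : E n} (hy : y ∈ U) (i : Fin n) :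
    MatDiffAt (conn φ H i) y := by
  intro a b
  simp only [conn, Matrix.sum_apply, Matrix.smul_apply, smul_eq_mul]
  exact DifferentiableAt.fun_sum fun c _ =>
    (h.matDiffAt_jac hy c i).fun_mul (h.matDiffAt_chr_comp hy c a b)

theorem matD_conn (h : IsPullback φ G U H V) {y : E n} (hy : y ∈ U) (k j : Fin n) :
    matD k (conn φ H j) y = (∑ a, matD k (jac φ) y a j • chr H a (φ y)) +
      ∑ b, ∑ a, (jac φ y b k * jac φ y a j) • matD b (chr H a) (φ y) := by
  ext p q
  have hd : ∀ a, DifferentiableAt ℝ (fun z => chr H a (φ z) p q) y := fun a =>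
    h.matDiffAt_chr_comp hy a p q
  have h1 : (∑ b, ∑ a, (jac φ y b k * jac φ y a j) • matD b (chr H a) (φ y)) p q =
      ∑ a, jac φ y a j * pderiv k (fun z => chr H a (φ z) p q) y := by
    simp only [Matrix.sum_apply, Matrix.smul_apply, smul_eq_mul]
    rw [Finset.sum_comm]
    refine Finset.sum_congr rfl fun a _ => ?_
    rw [h.pderiv_comp hy (f := fun w => chr H a w p q)
      (h.right.matDiffAt_chr (h.mapsTo hy) a p q) k, Finset.mul_sum]
    refine Finset.sum_congr rfl fun b _ => ?_
    simp only [matD, Matrix.of_apply]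
    ring
  rw [Matrix.add_apply, h1]
  simp only [Matrix.sum_apply, Matrix.smul_apply, smul_eq_mul]
  rw [← Finset.sum_add_distrib]
  have h2 : matD k (conn φ H j) y p q =
      pderiv k (fun z => ∑ a, jac φ z a j * chr H a (φ z) p q) y := by
    simp only [matD, conn, Matrix.of_apply, Matrix.sum_apply, Matrix.smul_apply, smul_eq_mul]
  rw [h2, pderiv_sum _ fun a _ => (h.matDiffAt_jac hy a j).fun_mul (hd a)]
  exact Finset.sum_congr rfl fun a _ => pderiv_mul (h.matDiffAt_jac hy a j) (hd a)

theorem conn_mul_conn (φ : E n → E n) (H : Fin n → Fin n → E n → ℝ) (k j : Fin n) (y : E n) :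
    conn φ H k y * conn φ H j y =
      ∑ b, ∑ a, (jac φ y b k * jac φ y a j) • (chr H b (φ y) * chr H a (φ y)) := by
  simp only [conn, Finset.sum_mul, Finset.mul_sum, Matrix.smul_mul, Matrix.mul_smul, smul_smul]
  rw [Finset.sum_comm]
  exact Finset.sum_congr rfl fun b _ => Finset.sum_congr rfl fun a _ => by rw [mul_comm]

/-- The curvature $dA+A\wedge A$ commutes with pulling back the connection form: the only extra
terms carry second derivatives of $\varphi$, and these drop out under antisymmetrization in $k,j$.
-/
theorem curv_conn (h : IsPullback φ G U H V) {y : E n} (hy : y ∈ U) (k j : Fin n) :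
    matD k (conn φ H j) y - matD j (conn φ H k) y +
      (conn φ H k y * conn φ H j y - conn φ H j y * conn φ H k y) =
      ∑ b, ∑ a, (jac φ y b k * jac φ y a j) • curv H b a (φ y) := by
  have h1 : (∑ b, ∑ a, (jac φ y b j * jac φ y a k) • matD b (chr H a) (φ y)) =
      ∑ b, ∑ a, (jac φ y b k * jac φ y a j) • matD a (chr H b) (φ y) := by
    rw [Finset.sum_comm]
    exact Finset.sum_congr rfl fun b _ => Finset.sum_congr rfl fun a _ => by rw [mul_comm]
  have h2 : (∑ b, ∑ a, (jac φ y b j * jac φ y a k) • (chr H b (φ y) * chr H a (φ y))) =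
      ∑ b, ∑ a, (jac φ y b k * jac φ y a j) • (chr H a (φ y) * chr H b (φ y)) := by
    rw [Finset.sum_comm]
    exact Finset.sum_congr rfl fun b _ => Finset.sum_congr rfl fun a _ => by rw [mul_comm]
  have h3 : (∑ a, matD k (jac φ) y a j • chr H a (φ y)) =
      ∑ a, matD j (jac φ) y a k • chr H a (φ y) :=
    Finset.sum_congr rfl fun a _ => by rw [h.matD_jac_symm hy]
  rw [h.matD_conn hy, h.matD_conn hy, conn_mul_conn, conn_mul_conn, h1, h2, h3]
  simp only [curv, smul_add, smul_sub, Finset.sum_add_distrib, Finset.sum_sub_distrib]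
  abel

/-- The transformation law of the curvature. -/
theorem jac_mul_curv (h : IsPullback φ G U H V) {y : E n} (hy : y ∈ U) (k j : Fin n) :
    jac φ y * curv G k j y =
      (∑ b, ∑ a, (jac φ y b k * jac φ y a j) • curv H b a (φ y)) * jac φ y := by
  have hU := h.left.isOpen.mem_nhds hy
  have hJ := h.matDiffAt_jac hy
  have hDJ : ∀ i, MatDiffAt (matD i (jac φ)) y := fun i a b =>
    differentiableAt_of_contDiffOn h.left.isOpen
      (contDiffOn_pderiv h.left.isOpen (h.contDiffOn_jac a b) i) hy
  have hcomm : matD k (matD j (jac φ)) y = matD j (matD k (jac φ)) y := by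
    ext a b
    exact pderiv_comm h.left.isOpen (h.contDiffOn_jac a b) hy k j
  -- Differentiate the Christoffel law $J\Gamma_j=\partial_jJ+A_jJ$ in direction $k$.
  -- Antisymmetrizing then removes the second derivatives of $J$.
  have law : ∀ k j, matD k (jac φ) y * chr G j y + jac φ y * matD k (chr G j) y =
      matD k (matD j (jac φ)) y + (matD k (conn φ H j) y * jac φ y +
        conn φ H j y * matD k (jac φ) y) := by
    intro k j
    rw [← matD_mul hJ (h.left.matDiffAt_chr hy j), ← matD_mul (h.matDiffAt_conn hy j) hJ,
      ← matD_add (hDJ j) ((h.matDiffAt_conn hy j).mul hJ)]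
    exact matD_congr (Filter.mem_of_superset hU fun z hz => h.jac_mul_chr hz j)
  have e1 : jac φ y * matD k (chr G j) y = matD j (matD k (jac φ)) y +
      (matD k (conn φ H j) y * jac φ y + conn φ H j y * matD k (jac φ) y) -
        matD k (jac φ) y * chr G j y := by
    rw [← hcomm, ← law k j]; abel
  have e2 : jac φ y * matD j (chr G k) y = matD j (matD k (jac φ)) y +
      (matD j (conn φ H k) y * jac φ y + conn φ H k y * matD j (jac φ) y) -
        matD j (jac φ) y * chr G k y := by
    rw [← law j k]; abel
  -- Eliminating the first derivatives of $J$ as well leaves an identity in $J$, $\Gamma$, $A$ and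
  -- the derivatives of $A$: a gauge transformation of curvature.
  have d : ∀ i, matD i (jac φ) y = jac φ y * chr G i y - conn φ H i y * jac φ y := fun i => by
    rw [h.jac_mul_chr hy]; abel
  rw [← h.curv_conn hy, curv, mul_add, mul_sub, e1, e2, d k, d j]
  noncomm_ring

/-- The curvature matrices are conjugated by $J$ and pulled back in their two form indices. In the
Ricci contraction the factor $J^{-1}$ from the conjugation meets the $J$ of the form index $k$
(`hinv`), so only the two covariant factors remain. -/
theorem ricci_eq (h : IsPullback φ G U H V) {y : E n} (hy : y ∈ U) (i j : Fin n) :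
    ricci G i j y = ∑ d, ∑ a, jac φ y d i * jac φ y a j * ricci H d a (φ y) := by
  have hu := h.isUnit_det_jac hy
  have hinv : ∀ b c, ∑ k, jac φ y b k * (jac φ y)⁻¹ k c = (1 : Matrix (Fin n) (Fin n) ℝ) b c :=
    fun b c => by rw [← Matrix.mul_nonsing_inv _ hu, Matrix.mul_apply]
  have h1 : ∀ k, curv G k j y = (jac φ y)⁻¹ *
      ((∑ b, ∑ a, (jac φ y b k * jac φ y a j) • curv H b a (φ y)) * jac φ y) := fun k => by
    rw [← h.jac_mul_curv hy, Matrix.nonsing_inv_mul_cancel_left _ _ hu]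
  have h2 : ∀ k, curv G k j y k i = ∑ c, ∑ d, ∑ b, ∑ a, (jac φ y b k * (jac φ y)⁻¹ k c) *
      (jac φ y d i * jac φ y a j * curv H b a (φ y) c d) := fun k => by
    rw [h1 k]
    simp only [Matrix.mul_apply, Matrix.sum_apply, Matrix.smul_apply, smul_eq_mul,
      Finset.mul_sum, Finset.sum_mul]
    refine Finset.sum_congr rfl fun c _ => ?_
    rw [Finset.sum_congr rfl fun b _ => Finset.sum_comm, Finset.sum_comm]
    exact Finset.sum_congr rfl fun d _ => Finset.sum_congr rfl fun b _ =>
      Finset.sum_congr rfl fun a _ => by ring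
  rw [h.left.ricci_eq hy]
  simp only [h2]
  rw [Finset.sum_comm]
  have h3 : ∀ c, (∑ k, ∑ d, ∑ b, ∑ a, (jac φ y b k * (jac φ y)⁻¹ k c) *
      (jac φ y d i * jac φ y a j * curv H b a (φ y) c d)) =
      ∑ d, ∑ a, jac φ y d i * jac φ y a j * curv H c a (φ y) c d := by
    intro c
    rw [Finset.sum_comm]
    refine Finset.sum_congr rfl fun d _ => ?_
    rw [Finset.sum_comm]
    simp only [← Finset.mul_sum]
    simp only [← Finset.sum_mul, hinv, Matrix.one_apply, ite_mul, one_mul, zero_mul,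
      Finset.sum_ite_eq', Finset.mem_univ, if_true]
  simp only [h3]
  rw [Finset.sum_comm]
  refine Finset.sum_congr rfl fun d _ => ?_
  rw [Finset.sum_comm]
  refine Finset.sum_congr rfl fun a _ => ?_
  rw [h.right.ricci_eq (h.mapsTo hy), Finset.mul_sum]

theorem jac_mul_inv_mul (h : IsPullback φ G U H V) {y : E n} (hy : y ∈ U) :
    jac φ y * (gram G y)⁻¹ * (jac φ y).transpose = (gram H (φ y))⁻¹ := by
  have hu := h.isUnit_det_jac hy
  have hut : IsUnit (jac φ y).transpose.det := by rwa [Matrix.det_transpose]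
  rw [h.gram_eq y hy, Matrix.mul_inv_rev, Matrix.mul_inv_rev,
    Matrix.mul_nonsing_inv_cancel_left _ _ hu, Matrix.mul_assoc, Matrix.nonsing_inv_mul _ hut,
    Matrix.mul_one]

/-- Contraction with the inverse metric is invariant. -/
theorem contract (h : IsPullback φ G U H V) {y : E n} (hy : y ∈ U) (T : Fin n → Fin n → ℝ) :
    ∑ i, ∑ j, invCoeff G i j y * ∑ d, ∑ a, jac φ y d i * jac φ y a j * T d a =
      ∑ d, ∑ a, invCoeff H d a (φ y) * T d a := by
  have h1 : ∀ d a, invCoeff H d a (φ y) =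
      ∑ i, ∑ j, jac φ y d i * (gram G y)⁻¹ i j * jac φ y a j := fun d a => by
    rw [invCoeff_eq, ← h.jac_mul_inv_mul hy]
    simp only [Matrix.mul_apply, Matrix.transpose_apply, Finset.sum_mul]
    rw [Finset.sum_comm]
  simp only [h1, invCoeff_eq, Finset.mul_sum, Finset.sum_mul]
  have h2 : ∀ f : Fin n → Fin n → Fin n → Fin n → ℝ,
      ∑ i, ∑ j, ∑ d, ∑ a, f i j d a = ∑ d, ∑ a, ∑ i, ∑ j, f i j d a := by
    intro f
    rw [Finset.sum_congr rfl fun i _ => Finset.sum_comm, Finset.sum_comm]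
    refine Finset.sum_congr rfl fun d _ => ?_
    rw [Finset.sum_congr rfl fun i _ => Finset.sum_comm, Finset.sum_comm]
  rw [h2]
  exact Finset.sum_congr rfl fun d _ => Finset.sum_congr rfl fun a _ =>
    Finset.sum_congr rfl fun i _ => Finset.sum_congr rfl fun j _ => by ring

/-- The scalar curvature is invariant under changes of coordinates. -/
theorem scalCoord_eq (h : IsPullback φ G U H V) {y : E n} (hy : y ∈ U) :
    scalCoord G y = scalCoord H (φ y) := by
  simp only [scalCoord, h.ricci_eq hy]
  exact h.contract hy fun d a => ricci H d a (φ y)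

theorem normSqCoord_eq (h : IsPullback φ G U H V) {y : E n} (hy : y ∈ U) {f : E n → ℝ}
    (hf : DifferentiableAt ℝ f (φ y)) :
    normSqCoord G (fun z => f (φ z)) y = normSqCoord H f (φ y) := by
  simp only [normSqCoord, h.pderiv_comp hy hf]
  have := h.contract hy fun d a => pderiv d f (φ y) * pderiv a f (φ y)
  simp only [← mul_assoc] at this
  rw [← this]
  refine Finset.sum_congr rfl fun i _ => Finset.sum_congr rfl fun j _ => ?_
  rw [mul_assoc, Finset.sum_mul_sum, Finset.mul_sum, Finset.mul_sum]
  refine Finset.sum_congr rfl fun d _ => ?_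
  rw [Finset.mul_sum, Finset.mul_sum]
  exact Finset.sum_congr rfl fun a _ => by ring

/-- The factor $|\det J|$ is exactly the one in the change of variables formula, which makes the
chart measures agree on overlaps. -/
theorem sqrt_det_eq (h : IsPullback φ G U H V) {y : E n} (hy : y ∈ U) :
    Real.sqrt (gram G y).det = |(jac φ y).det| * Real.sqrt (gram H (φ y)).det := by
  rw [h.gram_eq y hy, Matrix.det_mul, Matrix.det_mul, Matrix.det_transpose,
    show (jac φ y).det * (gram H (φ y)).det * (jac φ y).det =
      (jac φ y).det ^ 2 * (gram H (φ y)).det by ring,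
    Real.sqrt_mul (sq_nonneg _), Real.sqrt_sq_eq_abs]

end IsPullback

end Pullback

theorem det_fderiv_eq_det_jac {n : ℕ} {φ : E n → E n} {y : E n} (hφ : DifferentiableAt ℝ φ y) :
    (fderiv ℝ φ y).det = (jac φ y).det := by
  rw [ContinuousLinearMap.det,
    ← LinearMap.det_toMatrix (EuclideanSpace.basisFun (Fin n) ℝ).toBasis]
  congr 1
  ext a i
  have h2 : HasFDerivAt (fun z => φ z a)
      ((EuclideanSpace.proj a : E n →L[ℝ] ℝ).comp (fderiv ℝ φ y)) y :=
    (EuclideanSpace.proj a : E n →L[ℝ] ℝ).hasFDerivAt.comp y hφ.hasFDerivAt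
  simp only [jac, pderiv, Matrix.of_apply, h2.fderiv]
  simp [LinearMap.toMatrix_apply]

/-! ### Chart independence of scalar curvature and gradient norm -/

section Charts

variable {n : ℕ} {M : Type*} [TopologicalSpace M]

/-- The change of charts from `e` to `e'`. -/
def trans (e e' : OpenPartialHomeomorph M (E n)) (y : E n) : E n := e' (e.symm y)

/-- The domain of the change of charts from `e` to `e'`. -/
def overlap (e e' : OpenPartialHomeomorph M (E n)) : Set (E n) := e.target ∩ e.symm ⁻¹' e'.source

theorem isOpen_overlap (e e' : OpenPartialHomeomorph M (E n)) : IsOpen (overlap e e') :=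
  (e.symm.trans e').open_source

theorem mapsTo_trans (e e' : OpenPartialHomeomorph M (E n)) :
    Set.MapsTo (trans e e') (overlap e e') e'.target :=
  fun _ hy => e'.map_source hy.2

theorem symm_trans {e e' : OpenPartialHomeomorph M (E n)} {y : E n} (hy : y ∈ overlap e e') :
    e'.symm (trans e e' y) = e.symm y := e'.left_inv hy.2

theorem mem_overlap {e e' : OpenPartialHomeomorph M (E n)} {x : M} (hx : x ∈ e.source)
    (hx' : x ∈ e'.source) : e x ∈ overlap e e' :=
  ⟨e.map_source hx, by simpa only [Set.mem_preimage, e.left_inv hx] using hx'⟩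

theorem trans_apply {e e' : OpenPartialHomeomorph M (E n)} {x : M} (hx : x ∈ e.source) :
    trans e e' (e x) = e' x := by
  rw [trans, e.left_inv hx]

theorem normSqCoord_congr {G : Fin n → Fin n → E n → ℝ} {f h : E n → ℝ} {y : E n}
    (hfh : f =ᶠ[𝓝 y] h) : normSqCoord G f y = normSqCoord G h y := by
  simp only [normSqCoord, pderiv_congr hfh]

variable [ChartedSpace (E n) M]

theorem contDiffOn_trans {e e' : OpenPartialHomeomorph M (E n)} (he : e ∈ charts n M)
    (he' : e' ∈ charts n M) : ContDiffOn ℝ ∞ (trans e e') (overlap e e') := by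
  rw [← contMDiffOn_iff_contDiffOn]
  exact (contMDiffOn_of_mem_maximalAtlas he').comp
    ((contMDiffOn_symm_of_mem_maximalAtlas he).mono Set.inter_subset_left) fun y hy => hy.2

theorem mdifferentiableAt_symm {e : OpenPartialHomeomorph M (E n)} (he : e ∈ charts n M) {y : E n}
    (hy : y ∈ e.target) : MDifferentiableAt (𝓡 n) (𝓡 n) e.symm y :=
  ((contMDiffOn_symm_of_mem_maximalAtlas he).contMDiffAt
    (e.open_target.mem_nhds hy)).mdifferentiableAt (by simp)

theorem mdifferentiableAt_chart {e : OpenPartialHomeomorph M (E n)} (he : e ∈ charts n M) {x : M}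
    (hx : x ∈ e.source) : MDifferentiableAt (𝓡 n) (𝓡 n) e x :=
  ((contMDiffOn_of_mem_maximalAtlas he).contMDiffAt
    (e.open_source.mem_nhds hx)).mdifferentiableAt (by simp)

theorem contDiffOn_comp_symm {v : M → ℝ} (hv : ContMDiff (𝓡 n) 𝓘(ℝ, ℝ) ∞ v)
    {e : OpenPartialHomeomorph M (E n)} (he : e ∈ charts n M) :
    ContDiffOn ℝ ∞ (v ∘ e.symm) e.target := by
  rw [← contMDiffOn_iff_contDiffOn]
  exact hv.comp_contMDiffOn (contMDiffOn_symm_of_mem_maximalAtlas he)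

/-- The tangent map of the inverse of a chart, read in the model space. -/
def symmD (e : OpenPartialHomeomorph M (E n)) (y : E n) : E n →L[ℝ] E n :=
  mfderiv (𝓡 n) (𝓡 n) e.symm y

theorem mfderiv_symmD {e : OpenPartialHomeomorph M (E n)} (he : e ∈ charts n M) {y : E n}
    (hy : y ∈ e.target) (v : E n) :
    mfderiv (𝓡 n) (𝓡 n) e (e.symm y) (symmD e y v) = v := by
  have h1 : mfderiv (𝓡 n) (𝓡 n) (e ∘ e.symm) y =
      (mfderiv (𝓡 n) (𝓡 n) e (e.symm y)).comp (mfderiv (𝓡 n) (𝓡 n) e.symm y) :=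
    mfderiv_comp y (mdifferentiableAt_chart he (e.map_target hy)) (mdifferentiableAt_symm he hy)
  have h2 : (e ∘ e.symm) =ᶠ[𝓝 y] id :=
    Filter.mem_of_superset (e.open_target.mem_nhds hy) fun z hz => e.right_inv hz
  rw [h2.mfderiv_eq, mfderiv_id] at h1
  exact (DFunLike.congr_fun h1 v).symm

theorem symmD_injective {e : OpenPartialHomeomorph M (E n)} (he : e ∈ charts n M) {y : E n}
    (hy : y ∈ e.target) : Function.Injective (symmD e y) :=
  Function.LeftInverse.injective (g := mfderiv (𝓡 n) (𝓡 n) e (e.symm y)) (mfderiv_symmD he hy)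

/-- Chain rule for $e^{-1}=e'^{-1}\circ(e'\circ e^{-1})$ on the overlap. It expresses the coordinate
fields of one chart through those of the other, hence the Gram matrix as a pullback. -/
theorem symmD_eq {e e' : OpenPartialHomeomorph M (E n)} (he : e ∈ charts n M)
    (he' : e' ∈ charts n M) {y : E n} (hy : y ∈ overlap e e') (v : E n) :
    symmD e y v = symmD e' (trans e e' y) (fderiv ℝ (trans e e') y v) := by
  have h1 : mfderiv (𝓡 n) (𝓡 n) (e'.symm ∘ trans e e') y =
      (mfderiv (𝓡 n) (𝓡 n) e'.symm (trans e e' y)).comp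
        (mfderiv (𝓡 n) (𝓡 n) (trans e e') y) := by
    refine mfderiv_comp y (mdifferentiableAt_symm he' (mapsTo_trans e e' hy)) ?_
    exact (differentiableAt_of_contDiffOn (isOpen_overlap e e') (contDiffOn_trans he he')
      hy).mdifferentiableAt
  have h2 : (e'.symm ∘ trans e e') =ᶠ[𝓝 y] e.symm :=
    Filter.mem_of_superset ((isOpen_overlap e e').mem_nhds hy) fun z hz => symm_trans hz
  rw [h2.mfderiv_eq, mfderiv_eq_fderiv] at h1
  exact DFunLike.congr_fun h1 v

variable [IsManifold (𝓡 n) ∞ M]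

theorem chartAt_mem_charts (x : M) : chartAt (E n) x ∈ charts n M :=
  IsManifold.chart_mem_maximalAtlas x

/-- The metric at `x`, read in the model space. -/
def form (g : Metr n M) (x : M) : E n →L[ℝ] E n →L[ℝ] ℝ := g.inner x

theorem coeff_eq_form (g : Metr n M) (e : OpenPartialHomeomorph M (E n)) (i j : Fin n) (y : E n) :
    coeff g e i j y =
      form g (e.symm y) (symmD e y (basisVec i)) (symmD e y (basisVec j)) := rfl

theorem form_symmD (g : Metr n M) (e : OpenPartialHomeomorph M (E n)) (y v w : E n) :
    form g (e.symm y) (symmD e y v) (symmD e y w) =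
      ∑ i, ∑ j, v i * w j * coeff g e i j y := by
  conv_lhs => rw [← sum_smul_basisVec v, ← sum_smul_basisVec w]
  simp only [map_sum, map_smul, sum_apply, smul_apply, smul_eq_mul, Finset.mul_sum,
    coeff_eq_form]
  rw [Finset.sum_comm]
  exact Finset.sum_congr rfl fun i _ => Finset.sum_congr rfl fun j _ => by ring

theorem isCoordMetric_coeff (g : Metr n M) {e : OpenPartialHomeomorph M (E n)}
    (he : e ∈ charts n M) : IsCoordMetric (coeff g e) e.target where
  isOpen := e.open_target
  smooth := contDiffOn_coeff g he
  symm y _ i j := g.symm _ _ _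
  posDef y hy := by
    refine Matrix.PosDef.of_dotProduct_mulVec_pos ?_ fun v hv => ?_
    · ext i j
      exact g.symm _ _ _
    · set w : E n := WithLp.toLp 2 v with hw
      have hw0 : w ≠ 0 := fun h => hv (by
        have := congrArg (WithLp.ofLp) h
        simpa [hw] using this)
      have hne : symmD e y w ≠ 0 := fun h => hw0 (symmD_injective he hy (h.trans (map_zero _).symm))
      have h1 : 0 < form g (e.symm y) (symmD e y w) (symmD e y w) := g.pos _ _ hne
      rw [form_symmD] at h1
      have h2 : dotProduct (star v) ((gram (coeff g e) y).mulVec v) =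
          ∑ i, ∑ j, w i * w j * coeff g e i j y := by
        simp only [dotProduct, Matrix.mulVec, gram, Matrix.of_apply, Finset.mul_sum,
          star_trivial]
        exact Finset.sum_congr rfl fun i _ => Finset.sum_congr rfl fun j _ => by
          simp only [hw]; ring
      rw [h2]
      exact h1

theorem isPullback_coeff (g : Metr n M) {e e' : OpenPartialHomeomorph M (E n)}
    (he : e ∈ charts n M) (he' : e' ∈ charts n M) :
    IsPullback (trans e e') (coeff g e) (overlap e e') (coeff g e') e'.target where
  left := (isCoordMetric_coeff g he).mono (isOpen_overlap e e') Set.inter_subset_left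
  right := isCoordMetric_coeff g he'
  smooth := contDiffOn_trans he he'
  mapsTo := mapsTo_trans e e'
  gram_eq y hy := by
    have hd := differentiableAt_of_contDiffOn (isOpen_overlap e e') (contDiffOn_trans he he') hy
    have hJ : ∀ a i, (fderiv ℝ (trans e e') y (basisVec i)) a = jac (trans e e') y a i := by
      intro a i
      have h2 : HasFDerivAt (fun z => trans e e' z a)
          ((EuclideanSpace.proj a : E n →L[ℝ] ℝ).comp (fderiv ℝ (trans e e') y)) y :=
        (EuclideanSpace.proj a : E n →L[ℝ] ℝ).hasFDerivAt.comp y hd.hasFDerivAt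
      simp only [jac, pderiv, Matrix.of_apply, h2.fderiv]
      rfl
    ext i j
    have h1 : gram (coeff g e) y i j = form g (e'.symm (trans e e' y))
        (symmD e y (basisVec i)) (symmD e y (basisVec j)) := by
      rw [symm_trans hy]; rfl
    rw [h1, symmD_eq he he' hy, symmD_eq he he' hy, form_symmD]
    simp only [hJ, Matrix.mul_apply, Matrix.transpose_apply, gram, Matrix.of_apply,
      Finset.sum_mul]
    rw [Finset.sum_comm]
    exact Finset.sum_congr rfl fun i _ => Finset.sum_congr rfl fun j _ => by ring

/-- The scalar curvature may be computed in any chart. -/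
theorem scal_eq (g : Metr n M) {e : OpenPartialHomeomorph M (E n)} (he : e ∈ charts n M) {x : M}
    (hx : x ∈ e.source) : scal g x = scalCoord (coeff g e) (e x) := by
  have hx' := mem_chart_source (E n) x
  rw [scal, (isPullback_coeff g (chartAt_mem_charts x) he).scalCoord_eq (mem_overlap hx' hx),
    trans_apply hx']

/-- The norm of the differential may be computed in any chart. -/
theorem normSqD_eq (g : Metr n M) {v : M → ℝ} (hv : ContMDiff (𝓡 n) 𝓘(ℝ, ℝ) ∞ v)
    {e : OpenPartialHomeomorph M (E n)} (he : e ∈ charts n M) {x : M} (hx : x ∈ e.source) :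
    normSqD g v x = normSqCoord (coeff g e) (v ∘ e.symm) (e x) := by
  have hx' := mem_chart_source (E n) x
  have h := isPullback_coeff g (chartAt_mem_charts x) he
  have ho := mem_overlap hx' hx
  have hd : DifferentiableAt ℝ (v ∘ e.symm) (trans (chartAt (E n) x) e (chartAt (E n) x x)) :=
    differentiableAt_of_contDiffOn e.open_target (contDiffOn_comp_symm hv he) (h.mapsTo ho)
  have h1 := h.normSqCoord_eq ho hd
  rw [trans_apply hx'] at h1
  rw [← h1, normSqD]
  refine normSqCoord_congr (Filter.mem_of_superset ((isOpen_overlap _ e).mem_nhds ho) fun z hz => ?_)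
  simp only [Set.mem_ofPred_eq, Function.comp_apply, symm_trans hz]

end Charts

/-! ### The Riemannian measure in charts -/

section Measure

open MeasureTheory Set

variable {n : ℕ} {M : Type*} [TopologicalSpace M]

section Density

variable [ChartedSpace (E n) M] [IsManifold (𝓡 n) ∞ M]

/-- The density of the Riemannian measure in a chart. -/
def density (g : Metr n M) (e : OpenPartialHomeomorph M (E n)) (y : E n) : ℝ :=
  Real.sqrt (gram (coeff g e) y).det

theorem density_pos (g : Metr n M) {e : OpenPartialHomeomorph M (E n)} (he : e ∈ charts n M)
    {y : E n} (hy : y ∈ e.target) : 0 < density g e y :=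
  Real.sqrt_pos.2 ((isCoordMetric_coeff g he).det_pos hy)

theorem continuousOn_density (g : Metr n M) {e : OpenPartialHomeomorph M (E n)}
    (he : e ∈ charts n M) : ContinuousOn (density g e) e.target :=
  (isCoordMetric_coeff g he).contDiffOn_det.continuousOn.sqrt

end Density

section

variable [MeasurableSpace M] [ChartedSpace (E n) M] [IsManifold (𝓡 n) ∞ M]

theorem chartMeasure_le_riemMeasure (g : Metr n M) {e : OpenPartialHomeomorph M (E n)}
    (he : e ∈ charts n M) : chartMeasure g e ≤ riemMeasure g :=
  le_iSup₂ (f := fun (e : OpenPartialHomeomorph M (E n)) (_ : e ∈ charts n M) => chartMeasure g e)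
    e he

end

variable [MeasurableSpace M] [BorelSpace M]

theorem measurableSet_target_inter_preimage (e : OpenPartialHomeomorph M (E n)) {A : Set M}
    (hA : MeasurableSet A) : MeasurableSet (e.target ∩ e.symm ⁻¹' A) := by
  have h1 : Measurable (e.target.domRestrict e.symm) :=
    (continuousOn_iff_continuous_domRestrict.1 e.continuousOn_symm).measurable
  have h2 := MeasurableSet.subtype_image e.open_target.measurableSet (h1 hA)
  convert h2 using 1
  ext y
  simp [and_comm]

theorem aemeasurable_symm (e : OpenPartialHomeomorph M (E n)) :
    AEMeasurable e.symm (volume.restrict e.target) :=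
  e.continuousOn_symm.aemeasurable e.open_target.measurableSet

variable [ChartedSpace (E n) M] [IsManifold (𝓡 n) ∞ M]

theorem chartMeasure_apply (g : Metr n M) (e : OpenPartialHomeomorph M (E n)) {A : Set M}
    (hA : MeasurableSet A) : chartMeasure g e A =
      ∫⁻ y in e.target ∩ e.symm ⁻¹' A, ENNReal.ofReal (density g e y) := by
  rw [chartMeasure, Measure.map_apply_of_aemeasurable
    ((aemeasurable_symm e).mono_ac (withDensity_absolutelyContinuous _ _)) hA,
    withDensity_apply', Measure.restrict_restrict' e.open_target.measurableSet, inter_comm]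
  rfl

theorem chartMeasure_inter_source (g : Metr n M) (e : OpenPartialHomeomorph M (E n)) {A : Set M}
    (hA : MeasurableSet A) : chartMeasure g e (A ∩ e.source) = chartMeasure g e A := by
  rw [chartMeasure_apply g e (hA.inter e.open_source.measurableSet), chartMeasure_apply g e hA]
  congr 2
  ext y
  simp only [mem_inter_iff, mem_preimage]
  exact ⟨fun h => ⟨h.1, h.2.1⟩, fun h => ⟨h.1, h.2, e.map_target h.1⟩⟩

/-- Change of variables along the transition map, which is injective there; its Jacobian is absorbed
by the transformation of the density. -/
theorem chartMeasure_eq_of_subset (g : Metr n M) {e e' : OpenPartialHomeomorph M (E n)}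
    (he : e ∈ charts n M) (he' : e' ∈ charts n M) {A : Set M} (hA : MeasurableSet A)
    (h : A ⊆ e.source) (h' : A ⊆ e'.source) : chartMeasure g e' A = chartMeasure g e A := by
  have hp := isPullback_coeff g he he'
  have hs : e.target ∩ e.symm ⁻¹' A ⊆ overlap e e' := fun y hy => ⟨hy.1, h' hy.2⟩
  have himg : e'.target ∩ e'.symm ⁻¹' A = trans e e' '' (e.target ∩ e.symm ⁻¹' A) := by
    ext z
    constructor
    · intro hz
      refine ⟨e (e'.symm z), ⟨e.map_source (h hz.2), ?_⟩, ?_⟩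
      · simpa only [mem_preimage, e.left_inv (h hz.2)] using hz.2
      · rw [trans, e.left_inv (h hz.2), e'.right_inv hz.1]
    · rintro ⟨y, hy, rfl⟩
      refine ⟨mapsTo_trans e e' (hs hy), ?_⟩
      simpa only [mem_preimage, symm_trans (hs hy)] using hy.2
  have hinj : InjOn (trans e e') (e.target ∩ e.symm ⁻¹' A) := by
    intro y hy z hz hyz
    have := congrArg e'.symm hyz
    rw [symm_trans (hs hy), symm_trans (hs hz)] at this
    exact e.symm.injOn hy.1 hz.1 this
  have hd : ∀ y ∈ e.target ∩ e.symm ⁻¹' A, DifferentiableAt ℝ (trans e e') y := fun y hy =>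
    differentiableAt_of_contDiffOn (isOpen_overlap e e') (contDiffOn_trans he he') (hs hy)
  rw [chartMeasure_apply g e' hA, chartMeasure_apply g e hA, himg,
    lintegral_image_eq_lintegral_abs_det_fderiv_mul volume
      (measurableSet_target_inter_preimage e hA)
      (fun y hy => (hd y hy).hasFDerivAt.hasFDerivWithinAt) hinj]
  refine setLIntegral_congr_fun (measurableSet_target_inter_preimage e hA) fun y hy => ?_
  simp only [density]
  rw [hp.sqrt_det_eq (hs hy), ENNReal.ofReal_mul (abs_nonneg _), det_fderiv_eq_det_jac (hd y hy)]

/-- The Riemannian measure restricts to the chart measure on every chart domain. -/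
theorem riemMeasure_restrict (g : Metr n M) {e : OpenPartialHomeomorph M (E n)}
    (he : e ∈ charts n M) : (riemMeasure g).restrict e.source = chartMeasure g e := by
  have hms := e.open_source.measurableSet
  -- The right-hand side bounds every chart measure: inside `e.source` it equals the chart measure
  -- of `e` on the overlap, and outside it is at most the supremum. Hence it bounds the supremum
  -- too.
  have hle : riemMeasure g ≤ chartMeasure g e + (riemMeasure g).restrict e.sourceᶜ := by
    refine iSup₂_le fun e' he' => ?_
    refine Measure.le_iff.2 fun A hA => ?_
    rw [← measure_inter_add_sdiff A hms, Measure.add_apply, Measure.restrict_apply hA]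
    refine add_le_add ?_ (chartMeasure_le_riemMeasure g he' _)
    have hA1 := (hA.inter hms).inter e'.open_source.measurableSet
    rw [← chartMeasure_inter_source g e' (hA.inter hms),
      chartMeasure_eq_of_subset g he he' hA1 (fun x hx => hx.1.2) inter_subset_right]
    exact measure_mono (fun x hx => hx.1.1)
  refine le_antisymm (Measure.le_iff.2 fun A hA => ?_) (Measure.le_iff.2 fun A hA => ?_)
  · rw [Measure.restrict_apply hA]
    refine (hle _).trans ?_
    rw [Measure.add_apply, Measure.restrict_apply (hA.inter hms), inter_assoc,
      inter_compl_self, inter_empty, measure_empty, add_zero]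
    exact measure_mono inter_subset_left
  · rw [Measure.restrict_apply hA, ← chartMeasure_inter_source g e hA]
    exact chartMeasure_le_riemMeasure g he _

theorem riemMeasure_apply (g : Metr n M) {e : OpenPartialHomeomorph M (E n)}
    (he : e ∈ charts n M) {A : Set M} (hA : MeasurableSet A) (h : A ⊆ e.source) :
    riemMeasure g A = ∫⁻ y in e.target ∩ e.symm ⁻¹' A, ENNReal.ofReal (density g e y) := by
  rw [← chartMeasure_apply g e hA, ← riemMeasure_restrict g he, Measure.restrict_apply hA,
    inter_eq_left.2 h]

theorem integral_riemMeasure (g : Metr n M) {e : OpenPartialHomeomorph M (E n)}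
    (he : e ∈ charts n M) {F : M → ℝ} (hF : AEStronglyMeasurable F (riemMeasure g))
    (h0 : ∀ x ∉ e.source, F x = 0) :
    ∫ x, F x ∂(riemMeasure g) = ∫ y in e.target, density g e y * F (e.symm y) := by
  rw [← setIntegral_eq_integral_of_forall_compl_eq_zero h0, riemMeasure_restrict g he,
    chartMeasure, integral_map ((aemeasurable_symm e).mono_ac (withDensity_absolutelyContinuous _ _))]
  · have hm : AEMeasurable (fun y => ENNReal.ofReal (density g e y))
        (volume.restrict e.target) :=
      ((continuousOn_density g he).aemeasurable e.open_target.measurableSet).ennreal_ofReal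
    refine (integral_withDensity_eq_integral_toReal_smul₀ hm
      (Filter.Eventually.of_forall fun _ => ENNReal.ofReal_lt_top) _).trans ?_
    refine integral_congr_ae (Filter.Eventually.of_forall fun y => ?_)
    simp only [smul_eq_mul, density, Real.sqrt_nonneg, ENNReal.toReal_ofReal]
  · have := hF.mono_measure (Measure.restrict_le_self (s := e.source))
    rwa [riemMeasure_restrict g he] at this

/-- Needed for the integrability of continuous functions with compact support; on a small coordinate
ball the density is bounded. -/
instance isLocallyFiniteMeasure_riemMeasure (g : Metr n M) :
    IsLocallyFiniteMeasure (riemMeasure g) := by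
  refine ⟨fun x => ?_⟩
  have he := chartAt_mem_charts (n := n) x
  set e := chartAt (E n) x
  have hx : x ∈ e.source := mem_chart_source (E n) x
  obtain ⟨r, hr, hball⟩ := Metric.isOpen_iff.1 e.open_target (e x) (e.map_source hx)
  have hsub : Metric.closedBall (e x) (r / 2) ⊆ e.target :=
    (Metric.closedBall_subset_ball (by linarith)).trans hball
  have hcomp := isCompact_closedBall (e x) (r / 2)
  obtain ⟨C, hC⟩ := hcomp.exists_bound_of_continuousOn ((continuousOn_density g he).mono hsub)
  have hop : IsOpen (e.source ∩ e ⁻¹' Metric.ball (e x) (r / 2)) :=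
    e.isOpen_inter_preimage Metric.isOpen_ball
  refine ⟨_, hop.mem_nhds ⟨hx, Metric.mem_ball_self (by linarith)⟩, ?_⟩
  rw [riemMeasure_apply g he hop.measurableSet inter_subset_left]
  calc _ ≤ ∫⁻ y in Metric.closedBall (e x) (r / 2), ENNReal.ofReal (density g e y) := by
        refine lintegral_mono_set fun y hy => ?_
        have := hy.2.2
        rw [mem_preimage, e.right_inv hy.1] at this
        exact Metric.ball_subset_closedBall this
    _ ≤ ∫⁻ _ in Metric.closedBall (e x) (r / 2), ENNReal.ofReal C :=
        setLIntegral_mono measurable_const fun y hy =>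
          ENNReal.ofReal_le_ofReal ((le_abs_self _).trans (hC y hy))
    _ < ⊤ := by
        rw [setLIntegral_const]
        exact ENNReal.mul_lt_top ENNReal.ofReal_lt_top hcomp.measure_lt_top

/-- Needed for the positivity of the $L^p$-norm of a test function, the denominator of the
functional. -/
instance isOpenPosMeasure_riemMeasure (g : Metr n M) : (riemMeasure g).IsOpenPosMeasure := by
  refine ⟨fun W hW ⟨x, hx⟩ => ?_⟩
  have he := chartAt_mem_charts (n := n) x
  set e := chartAt (E n) x
  have hxs : x ∈ e.source := mem_chart_source (E n) x
  refine fun h0 => ?_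
  have h1 : riemMeasure g (W ∩ e.source) = 0 := measure_mono_null inter_subset_left h0
  have hop := hW.inter e.open_source
  rw [riemMeasure_apply g he hop.measurableSet inter_subset_right] at h1
  have hop2 : IsOpen (e.target ∩ e.symm ⁻¹' (W ∩ e.source)) :=
    e.symm.isOpen_inter_preimage hop
  have hpos : 0 < volume (e.target ∩ e.symm ⁻¹' (W ∩ e.source)) := by
    refine hop2.measure_pos volume ⟨e x, e.map_source hxs, ?_⟩
    rw [mem_preimage, e.left_inv hxs]
    exact ⟨hx, hxs⟩
  have hm : AEMeasurable (fun y => ENNReal.ofReal (density g e y))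
      (volume.restrict (e.target ∩ e.symm ⁻¹' (W ∩ e.source))) :=
    (((continuousOn_density g he).mono inter_subset_left).aemeasurable
      hop2.measurableSet).ennreal_ofReal
  rw [lintegral_eq_zero_iff' hm, Filter.EventuallyEq, ae_restrict_iff' hop2.measurableSet] at h1
  refine hpos.ne' (measure_mono_null (fun y hy => ?_) (ae_iff.1 h1))
  simp only [mem_ofPred_eq, not_forall]
  exact ⟨hy, by simpa using density_pos g he hy.1⟩

end Measure

/-! ### Dependence of the geometry on the 2-jet of the metric -/

namespace IsCoordMetric

variable {n : ℕ} {G : Fin n → Fin n → E n → ℝ} {U : Set (E n)}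

/-- Differentiate $GG^{-1}=1$. -/
theorem matD_inv (hG : IsCoordMetric G U) {y : E n} (hy : y ∈ U) (m : Fin n) :
    matD m (fun z => (gram G z)⁻¹) y = -((gram G y)⁻¹ * matD m (gram G) y * (gram G y)⁻¹) := by
  have hA : MatDiffAt (gram G) y := fun a b => hG.differentiableAt hy a b
  have hB : MatDiffAt (fun z => (gram G z)⁻¹) y := fun a b =>
    differentiableAt_of_contDiffOn hG.isOpen (hG.contDiffOn_invCoeff a b) hy
  have h1 : matD m (fun z => gram G z * (gram G z)⁻¹) y = 0 := by
    rw [matD_congr (B := fun _ => 1) (Filter.mem_of_superset (hG.isOpen.mem_nhds hy)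
      fun z hz => Matrix.mul_nonsing_inv _ (hG.isUnit_det hz))]
    ext a b
    exact pderiv_const _ _ _
  rw [matD_mul hA hB] at h1
  have h2 := congrArg ((gram G y)⁻¹ * ·) (eq_neg_of_add_eq_zero_right h1)
  simp only [Matrix.nonsing_inv_mul_cancel_left _ _ (hG.isUnit_det hy)] at h2
  rw [h2, Matrix.mul_neg, Matrix.mul_assoc]

theorem pderiv_invCoeff (hG : IsCoordMetric G U) {y : E n} (hy : y ∈ U) (m k l : Fin n) :
    pderiv m (invCoeff G k l) y =
      -∑ b, ∑ a, invCoeff G k a y * pderiv m (G a b) y * invCoeff G b l y := by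
  have h := congrFun (congrFun (hG.matD_inv hy m) k) l
  simp only [Matrix.neg_apply, Matrix.mul_apply, Finset.sum_mul] at h
  exact h

/-- Together with `pderiv_invCoeff` this exhibits the derivatives of the Christoffel symbols as
explicit functions of the 2-jet, so that $C^2$-continuity in the metric can be read off. -/
theorem pderiv_christoffel (hG : IsCoordMetric G U) {y : E n} (hy : y ∈ U) (m k i j : Fin n) :
    pderiv m (christoffel G k i j) y = (1 / 2 : ℝ) * ∑ l,
      (pderiv m (invCoeff G k l) y * (pderiv i (G j l) y + pderiv j (G i l) y - pderiv l (G i j) y) +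
        invCoeff G k l y * (pderiv m (pderiv i (G j l)) y + pderiv m (pderiv j (G i l)) y -
          pderiv m (pderiv l (G i j)) y)) := by
  have hd : ∀ a b c, DifferentiableAt ℝ (pderiv a (G b c)) y := fun a b c =>
    differentiableAt_of_contDiffOn hG.isOpen (contDiffOn_pderiv hG.isOpen (hG.smooth b c) a) hy
  have hi : ∀ a b, DifferentiableAt ℝ (invCoeff G a b) y := fun a b =>
    differentiableAt_of_contDiffOn hG.isOpen (hG.contDiffOn_invCoeff a b) hy
  have hs : ∀ l, DifferentiableAt ℝ
      (fun y => pderiv i (G j l) y + pderiv j (G i l) y - pderiv l (G i j) y) y := fun l =>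
    ((hd _ _ _).fun_add (hd _ _ _)).fun_sub (hd _ _ _)
  have h0 : christoffel G k i j = fun y => (1 / 2 : ℝ) * ∑ l, invCoeff G k l y *
    (pderiv i (G j l) y + pderiv j (G i l) y - pderiv l (G i j) y) := rfl
  rw [h0, pderiv_const_mul _ (DifferentiableAt.fun_sum fun l _ => (hi k l).fun_mul (hs l)),
    pderiv_sum _ fun l _ => (hi k l).fun_mul (hs l)]
  congr 1
  refine Finset.sum_congr rfl fun l _ => ?_
  rw [pderiv_mul (hi k l) (hs l), pderiv_sub ((hd _ _ _).fun_add (hd _ _ _)) (hd _ _ _),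
    pderiv_add (hd _ _ _) (hd _ _ _)]

/-- The quadratic form of the inverse metric. -/
def _root_.Yamabe.quad (G : Fin n → Fin n → E n → ℝ) (y ξ : E n) : ℝ :=
  ∑ i, ∑ j, invCoeff G i j y * ξ i * ξ j

theorem quad_pos (hG : IsCoordMetric G U) {y ξ : E n} (hy : y ∈ U) (hξ : ξ ≠ 0) :
    0 < quad G y ξ := by
  have hne : (ξ : Fin n → ℝ) ≠ 0 := fun h => hξ (by ext i; exact congrFun h i)
  have h1 := (hG.posDef y hy).inv.dotProduct_mulVec_pos hne
  have h2 : quad G y ξ = dotProduct (star (ξ : Fin n → ℝ)) ((gram G y)⁻¹.mulVec ξ) := by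
    simp only [dotProduct, Matrix.mulVec, quad, Finset.mul_sum, star_trivial]
    exact Finset.sum_congr rfl fun i _ => Finset.sum_congr rfl fun j _ => by
      rw [invCoeff_eq]; ring
  rw [h2]
  exact h1

end IsCoordMetric

section JointContinuity

open Set

variable {n : ℕ}

theorem quad_smul (G : Fin n → Fin n → E n → ℝ) (y ξ : E n) (c : ℝ) :
    quad G y (c • ξ) = c ^ 2 * quad G y ξ := by
  simp only [quad, Finset.mul_sum]
  exact Finset.sum_congr rfl fun i _ => Finset.sum_congr rfl fun j _ => by
    simp only [PiLp.smul_apply, smul_eq_mul]; ring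

theorem quad_zero (G : Fin n → Fin n → E n → ℝ) (y : E n) : quad G y 0 = 0 := by
  simp [quad]

theorem normSqCoord_eq_quad (G : Fin n → Fin n → E n → ℝ) (f : E n → ℝ) (y : E n) :
    normSqCoord G f y = quad G y (WithLp.toLp 2 fun i => pderiv i f y) := rfl

/-- A relation between jointly continuous functions holds near `t₀`, uniformly on compact sets. -/
theorem eventually_forall_of_continuousOn {X Y : Type*} [TopologicalSpace X]
    [TopologicalSpace Y] {W C : Set Y}
    (hW : IsOpen W) (hC : IsCompact C) (hCW : C ⊆ W) {F : X × Y → ℝ} {t₀ : X}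
    (hF : ContinuousOn F (univ ×ˢ W)) {P : ℝ → ℝ → Prop}
    (hP : IsOpen {q : ℝ × ℝ | P q.1 q.2}) (h0 : ∀ y ∈ C, P (F (t₀, y)) (F (t₀, y))) :
    ∀ᶠ t in 𝓝 t₀, ∀ y ∈ C, P (F (t, y)) (F (t₀, y)) := by
  -- Tube lemma: it suffices that the open relation hold near each point $(t_0,y)$, where both
  -- arguments tend to $F(t_0,y)$.
  refine hC.eventually_forall_of_forall_eventually fun y hy => ?_
  have hop : IsOpen (univ ×ˢ W : Set (X × Y)) := isOpen_univ.prod hW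
  have h1 : ContinuousAt F (t₀, y) := hF.continuousAt (hop.mem_nhds ⟨mem_univ _, hCW hy⟩)
  have h2 : ContinuousAt (fun p : X × Y => F (t₀, p.2)) (t₀, y) :=
    ContinuousAt.comp (g := F) (f := fun p : X × Y => (t₀, p.2)) h1 (by fun_prop)
  exact (h1.prodMk h2).eventually (hP.mem_nhds (h0 y hy))

variable {M : Type*} [TopologicalSpace M] [ChartedSpace (E n) M] [IsManifold (𝓡 n) ∞ M]
  {X : Type*} [TopologicalSpace X]

/-- A family of metrics which is continuous for the compact-open `C²`-topology. -/
def IsC2Family (γ : X → Metr n M) : Prop :=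
  ∀ (e : OpenPartialHomeomorph M (E n)) (he : e ∈ charts n M),
    Continuous fun t => jet 2 e he (γ t)

namespace IsC2Family

variable {γ : X → Metr n M} {e : OpenPartialHomeomorph M (E n)}

/-- Evaluation is jointly continuous for the compact-open topology because the chart range is
locally compact. All joint continuity statements rest on this one. -/
theorem continuousOn_iteratedFDeriv (hγ : IsC2Family γ) (he : e ∈ charts n M) (i j : Fin n) {l : ℕ}
    (hl : (l : ℕ∞) ≤ 2) :
    ContinuousOn (fun p : X × E n => iteratedFDeriv ℝ l (coeff (γ p.1) e i j) p.2)
      (univ ×ˢ e.target) := by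
  have : LocallyCompactSpace e.target := e.open_target.locallyCompactSpace
  rw [continuousOn_iff_continuous_domRestrict]
  have h1 : Continuous fun p : (univ ×ˢ e.target : Set (X × E n)) =>
      jet 2 e he (γ p.1.1) ⟨p.1.2, p.2.2⟩ :=
    ((hγ e he).comp (continuous_fst.comp continuous_subtype_val)).eval
      ((continuous_snd.comp continuous_subtype_val).subtype_mk _)
  have h2 := (continuous_apply (⟨l, hl⟩ : {l : ℕ // (l : ℕ∞) ≤ 2})).comp
    ((continuous_apply j).comp ((continuous_apply i).comp h1))
  exact h2

theorem continuousOn_coeff (hγ : IsC2Family γ) (he : e ∈ charts n M) (i j : Fin n) :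
    ContinuousOn (fun p : X × E n => coeff (γ p.1) e i j p.2) (univ ×ˢ e.target) := by
  have h := hγ.continuousOn_iteratedFDeriv he i j (l := 0) (by simp)
  have h2 := (ContinuousMultilinearMap.apply ℝ (fun _ : Fin 0 => E n) ℝ 0).continuous.comp_continuousOn h
  refine h2.congr fun p _ => ?_
  simp

theorem continuousOn_pderiv (hγ : IsC2Family γ) (he : e ∈ charts n M) (m i j : Fin n) :
    ContinuousOn (fun p : X × E n => pderiv m (coeff (γ p.1) e i j) p.2) (univ ×ˢ e.target) := by
  have h := hγ.continuousOn_iteratedFDeriv he i j (l := 1) (by norm_num)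
  have h2 := (ContinuousMultilinearMap.apply ℝ (fun _ : Fin 1 => E n) ℝ
    ![basisVec m]).continuous.comp_continuousOn h
  refine h2.congr fun p _ => ?_
  simp [pderiv]

theorem continuousOn_pderiv_pderiv (hγ : IsC2Family γ) (he : e ∈ charts n M) (m k i j : Fin n) :
    ContinuousOn (fun p : X × E n => pderiv m (pderiv k (coeff (γ p.1) e i j)) p.2)
      (univ ×ˢ e.target) := by
  have h := hγ.continuousOn_iteratedFDeriv he i j (l := 2) (by norm_num)
  have h2 := (ContinuousMultilinearMap.apply ℝ (fun _ : Fin 2 => E n) ℝ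
    ![basisVec m, basisVec k]).continuous.comp_continuousOn h
  refine h2.congr fun p hp => ?_
  rw [pderiv_pderiv e.open_target (contDiffOn_coeff (γ p.1) he i j) hp.2]
  simp [iteratedFDeriv_two_apply]

theorem continuousOn_det (hγ : IsC2Family γ) (he : e ∈ charts n M) :
    ContinuousOn (fun p : X × E n => (gram (coeff (γ p.1) e) p.2).det) (univ ×ˢ e.target) := by
  simp only [Matrix.det_apply, gram, Matrix.of_apply]
  exact continuousOn_finsetSum _ fun σ _ =>
    (continuousOn_finsetProd _ fun i _ => hγ.continuousOn_coeff he _ _).const_smul _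

theorem continuousOn_density (hγ : IsC2Family γ) (he : e ∈ charts n M) :
    ContinuousOn (fun p : X × E n => density (γ p.1) e p.2) (univ ×ˢ e.target) :=
  (hγ.continuousOn_det he).sqrt

theorem continuousOn_invCoeff (hγ : IsC2Family γ) (he : e ∈ charts n M) (i j : Fin n) :
    ContinuousOn (fun p : X × E n => invCoeff (coeff (γ p.1) e) i j p.2) (univ ×ˢ e.target) := by
  have h : ∀ p : X × E n, invCoeff (coeff (γ p.1) e) i j p.2 =
      ((gram (coeff (γ p.1) e) p.2).det)⁻¹ * (gram (coeff (γ p.1) e) p.2).adjugate i j := by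
    intro p
    rw [invCoeff_eq, Matrix.inv_def, Matrix.smul_apply, Ring.inverse_eq_inv', smul_eq_mul]
  simp only [h]
  refine ((hγ.continuousOn_det he).inv₀ fun p hp =>
    ((isCoordMetric_coeff (γ p.1) he).det_pos hp.2).ne').mul ?_
  simp only [Matrix.adjugate_apply, Matrix.det_apply, gram]
  refine continuousOn_finsetSum _ fun σ _ => ?_
  refine (continuousOn_finsetProd _ fun k _ => ?_).const_smul _
  simp only [Matrix.updateRow_apply]
  split_ifs
  · exact continuousOn_const
  · exact hγ.continuousOn_coeff he _ _

theorem continuousOn_christoffel (hγ : IsC2Family γ) (he : e ∈ charts n M) (k i j : Fin n) :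
    ContinuousOn (fun p : X × E n => christoffel (coeff (γ p.1) e) k i j p.2)
      (univ ×ˢ e.target) := by
  refine continuousOn_const.mul (continuousOn_finsetSum _ fun l _ =>
    (hγ.continuousOn_invCoeff he k l).mul ?_)
  exact ((hγ.continuousOn_pderiv he _ _ _).add (hγ.continuousOn_pderiv he _ _ _)).sub
    (hγ.continuousOn_pderiv he _ _ _)

theorem continuousOn_pderiv_christoffel (hγ : IsC2Family γ) (he : e ∈ charts n M)
    (m k i j : Fin n) :
    ContinuousOn (fun p : X × E n => pderiv m (christoffel (coeff (γ p.1) e) k i j) p.2)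
      (univ ×ˢ e.target) := by
  have h1 : ∀ l, ContinuousOn (fun p : X × E n => pderiv m (invCoeff (coeff (γ p.1) e) k l) p.2)
      (univ ×ˢ e.target) := by
    intro l
    refine ContinuousOn.congr ?_ fun p hp =>
      (isCoordMetric_coeff (γ p.1) he).pderiv_invCoeff hp.2 m k l
    exact (continuousOn_finsetSum _ fun b _ => continuousOn_finsetSum _ fun a _ =>
      ((hγ.continuousOn_invCoeff he _ _).mul (hγ.continuousOn_pderiv he _ _ _)).mul
        (hγ.continuousOn_invCoeff he _ _)).neg
  refine ContinuousOn.congr ?_ fun p hp =>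
      (isCoordMetric_coeff (γ p.1) he).pderiv_christoffel hp.2 m k i j
  refine continuousOn_const.mul (continuousOn_finsetSum _ fun l _ => ((h1 l).mul ?_).add
    ((hγ.continuousOn_invCoeff he _ _).mul ?_))
  · exact ((hγ.continuousOn_pderiv he _ _ _).add (hγ.continuousOn_pderiv he _ _ _)).sub
      (hγ.continuousOn_pderiv he _ _ _)
  · exact ((hγ.continuousOn_pderiv_pderiv he _ _ _ _).add
      (hγ.continuousOn_pderiv_pderiv he _ _ _ _)).sub (hγ.continuousOn_pderiv_pderiv he _ _ _ _)

theorem continuousOn_scalCoord (hγ : IsC2Family γ) (he : e ∈ charts n M) :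
    ContinuousOn (fun p : X × E n => scalCoord (coeff (γ p.1) e) p.2) (univ ×ˢ e.target) := by
  have hc := hγ.continuousOn_christoffel he
  have hp := hγ.continuousOn_pderiv_christoffel he
  refine continuousOn_finsetSum _ fun i _ => continuousOn_finsetSum _ fun j _ =>
    (hγ.continuousOn_invCoeff he i j).mul ?_
  refine (continuousOn_finsetSum _ fun k _ => ?_).add
    (continuousOn_finsetSum _ fun k _ => continuousOn_finsetSum _ fun l _ => ?_)
  · exact (hp _ _ _ _).sub (hp _ _ _ _)
  · exact ((hc _ _ _).mul (hc _ _ _)).sub ((hc _ _ _).mul (hc _ _ _))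

theorem continuousOn_quad (hγ : IsC2Family γ) (he : e ∈ charts n M) :
    ContinuousOn (fun p : X × E n × E n => quad (coeff (γ p.1) e) p.2.1 p.2.2)
      (univ ×ˢ (e.target ×ˢ univ)) := by
  refine continuousOn_finsetSum _ fun i _ => continuousOn_finsetSum _ fun j _ => ?_
  have h1 : ContinuousOn (fun p : X × E n × E n => invCoeff (coeff (γ p.1) e) i j p.2.1)
      (univ ×ˢ (e.target ×ˢ univ)) :=
    (hγ.continuousOn_invCoeff he i j).comp (f := fun p : X × E n × E n => (p.1, p.2.1))
      (by fun_prop) fun p hp => ⟨mem_univ _, hp.2.1⟩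
  exact (h1.mul (by fun_prop)).mul (by fun_prop)

end IsC2Family

end JointContinuity

/-! ### Closeness of metrics on compact sets -/

section Closeness

open MeasureTheory Set

variable {n : ℕ} {M : Type*} [TopologicalSpace M] [ChartedSpace (E n) M] [IsManifold (𝓡 n) ∞ M]
  [MeasurableSpace M]

/-- The metric `g` is `ε`-close to `g₀` on `A`, as far as the Yamabe functional is concerned. -/
structure IsClose (ε : ℝ) (g₀ g : Metr n M) (A : Set M) : Prop where
  abs_scal_sub_le : ∀ x ∈ A, |scal g x - scal g₀ x| ≤ ε
  le_normSqD : ∀ v : M → ℝ, ContMDiff (𝓡 n) 𝓘(ℝ, ℝ) ∞ v → ∀ x ∈ A,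
    (1 - ε) * normSqD g₀ v x ≤ normSqD g v x
  normSqD_le : ∀ v : M → ℝ, ContMDiff (𝓡 n) 𝓘(ℝ, ℝ) ∞ v → ∀ x ∈ A,
    normSqD g v x ≤ (1 + ε) * normSqD g₀ v x
  le_measure : ∀ B ⊆ A, MeasurableSet B →
    ENNReal.ofReal (1 - ε) * riemMeasure g₀ B ≤ riemMeasure g B
  measure_le : ∀ B ⊆ A, MeasurableSet B →
    riemMeasure g B ≤ ENNReal.ofReal (1 + ε) * riemMeasure g₀ B

theorem IsClose.mono {ε : ℝ} {g₀ g : Metr n M} {A A' : Set M} (h : IsClose ε g₀ g A)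
    (hA : A' ⊆ A) : IsClose ε g₀ g A' :=
  ⟨fun x hx => h.1 x (hA hx), fun v hv x hx => h.2 v hv x (hA hx),
    fun v hv x hx => h.3 v hv x (hA hx), fun B hB => h.4 B (hB.trans hA),
    fun B hB => h.5 B (hB.trans hA)⟩

theorem IsClose.union {ε : ℝ} {g₀ g : Metr n M} {A A' : Set M} (h : IsClose ε g₀ g A)
    (h' : IsClose ε g₀ g A') (hA : MeasurableSet A) : IsClose ε g₀ g (A ∪ A') where
  abs_scal_sub_le x hx := hx.elim (h.1 x) (h'.1 x)
  le_normSqD v hv x hx := hx.elim (h.2 v hv x) (h'.2 v hv x)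
  normSqD_le v hv x hx := hx.elim (h.3 v hv x) (h'.3 v hv x)
  le_measure B hB hBm := by
    rw [← measure_inter_add_sdiff B hA, ← measure_inter_add_sdiff (μ := riemMeasure g) B hA,
      mul_add]
    exact add_le_add (h.4 _ inter_subset_right (hBm.inter hA))
      (h'.4 _ (fun x hx => (hB hx.1).resolve_left hx.2) (hBm.diff hA))
  measure_le B hB hBm := by
    rw [← measure_inter_add_sdiff B hA, ← measure_inter_add_sdiff (μ := riemMeasure g₀) B hA,
      mul_add]
    exact add_le_add (h.5 _ inter_subset_right (hBm.inter hA))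
      (h'.5 _ (fun x hx => (hB hx.1).resolve_left hx.2) (hBm.diff hA))

variable [BorelSpace M] {X : Type*} [TopologicalSpace X] {γ : X → Metr n M}

/-- The density and the inverse metric are positive and are compared by ratios; the scalar curvature
has no sign and is compared by differences. -/
theorem IsC2Family.eventually_isClose_chart (hγ : IsC2Family γ)
    {e : OpenPartialHomeomorph M (E n)} (he : e ∈ charts n M) {C : Set (E n)} (hC : IsCompact C)
    (hCe : C ⊆ e.target) (t₀ : X) {ε : ℝ} (hε : 0 < ε) :
    ∀ᶠ t in 𝓝 t₀, IsClose ε (γ t₀) (γ t) (e.source ∩ e ⁻¹' C) := by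
  have hratio : IsOpen {q : ℝ × ℝ | (1 - ε) * q.2 < q.1 ∧ q.1 < (1 + ε) * q.2} :=
    (isOpen_lt (by fun_prop) (by fun_prop)).and (isOpen_lt (by fun_prop) (by fun_prop))
  have hpos : ∀ b : ℝ, 0 < b → (1 - ε) * b < b ∧ b < (1 + ε) * b := fun b hb => by
    have := mul_pos hε hb
    constructor <;> linarith
  have h1 : ∀ᶠ t in 𝓝 t₀, ∀ y ∈ C,
      |scalCoord (coeff (γ t) e) y - scalCoord (coeff (γ t₀) e) y| < ε :=
    eventually_forall_of_continuousOn e.open_target hC hCe (hγ.continuousOn_scalCoord he)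
      (P := fun a b => |a - b| < ε) (isOpen_lt (by fun_prop) (by fun_prop)) (by simpa using fun _ _ => hε)
  have h2 : ∀ᶠ t in 𝓝 t₀, ∀ y ∈ C, (1 - ε) * density (γ t₀) e y < density (γ t) e y ∧
      density (γ t) e y < (1 + ε) * density (γ t₀) e y :=
    eventually_forall_of_continuousOn e.open_target hC hCe (hγ.continuousOn_density he)
      (P := fun a b => (1 - ε) * b < a ∧ a < (1 + ε) * b) hratio
      fun y hy => hpos _ (density_pos _ he (hCe hy))
  -- Only unit covectors are tested, since they form a compact set; quadratic homogeneity extends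
  -- the bounds to all covectors, including the differential of any test function.
  have h3 : ∀ᶠ t in 𝓝 t₀, ∀ q ∈ C ×ˢ Metric.sphere (0 : E n) 1,
      (1 - ε) * quad (coeff (γ t₀) e) q.1 q.2 < quad (coeff (γ t) e) q.1 q.2 ∧
      quad (coeff (γ t) e) q.1 q.2 < (1 + ε) * quad (coeff (γ t₀) e) q.1 q.2 :=
    eventually_forall_of_continuousOn (e.open_target.prod isOpen_univ)
      (hC.prod (isCompact_sphere _ _)) (prod_mono hCe (subset_univ _)) (hγ.continuousOn_quad he)
      (P := fun a b => (1 - ε) * b < a ∧ a < (1 + ε) * b) hratio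
      fun q hq => hpos _ ((isCoordMetric_coeff _ he).quad_pos (hCe hq.1) fun h => by
        have := hq.2
        rw [mem_sphere_zero_iff_norm, show q.2 = 0 from h, norm_zero] at this
        exact zero_ne_one this)
  filter_upwards [h1, h2, h3] with t h1 h2 h3
  have hq : ∀ y ∈ C, ∀ ξ : E n,
      (1 - ε) * quad (coeff (γ t₀) e) y ξ ≤ quad (coeff (γ t) e) y ξ ∧
      quad (coeff (γ t) e) y ξ ≤ (1 + ε) * quad (coeff (γ t₀) e) y ξ := by
    intro y hy ξ
    rcases eq_or_ne ξ 0 with rfl | hξ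
    · simp [quad_zero]
    · have hn : ‖ξ‖ ≠ 0 := norm_ne_zero_iff.2 hξ
      have hs : ‖ξ‖⁻¹ • ξ ∈ Metric.sphere (0 : E n) 1 := by
        simp [norm_smul, hn]
      obtain ⟨c, η, hη, rfl⟩ : ∃ (c : ℝ) (η : E n), η ∈ Metric.sphere (0 : E n) 1 ∧ ξ = c • η :=
        ⟨‖ξ‖, _, hs, by rw [smul_smul, mul_inv_cancel₀ hn, one_smul]⟩
      obtain ⟨ha, hb⟩ := h3 (y, η) ⟨hy, hη⟩
      rw [quad_smul, quad_smul]
      constructor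
      · nlinarith [mul_le_mul_of_nonneg_left ha.le (sq_nonneg c)]
      · nlinarith [mul_le_mul_of_nonneg_left hb.le (sq_nonneg c)]
  have hmem : ∀ B ⊆ e.source ∩ e ⁻¹' C, ∀ y ∈ e.target ∩ e.symm ⁻¹' B, y ∈ C := by
    intro B hB y hy
    have := (hB hy.2).2
    rwa [mem_preimage, e.right_inv hy.1] at this
  refine ⟨fun x hx => ?_, fun v hv x hx => ?_, fun v hv x hx => ?_, fun B hB hBm => ?_,
    fun B hB hBm => ?_⟩
  · rw [scal_eq _ he hx.1, scal_eq _ he hx.1]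
    exact (h1 _ hx.2).le
  · rw [normSqD_eq _ hv he hx.1, normSqD_eq _ hv he hx.1, normSqCoord_eq_quad,
      normSqCoord_eq_quad]
    exact (hq _ hx.2 _).1
  · rw [normSqD_eq _ hv he hx.1, normSqD_eq _ hv he hx.1, normSqCoord_eq_quad,
      normSqCoord_eq_quad]
    exact (hq _ hx.2 _).2
  · rw [riemMeasure_apply _ he hBm (hB.trans inter_subset_left),
      riemMeasure_apply _ he hBm (hB.trans inter_subset_left),
      ← lintegral_const_mul' _ _ ENNReal.ofReal_ne_top]
    refine setLIntegral_mono' (measurableSet_target_inter_preimage e hBm) fun y hy => ?_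
    rw [← ENNReal.ofReal_mul' (density_pos _ he hy.1).le]
    exact ENNReal.ofReal_le_ofReal (h2 y (hmem B hB y hy)).1.le
  · rw [riemMeasure_apply _ he hBm (hB.trans inter_subset_left),
      riemMeasure_apply _ he hBm (hB.trans inter_subset_left),
      ← lintegral_const_mul' _ _ ENNReal.ofReal_ne_top]
    refine setLIntegral_mono' (measurableSet_target_inter_preimage e hBm) fun y hy => ?_
    rw [← ENNReal.ofReal_mul' (density_pos _ he hy.1).le]
    exact ENNReal.ofReal_le_ofReal (h2 y (hmem B hB y hy)).2.le

theorem IsC2Family.eventually_isClose (hγ : IsC2Family γ) {K : Set M} (hK : IsCompact K) (t₀ : X)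
    {ε : ℝ} (hε : 0 < ε) : ∀ᶠ t in 𝓝 t₀, IsClose ε (γ t₀) (γ t) K := by
  -- The induction over finite covers carries a measurable superset because gluing two closeness
  -- statements splits measures along a measurable set.
  have key : ∃ A, MeasurableSet A ∧ K ⊆ A ∧ ∀ᶠ t in 𝓝 t₀, IsClose ε (γ t₀) (γ t) A := by
    refine hK.induction_on (p := fun s => ∃ A, MeasurableSet A ∧ s ⊆ A ∧
      ∀ᶠ t in 𝓝 t₀, IsClose ε (γ t₀) (γ t) A) ?_ ?_ ?_ ?_
    · refine ⟨∅, MeasurableSet.empty, empty_subset _, Filter.Eventually.of_forall fun t => ?_⟩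
      refine ⟨by simp, by simp, by simp, fun B hB _ => ?_, fun B hB _ => ?_⟩ <;>
        simp [subset_empty_iff.1 hB]
    · rintro s s' hs ⟨A, hA, hsA, h⟩
      exact ⟨A, hA, hs.trans hsA, h⟩
    · rintro s s' ⟨A, hA, hsA, h⟩ ⟨A', hA', hsA', h'⟩
      refine ⟨A ∪ A', hA.union hA', union_subset_union hsA hsA', ?_⟩
      filter_upwards [h, h'] with t h h' using h.union h' hA
    · intro x _
      have he := chartAt_mem_charts (n := n) x
      set e := chartAt (E n) x
      have hx : x ∈ e.source := mem_chart_source (E n) x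
      obtain ⟨r, hr, hball⟩ := Metric.isOpen_iff.1 e.open_target (e x) (e.map_source hx)
      have hsub : Metric.closedBall (e x) (r / 2) ⊆ e.target :=
        (Metric.closedBall_subset_ball (by linarith)).trans hball
      have hop : IsOpen (e.source ∩ e ⁻¹' Metric.ball (e x) (r / 2)) :=
        e.isOpen_inter_preimage Metric.isOpen_ball
      refine ⟨_, mem_nhdsWithin_of_mem_nhds (hop.mem_nhds ⟨hx, Metric.mem_ball_self (by linarith)⟩),
        _, hop.measurableSet, Subset.rfl, ?_⟩
      filter_upwards [hγ.eventually_isClose_chart he (isCompact_closedBall (e x) (r / 2)) hsub t₀ hε]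
        with t ht
      exact ht.mono (inter_subset_inter_right _ (preimage_mono Metric.ball_subset_closedBall))
  obtain ⟨A, _, hKA, h⟩ := key
  exact h.mono fun t ht => ht.mono hKA

end Closeness

theorem tsupport_mono_of_zero {M : Type*} [TopologicalSpace M] {f F : M → ℝ}
    (h : ∀ x, f x = 0 → F x = 0) : tsupport F ⊆ tsupport f :=
  closure_mono fun x hx => Function.mem_support.2 fun h0 => Function.mem_support.1 hx (h x h0)

/-! ### Comparison of the integrals in the Yamabe functional -/

section Integrals

open MeasureTheory Set

variable {n : ℕ} {M : Type*} [TopologicalSpace M] [ChartedSpace (E n) M] [IsManifold (𝓡 n) ∞ M]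

theorem continuous_scal (g : Metr n M) : Continuous (scal g) := by
  refine continuous_iff_continuousAt.2 fun x => ?_
  have he := chartAt_mem_charts (n := n) x
  set e := chartAt (E n) x
  have hx : x ∈ e.source := mem_chart_source (E n) x
  have h1 : ContinuousOn (fun z => scalCoord (coeff g e) (e z)) e.source :=
    (isCoordMetric_coeff g he).contDiffOn_scalCoord.continuousOn.comp e.continuousOn e.mapsTo
  exact (h1.congr fun z hz => scal_eq g he hz).continuousAt (e.open_source.mem_nhds hx)

theorem continuous_normSqD (g : Metr n M) {v : M → ℝ} (hv : ContMDiff (𝓡 n) 𝓘(ℝ, ℝ) ∞ v) :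
    Continuous (normSqD g v) := by
  refine continuous_iff_continuousAt.2 fun x => ?_
  have he := chartAt_mem_charts (n := n) x
  set e := chartAt (E n) x
  have hx : x ∈ e.source := mem_chart_source (E n) x
  have h0 : ContinuousOn (normSqCoord (coeff g e) (v ∘ e.symm)) e.target := by
    have hd : ∀ i, ContinuousOn (pderiv i (v ∘ e.symm)) e.target := fun i =>
      (contDiffOn_pderiv e.open_target (contDiffOn_comp_symm hv he) i).continuousOn
    exact continuousOn_finsetSum _ fun i _ => continuousOn_finsetSum _ fun j _ =>
      (((isCoordMetric_coeff g he).contDiffOn_invCoeff i j).continuousOn.mul (hd i)).mul (hd j)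
  have h1 : ContinuousOn (fun z => normSqCoord (coeff g e) (v ∘ e.symm) (e z)) e.source :=
    h0.comp e.continuousOn e.mapsTo
  exact (h1.congr fun z hz => normSqD_eq g hv he hz).continuousAt (e.open_source.mem_nhds hx)

theorem normSqD_nonneg (g : Metr n M) (v : M → ℝ) (x : M) : 0 ≤ normSqD g v x := by
  rw [normSqD, normSqCoord_eq_quad]
  have h := isCoordMetric_coeff g (chartAt_mem_charts (n := n) x)
  rcases eq_or_ne (WithLp.toLp 2 fun i => pderiv i (v ∘ (chartAt (E n) x).symm)
    (chartAt (E n) x x)) (0 : E n) with h0 | h0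
  · rw [h0, quad_zero]
  · exact (h.quad_pos (mem_chart_target _ x) h0).le

theorem normSqD_eq_zero (g : Metr n M) {v : M → ℝ} {x : M} (hx : x ∉ tsupport v) :
    normSqD g v x = 0 := by
  have h0 : v =ᶠ[𝓝 x] 0 := notMem_tsupport_iff_eventuallyEq.1 hx
  set e := chartAt (E n) x
  have hxs : x ∈ e.source := mem_chart_source (E n) x
  have h1 : (v ∘ e.symm) =ᶠ[𝓝 (e x)] fun _ => 0 := by
    have := e.continuousAt_symm (e.map_source hxs)
    rw [ContinuousAt, e.left_inv hxs] at this
    exact this.eventually h0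
  rw [normSqD, normSqCoord_congr h1]
  simp [normSqCoord, pderiv_const]

theorem hasCompactSupport_normSqD (g : Metr n M) {v : M → ℝ} (hv : HasCompactSupport v) :
    HasCompactSupport (normSqD g v) :=
  hv.mono' fun _ hx => by_contra fun h => hx (normSqD_eq_zero g h)

variable [MeasurableSpace M] [BorelSpace M]

theorem integrable_of_hasCompactSupport (g : Metr n M) {f : M → ℝ} (hf : Continuous f)
    (hc : HasCompactSupport f) : Integrable f (riemMeasure g) :=
  hf.integrable_of_hasCompactSupport hc

namespace IsClose

variable {ε : ℝ} {g₀ g : Metr n M} {K : Set M} [T2Space M]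

theorem integral_bounds (h : IsClose ε g₀ g K) (hK : IsCompact K) (hε : 0 ≤ ε) (hε1 : ε ≤ 1)
    {f : M → ℝ} (hf : Continuous f) (h0 : ∀ x, 0 ≤ f x) (hfK : tsupport f ⊆ K) :
    (1 - ε) * ∫ x, f x ∂(riemMeasure g₀) ≤ ∫ x, f x ∂(riemMeasure g) ∧
      ∫ x, f x ∂(riemMeasure g) ≤ (1 + ε) * ∫ x, f x ∂(riemMeasure g₀) := by
  have hc : HasCompactSupport f := hK.of_isClosed_subset (isClosed_tsupport f) hfK
  have hz : ∀ x ∉ K, f x = 0 := fun x hx => image_eq_zero_of_notMem_tsupport fun h => hx (hfK h)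
  have hKm := hK.isClosed.measurableSet
  have hi := fun g : Metr n M => (integrable_of_hasCompactSupport g hf hc).restrict (s := K)
  rw [← setIntegral_eq_integral_of_forall_compl_eq_zero hz,
    ← setIntegral_eq_integral_of_forall_compl_eq_zero (μ := riemMeasure g) hz]
  constructor
  · have hle : ENNReal.ofReal (1 - ε) • (riemMeasure g₀).restrict K ≤
        (riemMeasure g).restrict K := by
      refine Measure.le_iff.2 fun B hB => ?_
      rw [Measure.smul_apply, Measure.restrict_apply hB, Measure.restrict_apply hB, smul_eq_mul]
      exact h.le_measure _ inter_subset_right (hB.inter hKm)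
    have := integral_mono_measure hle (Filter.Eventually.of_forall h0) (hi g)
    rwa [integral_smul_measure, ENNReal.toReal_ofReal (by linarith), smul_eq_mul] at this
  · have hle : (riemMeasure g).restrict K ≤
        ENNReal.ofReal (1 + ε) • (riemMeasure g₀).restrict K := by
      refine Measure.le_iff.2 fun B hB => ?_
      rw [Measure.smul_apply, Measure.restrict_apply hB, Measure.restrict_apply hB, smul_eq_mul]
      exact h.measure_le _ inter_subset_right (hB.inter hKm)
    have := integral_mono_measure hle (Filter.Eventually.of_forall h0)
      ((hi g₀).smul_measure ENNReal.ofReal_ne_top)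
    rwa [integral_smul_measure, ENNReal.toReal_ofReal (by linarith), smul_eq_mul] at this

theorem abs_integral_sub_le (h : IsClose ε g₀ g K) (hK : IsCompact K) (hε : 0 ≤ ε) (hε1 : ε ≤ 1)
    {f : M → ℝ} (hf : Continuous f) (hfK : tsupport f ⊆ K) :
    |∫ x, f x ∂(riemMeasure g) - ∫ x, f x ∂(riemMeasure g₀)| ≤
      ε * ∫ x, |f x| ∂(riemMeasure g₀) := by
  have hc : HasCompactSupport f := hK.of_isClosed_subset (isClosed_tsupport f) hfK
  have hca : HasCompactSupport fun x => |f x| := hc.comp_left (g := fun y : ℝ => |y|) abs_zero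
  have hi := fun g : Metr n M => integrable_of_hasCompactSupport g hf hc
  have hia := fun g : Metr n M => integrable_of_hasCompactSupport g hf.abs hca
  have hs : ∀ F : M → ℝ, (∀ x, f x = 0 → F x = 0) → tsupport F ⊆ K := fun F hF =>
    (tsupport_mono_of_zero hF).trans hfK
  -- The bounds for nonnegative integrands are applied to $|f|+f$ and $|f|-f$. Subtracting them
  -- leaves an error of exactly $\varepsilon\int|f|$.
  have h1 := h.integral_bounds hK hε hε1 (f := fun x => |f x| + f x) (hf.abs.add hf)
    (fun x => by linarith [neg_abs_le (f x)]) (hs _ fun x hx => by simp [hx])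
  have h2 := h.integral_bounds hK hε hε1 (f := fun x => |f x| - f x) (hf.abs.sub hf)
    (fun x => by linarith [le_abs_self (f x)]) (hs _ fun x hx => by simp [hx])
  rw [integral_add (hia _) (hi _), integral_add (hia _) (hi _)] at h1
  rw [integral_sub (hia _) (hi _), integral_sub (hia _) (hi _)] at h2
  rw [abs_le]
  constructor <;> nlinarith [h1.1, h1.2, h2.1, h2.2]

theorem normSqD_bounds (h : IsClose ε g₀ g K) (hK : IsCompact K) (hε : 0 ≤ ε) (hε1 : ε ≤ 1)
    {v : M → ℝ} (hv : ContMDiff (𝓡 n) 𝓘(ℝ, ℝ) ∞ v) (hvK : tsupport v ⊆ K) :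
    (1 - ε) ^ 2 * ∫ x, normSqD g₀ v x ∂(riemMeasure g₀) ≤ ∫ x, normSqD g v x ∂(riemMeasure g) ∧
      ∫ x, normSqD g v x ∂(riemMeasure g) ≤
        (1 + ε) ^ 2 * ∫ x, normSqD g₀ v x ∂(riemMeasure g₀) := by
  have hc : HasCompactSupport v := hK.of_isClosed_subset (isClosed_tsupport v) hvK
  have hs : tsupport (normSqD g₀ v) ⊆ K := by
    refine (closure_minimal ?_ (isClosed_tsupport v)).trans hvK
    exact fun _ hx => by_contra fun h => hx (normSqD_eq_zero g₀ h)
  have hb := h.integral_bounds hK hε hε1 (continuous_normSqD g₀ hv) (normSqD_nonneg g₀ v) hs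
  have hi := fun g' : Metr n M => integrable_of_hasCompactSupport g (continuous_normSqD g' hv)
    (hasCompactSupport_normSqD g' hc)
  have hle : ∀ x, (1 - ε) * normSqD g₀ v x ≤ normSqD g v x ∧
      normSqD g v x ≤ (1 + ε) * normSqD g₀ v x := by
    intro x
    by_cases hx : x ∈ K
    · exact ⟨h.le_normSqD v hv x hx, h.normSqD_le v hv x hx⟩
    · have hx' : x ∉ tsupport v := fun h => hx (hvK h)
      simp [normSqD_eq_zero _ hx']
  have h1 := integral_mono ((hi g₀).const_mul (1 - ε)) (hi g) fun x => (hle x).1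
  have h2 := integral_mono (hi g) ((hi g₀).const_mul (1 + ε)) fun x => (hle x).2
  rw [integral_const_mul] at h1 h2
  constructor
  · calc _ = (1 - ε) * ((1 - ε) * ∫ x, normSqD g₀ v x ∂(riemMeasure g₀)) := by ring
      _ ≤ (1 - ε) * ∫ x, normSqD g₀ v x ∂(riemMeasure g) :=
        mul_le_mul_of_nonneg_left hb.1 (by linarith)
      _ ≤ _ := h1
  · calc _ ≤ (1 + ε) * ∫ x, normSqD g₀ v x ∂(riemMeasure g) := h2
      _ ≤ (1 + ε) * ((1 + ε) * ∫ x, normSqD g₀ v x ∂(riemMeasure g₀)) :=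
        mul_le_mul_of_nonneg_left hb.2 (by linarith)
      _ = _ := by ring

/-- Change the scalar curvature first and the measure second. The first step costs
$\varepsilon(1+\varepsilon)\le2\varepsilon$ and the second $\varepsilon s$, each times $\int
v^2\,d\mu_{g_0}$. -/
theorem abs_scal_term_sub_le (h : IsClose ε g₀ g K) (hK : IsCompact K) (hε : 0 ≤ ε) (hε1 : ε ≤ 1)
    {v : M → ℝ} (hv : Continuous v) (hvK : tsupport v ⊆ K) {s : ℝ}
    (hs : ∀ x ∈ K, |scal g₀ x| ≤ s) :
    |∫ x, scal g x * v x ^ 2 ∂(riemMeasure g) - ∫ x, scal g₀ x * v x ^ 2 ∂(riemMeasure g₀)| ≤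
      ε * (2 + s) * ∫ x, v x ^ 2 ∂(riemMeasure g₀) := by
  have hc : HasCompactSupport v := hK.of_isClosed_subset (isClosed_tsupport v) hvK
  have hts : ∀ F : M → ℝ, (∀ x, v x = 0 → F x = 0) → tsupport F ⊆ K := fun F hF =>
    (tsupport_mono_of_zero hF).trans hvK
  have hcs : ∀ F : M → ℝ, (∀ x, v x = 0 → F x = 0) → HasCompactSupport F := fun F hF =>
    hK.of_isClosed_subset (isClosed_tsupport F) (hts F hF)
  have hv2 : Continuous fun x => v x ^ 2 := hv.pow 2
  have hf : ∀ g' : Metr n M, Continuous fun x => scal g' x * v x ^ 2 :=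
    fun g' => (continuous_scal g').mul hv2
  have i2 := fun g' : Metr n M =>
    integrable_of_hasCompactSupport g' hv2 (hcs _ fun x hx => by simp [hx])
  have i1 := fun g' g'' : Metr n M =>
    integrable_of_hasCompactSupport g' (hf g'') (hcs _ fun x hx => by simp [hx])
  have hz : ∀ x ∉ K, v x = 0 := fun x hx => image_eq_zero_of_notMem_tsupport fun h => hx (hvK h)
  have e1 : |∫ x, scal g x * v x ^ 2 ∂(riemMeasure g) - ∫ x, scal g₀ x * v x ^ 2 ∂(riemMeasure g)|
      ≤ ε * ∫ x, v x ^ 2 ∂(riemMeasure g) := by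
    rw [← integral_sub (i1 g g) (i1 g g₀), ← integral_const_mul]
    refine norm_integral_le_of_norm_le (f := fun x => scal g x * v x ^ 2 - scal g₀ x * v x ^ 2)
      ((i2 g).const_mul ε) (Filter.Eventually.of_forall fun x => ?_)
    rw [← sub_mul, Real.norm_eq_abs, abs_mul, abs_of_nonneg (sq_nonneg (v x))]
    by_cases hx : x ∈ K
    · exact mul_le_mul_of_nonneg_right (h.abs_scal_sub_le x hx) (sq_nonneg _)
    · simp [hz x hx]
  have e2 := h.abs_integral_sub_le hK hε hε1 (hf g₀) (hts _ fun x hx => by simp [hx])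
  have e3 := (h.integral_bounds hK hε hε1 hv2 (fun x => sq_nonneg _)
    (hts _ fun x hx => by simp [hx])).2
  have e4 : ∫ x, |scal g₀ x * v x ^ 2| ∂(riemMeasure g₀) ≤
      s * ∫ x, v x ^ 2 ∂(riemMeasure g₀) := by
    rw [← integral_const_mul]
    refine integral_mono (i1 g₀ g₀).abs ((i2 g₀).const_mul s) fun x => ?_
    simp only [abs_mul, abs_of_nonneg (sq_nonneg (v x))]
    by_cases hx : x ∈ K
    · exact mul_le_mul_of_nonneg_right (hs x hx) (sq_nonneg _)
    · simp [hz x hx]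
  have hV : 0 ≤ ∫ x, v x ^ 2 ∂(riemMeasure g₀) := integral_nonneg fun x => sq_nonneg _
  calc _ ≤ _ := abs_sub_le _ (∫ x, scal g₀ x * v x ^ 2 ∂(riemMeasure g)) _
    _ ≤ ε * ((1 + ε) * ∫ x, v x ^ 2 ∂(riemMeasure g₀)) +
        ε * (s * ∫ x, v x ^ 2 ∂(riemMeasure g₀)) :=
      add_le_add (e1.trans (mul_le_mul_of_nonneg_left e3 hε))
        (e2.trans (mul_le_mul_of_nonneg_left e4 hε))
    _ ≤ _ := by nlinarith [mul_nonneg (mul_nonneg hε hV) (sub_nonneg.2 hε1)]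

end IsClose

end Integrals

/-! ### Semicontinuity of the Yamabe constant -/

section Semicontinuity

open MeasureTheory Set

theorem two_lt_critExp {n : ℕ} (hn : 3 ≤ n) : 2 < critExp n := by
  have : (3 : ℝ) ≤ n := by exact_mod_cast hn
  rw [critExp, lt_div_iff₀ (by linarith)]
  linarith

theorem gradConst_pos {n : ℕ} (hn : 3 ≤ n) : 0 < gradConst n := by
  have : (3 : ℝ) ≤ n := by exact_mod_cast hn
  exact div_pos (by linarith) (by linarith)

variable {n : ℕ} {M : Type*} [TopologicalSpace M]

theorem continuous_abs_rpow {v : M → ℝ} (hv : Continuous v) {p : ℝ} (hp : 0 < p) :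
    Continuous fun x => |v x| ^ p :=
  hv.abs.rpow_const fun _ => Or.inr hp.le

theorem tsupport_abs_rpow (v : M → ℝ) {p : ℝ} (hp : 0 < p) :
    tsupport (fun x => |v x| ^ p) ⊆ tsupport v :=
  tsupport_mono_of_zero fun x hx => by simp [hx, Real.zero_rpow hp.ne']

variable [ChartedSpace (E n) M] [IsManifold (𝓡 n) ∞ M]
  [MeasurableSpace M]

theorem lpNorm_sq_eq (g : Metr n M) {p : ℝ} (v : M → ℝ) :
    lpNorm g p v ^ 2 = (∫ x, |v x| ^ p ∂(riemMeasure g)) ^ (2 / p) := by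
  rw [lpNorm, ← Real.rpow_natCast, ← Real.rpow_mul
    (integral_nonneg fun x => Real.rpow_nonneg (abs_nonneg _) _)]
  congr 1
  push_cast
  ring

variable [BorelSpace M]

theorem functional_eq (g : Metr n M) {v : M → ℝ} (hv : ContMDiff (𝓡 n) 𝓘(ℝ, ℝ) ∞ v)
    (hc : HasCompactSupport v) : functional g v =
      (gradConst n * ∫ x, normSqD g v x ∂(riemMeasure g) +
        ∫ x, scal g x * v x ^ 2 ∂(riemMeasure g)) / lpNorm g (critExp n) v ^ 2 := by
  have hcs : HasCompactSupport fun x => scal g x * v x ^ 2 :=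
    hc.mono fun x hx => by
      rw [Function.mem_support] at hx ⊢
      contrapose! hx
      simp [hx]
  rw [functional, integral_add, integral_const_mul]
  · exact (integrable_of_hasCompactSupport g (continuous_normSqD g hv)
      (hasCompactSupport_normSqD g hc)).const_mul _
  · exact integrable_of_hasCompactSupport g ((continuous_scal g).mul (hv.continuous.pow 2)) hcs

theorem lpNorm_pos (g : Metr n M) {p : ℝ} (hp : 0 < p) {v : M → ℝ} (hv : Continuous v)
    (hc : HasCompactSupport v) (h0 : ∃ x, v x ≠ 0) : 0 < lpNorm g p v := by
  obtain ⟨x, hx⟩ := h0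
  refine Real.rpow_pos_of_pos ?_ _
  refine (continuous_abs_rpow hv hp).integral_pos_of_hasCompactSupport_nonneg_nonzero
    (hc.of_isClosed_subset (isClosed_tsupport _) (tsupport_abs_rpow v hp))
    (fun x => Real.rpow_nonneg (abs_nonneg _) _) (x := x) ?_
  exact (Real.rpow_pos_of_pos (abs_pos.2 hx) _).ne'

/-- The squared norm is the power $2/p\le1$ of an integral, and such a power moves $1-\varepsilon$
and $1+\varepsilon$ only towards 1. -/
theorem IsClose.lpNorm_sq_bounds [T2Space M] {ε : ℝ} {g₀ g : Metr n M} {K : Set M}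
    (h : IsClose ε g₀ g K) (hK : IsCompact K) (hε : 0 ≤ ε) (hε1 : ε ≤ 1) {p : ℝ} (hp : 2 ≤ p)
    {v : M → ℝ} (hv : Continuous v) (hvK : tsupport v ⊆ K) :
    (1 - ε) * lpNorm g₀ p v ^ 2 ≤ lpNorm g p v ^ 2 ∧
      lpNorm g p v ^ 2 ≤ (1 + ε) * lpNorm g₀ p v ^ 2 := by
  have hp0 : 0 < p := by linarith
  have hq0 : 0 < 2 / p := by positivity
  have hq1 : 2 / p ≤ 1 := (div_le_one hp0).2 hp
  obtain ⟨h1, h2⟩ := h.integral_bounds hK hε hε1 (continuous_abs_rpow hv hp0)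
    (fun x => Real.rpow_nonneg (abs_nonneg _) _) ((tsupport_abs_rpow v hp0).trans hvK)
  have hI : ∀ g' : Metr n M, 0 ≤ ∫ x, |v x| ^ p ∂(riemMeasure g') :=
    fun g' => integral_nonneg fun x => Real.rpow_nonneg (abs_nonneg _) _
  simp only [lpNorm_sq_eq]
  constructor
  · refine le_trans ?_ (Real.rpow_le_rpow (mul_nonneg (by linarith) (hI g₀)) h1 hq0.le)
    rw [Real.mul_rpow (by linarith) (hI g₀)]
    refine mul_le_mul_of_nonneg_right ?_ (Real.rpow_nonneg (hI g₀) _)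
    rcases hε1.eq_or_lt with rfl | hlt
    · simp [Real.zero_rpow hq0.ne']
    · simpa using Real.rpow_le_rpow_of_exponent_ge (x := 1 - ε) (by linarith) (by linarith) hq1
  · refine (Real.rpow_le_rpow (hI g) h2 hq0.le).trans ?_
    rw [Real.mul_rpow (by linarith) (hI g₀)]
    refine mul_le_mul_of_nonneg_right ?_ (Real.rpow_nonneg (hI g₀) _)
    simpa using Real.rpow_le_rpow_of_exponent_le (x := 1 + ε) (by linarith) hq1

theorem tendsto_of_forall_abs_sub_le {X : Type*} {l : Filter X} {F : X → ℝ} {a C : ℝ}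
    (h : ∀ ε : ℝ, 0 < ε → ε ≤ 1 → ∀ᶠ t in l, |F t - a| ≤ C * ε) : Filter.Tendsto F l (𝓝 a) := by
  rw [Metric.tendsto_nhds]
  intro δ hδ
  have hC : 0 < |C| + 1 := by positivity
  have hpos : 0 < min 1 (δ / (2 * (|C| + 1))) := lt_min one_pos (by positivity)
  filter_upwards [h _ hpos (min_le_left _ _)] with t ht
  rw [Real.dist_eq]
  have h1 : min 1 (δ / (2 * (|C| + 1))) ≤ δ / (2 * (|C| + 1)) := min_le_right _ _
  calc |F t - a| ≤ C * min 1 (δ / (2 * (|C| + 1))) := ht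
    _ ≤ (|C| + 1) * (δ / (2 * (|C| + 1))) :=
      mul_le_mul (by linarith [le_abs_self C]) h1 hpos.le hC.le
    _ = δ / 2 := by field_simp
    _ < δ := by linarith

/-- On a compact manifold, the `L²`-norm is bounded by the `Lᵖ`-norm for `p > 2`. -/
theorem exists_integral_sq_le [CompactSpace M] (g : Metr n M) {p : ℝ} (hp : 2 < p) :
    ∃ C : ℝ, 0 ≤ C ∧ ∀ v : M → ℝ, Continuous v →
      ∫ x, v x ^ 2 ∂(riemMeasure g) ≤ C * lpNorm g p v ^ 2 := by
  have hfin : IsFiniteMeasure (riemMeasure g) := ⟨isCompact_univ.measure_lt_top⟩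
  have hp2 : 1 < p / 2 := by linarith
  have hconj := Real.HolderConjugate.conjExponent hp2
  set q := Real.conjExponent (p / 2)
  refine ⟨(∫ _, (1 : ℝ) ^ q ∂(riemMeasure g)) ^ (1 / q), Real.rpow_nonneg (integral_nonneg
    fun _ => by positivity) _, fun v hv => ?_⟩
  have hcont : ∀ r : ENNReal, ∀ f : M → ℝ, Continuous f → MemLp f r (riemMeasure g) := by
    intro r f hf
    exact hf.memLp_of_hasCompactSupport (HasCompactSupport.of_compactSpace f)
  -- Hölder for $v^2\cdot1$ with exponent $p/2>1$ and its conjugate $q$; the constant is the volume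
  -- to the power $1/q$.
  have h := integral_mul_le_Lp_mul_Lq_of_nonneg hconj (μ := riemMeasure g)
    (f := fun x => v x ^ 2) (g := fun _ => (1 : ℝ))
    (Filter.Eventually.of_forall fun x => sq_nonneg _) (Filter.Eventually.of_forall fun x => zero_le_one)
    (hcont _ _ (hv.pow 2)) (hcont _ _ continuous_const)
  have h2 : ∀ x, (v x ^ 2) ^ (p / 2) = |v x| ^ p := fun x => by
    rw [← sq_abs, ← Real.rpow_natCast, ← Real.rpow_mul (abs_nonneg _)]
    congr 1
    push_cast
    ring
  simp only [mul_one, h2] at h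
  rw [lpNorm_sq_eq, mul_comm]
  convert h using 2
  congr 1
  field_simp

variable [T2Space M] {X : Type*} [TopologicalSpace X] {γ : X → Metr n M}

/-- The Yamabe functional of a fixed test function is continuous in the metric. -/
theorem IsC2Family.tendsto_functional (hγ : IsC2Family γ) (hn : 3 ≤ n) (v : TestFunction n M)
    (t₀ : X) : Filter.Tendsto (fun t => functional (γ t) v.toFun) (𝓝 t₀)
      (𝓝 (functional (γ t₀) v.toFun)) := by
  have hK : IsCompact (tsupport v.toFun) := v.compactSupport
  have hp := two_lt_critExp hn
  have hcv := v.smooth.continuous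
  have hclose := fun {ε : ℝ} (hε : 0 < ε) => hγ.eventually_isClose hK t₀ hε
  simp only [functional_eq _ v.smooth v.compactSupport]
  refine Filter.Tendsto.div (Filter.Tendsto.add (Filter.Tendsto.const_mul _ ?_) ?_) ?_ ?_
  · have hD : 0 ≤ ∫ x, normSqD (γ t₀) v.toFun x ∂(riemMeasure (γ t₀)) :=
      integral_nonneg fun x => normSqD_nonneg _ _ x
    refine tendsto_of_forall_abs_sub_le
      (C := 3 * ∫ x, normSqD (γ t₀) v.toFun x ∂(riemMeasure (γ t₀))) fun ε hε hε1 => ?_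
    filter_upwards [hclose hε] with t ht
    obtain ⟨h1, h2⟩ := ht.normSqD_bounds hK hε.le hε1 v.smooth Subset.rfl
    have h3 := mul_nonneg hε.le hD
    have h4 := mul_nonneg h3 (sub_nonneg.2 hε1)
    have h5 := mul_nonneg h3 hε.le
    rw [abs_le]
    constructor <;> nlinarith
  · obtain ⟨s, hs⟩ := hK.exists_bound_of_continuousOn (continuous_scal (γ t₀)).continuousOn
    refine tendsto_of_forall_abs_sub_le
      (C := (2 + s) * ∫ x, v.toFun x ^ 2 ∂(riemMeasure (γ t₀))) fun ε hε hε1 => ?_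
    filter_upwards [hclose hε] with t ht
    refine (ht.abs_scal_term_sub_le hK hε.le hε1 hcv Subset.rfl hs).trans (le_of_eq ?_)
    ring
  · refine tendsto_of_forall_abs_sub_le
      (C := lpNorm (γ t₀) (critExp n) v.toFun ^ 2) fun ε hε hε1 => ?_
    filter_upwards [hclose hε] with t ht
    obtain ⟨h1, h2⟩ := ht.lpNorm_sq_bounds hK hε.le hε1 hp.le hcv Subset.rfl
    rw [abs_le]
    constructor <;> linarith
  · exact (pow_pos (lpNorm_pos _ (by linarith) hcv v.compactSupport v.ne_zero) 2).ne'

theorem IsC2Family.eventually_yam_lt (hγ : IsC2Family γ) (hn : 3 ≤ n) (t₀ : X) {c : EReal}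
    (hc : yam (γ t₀) < c) : ∀ᶠ t in 𝓝 t₀, yam (γ t) < c := by
  obtain ⟨v, hv⟩ := iInf_lt_iff.1 hc
  have h1 : Filter.Tendsto (fun t => ((functional (γ t) v.toFun : ℝ) : EReal)) (𝓝 t₀)
      (𝓝 ((functional (γ t₀) v.toFun : ℝ) : EReal)) :=
    (continuous_coe_real_ereal.tendsto _).comp (hγ.tendsto_functional hn v t₀)
  filter_upwards [h1.eventually_lt_const hv] with t ht
  exact (iInf_le _ v).trans_lt ht

/-- Compactness makes one $\varepsilon$ serve all test functions: every error not absorbed into the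
energy is at most $\varepsilon$ times a constant times $\|v\|_{L^p(g_0)}^2$. -/
theorem IsC2Family.eventually_lt_yam [CompactSpace M] (hγ : IsC2Family γ) (hn : 3 ≤ n) (t₀ : X)
    {c : EReal} (hc : c < yam (γ t₀)) : ∀ᶠ t in 𝓝 t₀, c < yam (γ t) := by
  have hp := two_lt_critExp hn
  obtain ⟨c₁, hc₁, hc₁'⟩ := EReal.lt_iff_exists_real_btwn.1 hc
  obtain ⟨c₂, hc₂, hc₂'⟩ := EReal.lt_iff_exists_real_btwn.1 hc₁'
  have hlt : c₁ < c₂ := EReal.coe_lt_coe_iff.1 hc₂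
  have hfun : ∀ v : TestFunction n M, c₂ ≤ functional (γ t₀) v.toFun := fun v =>
    EReal.coe_le_coe_iff.1 (hc₂'.le.trans (iInf_le _ v))
  obtain ⟨s, hs⟩ := (isCompact_univ (X := M)).exists_bound_of_continuousOn
    (continuous_scal (γ t₀)).continuousOn
  obtain ⟨C, hC0, hC⟩ := exists_integral_sq_le (γ t₀) hp
  -- `B` collects the coefficients of $\varepsilon\|v\|_{L^p(g_0)}^2$ in `k3` to `k6` below; the
  -- final 1 keeps it positive. The choice of `ε` makes their total at most $c_2-c_1$.
  set B := |c₁| + 2 * |c₂| + (2 + 3 * |s|) * C + 1 with hB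
  have hBpos : 0 < B := by positivity
  set ε := min (1 / 2) ((c₂ - c₁) / B) with hεdef
  have hε : 0 < ε := lt_min (by norm_num) (div_pos (by linarith) hBpos)
  have hε1 : ε ≤ 1 := (min_le_left _ _).trans (by norm_num)
  have hεB : ε * B ≤ c₂ - c₁ := by
    rw [← le_div_iff₀ hBpos]; exact min_le_right _ _
  filter_upwards [hγ.eventually_isClose isCompact_univ t₀ hε] with t ht
  refine lt_of_lt_of_le hc₁ (le_iInf fun v => EReal.coe_le_coe_iff.2 ?_)
  have hcv := v.smooth.continuous
  have hL0 := pow_pos (lpNorm_pos (γ t₀) (by linarith : 0 < critExp n) hcv v.compactSupport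
    v.ne_zero) 2
  have hL := pow_pos (lpNorm_pos (γ t) (by linarith : 0 < critExp n) hcv v.compactSupport
    v.ne_zero) 2
  have hN := hfun v
  rw [functional_eq _ v.smooth v.compactSupport, le_div_iff₀ hL0] at hN
  rw [functional_eq _ v.smooth v.compactSupport, le_div_iff₀ hL]
  have hD := (ht.normSqD_bounds isCompact_univ hε.le hε1 v.smooth (subset_univ _)).1
  have hS := (abs_le.1 (ht.abs_scal_term_sub_le isCompact_univ hε.le hε1 hcv (subset_univ _)
    (s := |s|) fun x hx => (hs x hx).trans (le_abs_self s))).1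
  obtain ⟨hL1, hL2⟩ := ht.lpNorm_sq_bounds isCompact_univ hε.le hε1 hp.le hcv (subset_univ _)
  have hV := hC v.toFun hcv
  have hV0 : 0 ≤ ∫ x, v.toFun x ^ 2 ∂(riemMeasure (γ t₀)) := integral_nonneg fun x => sq_nonneg _
  have hS0 : ∫ x, scal (γ t₀) x * v.toFun x ^ 2 ∂(riemMeasure (γ t₀)) ≥
      -(|s| * ∫ x, v.toFun x ^ 2 ∂(riemMeasure (γ t₀))) := by
    rw [← integral_const_mul, ← integral_neg]
    have hcc := fun f : M → ℝ => HasCompactSupport.of_compactSpace f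
    refine integral_mono (integrable_of_hasCompactSupport _
      ((continuous_const.mul (hcv.pow 2)).neg) (hcc _)) (integrable_of_hasCompactSupport _
      ((continuous_scal _).mul (hcv.pow 2)) (hcc _)) fun x => ?_
    have h1 := neg_le_of_abs_le ((hs x (mem_univ x)).trans (le_abs_self s))
    have := mul_le_mul_of_nonneg_right h1 (sq_nonneg (v.toFun x))
    linarith
  have ha := gradConst_pos hn
  generalize gradConst n = a at *
  generalize lpNorm (γ t₀) (critExp n) v.toFun ^ 2 = L₀ at *
  generalize lpNorm (γ t) (critExp n) v.toFun ^ 2 = L at *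
  generalize (∫ x, normSqD (γ t₀) v.toFun x ∂(riemMeasure (γ t₀))) = D₀ at *
  generalize (∫ x, normSqD (γ t) v.toFun x ∂(riemMeasure (γ t))) = D at *
  generalize (∫ x, scal (γ t₀) x * v.toFun x ^ 2 ∂(riemMeasure (γ t₀))) = S₀ at *
  generalize (∫ x, scal (γ t) x * v.toFun x ^ 2 ∂(riemMeasure (γ t))) = S at *
  generalize (∫ x, v.toFun x ^ 2 ∂(riemMeasure (γ t₀))) = V at *
  clear_value ε B
  have k1 : a * ((1 - ε) ^ 2 * D₀) ≤ a * D := mul_le_mul_of_nonneg_left hD ha.le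
  -- The Dirichlet integral is not bounded by the $L^p$-norm. The whole energy inequality is
  -- therefore scaled by the factor $(1-\varepsilon)^2$ of the gradient term, and only the leftover
  -- part of $S_0$ is estimated.
  have k2 : (1 - ε) ^ 2 * (c₂ * L₀) ≤ (1 - ε) ^ 2 * (a * D₀ + S₀) :=
    mul_le_mul_of_nonneg_left hN (sq_nonneg _)
  have hw : 0 ≤ 1 - (1 - ε) ^ 2 ∧ 1 - (1 - ε) ^ 2 ≤ 2 * ε := by constructor <;> nlinarith
  have k3 : -(2 * ε * (|s| * V)) ≤ (1 - (1 - ε) ^ 2) * S₀ := by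
    have h1 := mul_le_mul_of_nonneg_left hS0 hw.1
    have h2 := mul_le_mul_of_nonneg_right hw.2 (mul_nonneg (abs_nonneg s) hV0)
    linarith
  have k4 : ε * (2 + 3 * |s|) * V ≤ ε * (2 + 3 * |s|) * (C * L₀) :=
    mul_le_mul_of_nonneg_left hV (by positivity)
  have k5 : c₁ * L ≤ c₁ * L₀ + |c₁| * (ε * L₀) := by
    have h1 : c₁ * (L - L₀) ≤ |c₁| * |L - L₀| := by
      rw [← abs_mul]; exact le_abs_self _
    have h2 : |L - L₀| ≤ ε * L₀ := by rw [abs_le]; constructor <;> linarith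
    have h3 := mul_le_mul_of_nonneg_left h2 (abs_nonneg c₁)
    linarith
  have k6 : c₂ * L₀ - 2 * ε * (|c₂| * L₀) ≤ (1 - ε) ^ 2 * (c₂ * L₀) := by
    have h1 : c₂ * L₀ ≤ |c₂| * L₀ := mul_le_mul_of_nonneg_right (le_abs_self _) hL0.le
    have h2 := mul_le_mul_of_nonneg_left h1 hw.1
    have h3 := mul_le_mul_of_nonneg_right hw.2 (mul_nonneg (abs_nonneg c₂) hL0.le)
    linarith
  have k7 : ε * B * L₀ ≤ (c₂ - c₁) * L₀ := mul_le_mul_of_nonneg_right hεB hL0.le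
  have k8 : ε * B * L₀ = |c₁| * (ε * L₀) + 2 * ε * (|c₂| * L₀) +
      ε * (2 + 3 * |s|) * (C * L₀) + ε * L₀ := by rw [hB]; ring
  have k9 : 0 < ε * L₀ := mul_pos hε hL0
  linarith

end Semicontinuity

/-! ### A homogeneous metric of negative scalar curvature -/

section Model

variable {n : ℕ}

/-- The diagonal entries of the metric `∑ᵢ cᵢ exp(2 λᵢ y_o) dyᵢ²`. -/
def diagEntry (o : Fin n) (c lam : Fin n → ℝ) (i : Fin n) (y : E n) : ℝ :=
  c i * Real.exp (2 * lam i * y o)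

/-- The coefficients of the metric `∑ᵢ cᵢ exp(2 λᵢ y_o) dyᵢ²`. -/
def diagMetric (o : Fin n) (c lam : Fin n → ℝ) (i j : Fin n) (y : E n) : ℝ :=
  if i = j then diagEntry o c lam i y else 0

variable {o : Fin n} {c lam : Fin n → ℝ}

theorem contDiff_diagEntry (i : Fin n) : ContDiff ℝ ∞ (diagEntry o c lam i) :=
  contDiff_const.mul (contDiff_const.mul
    (EuclideanSpace.proj o : E n →L[ℝ] ℝ).contDiff).exp

theorem diagEntry_pos (hc : ∀ i, 0 < c i) (i : Fin n) (y : E n) : 0 < diagEntry o c lam i y :=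
  mul_pos (hc i) (Real.exp_pos _)

theorem gram_diagMetric (y : E n) :
    gram (diagMetric o c lam) y = Matrix.diagonal fun i => diagEntry o c lam i y := by
  ext i j
  simp [gram, diagMetric, Matrix.diagonal_apply]

theorem pderiv_diagEntry (m i : Fin n) (y : E n) :
    pderiv m (diagEntry o c lam i) y = if m = o then 2 * lam i * diagEntry o c lam i y else 0 := by
  have h1 : HasFDerivAt (fun z : E n => 2 * lam i * z o)
      ((2 * lam i) • (EuclideanSpace.proj o : E n →L[ℝ] ℝ)) y :=
    (EuclideanSpace.proj o : E n →L[ℝ] ℝ).hasFDerivAt.const_mul _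
  have h2 : HasFDerivAt (diagEntry o c lam i) _ y := h1.exp.const_mul (c i)
  rw [pderiv, h2.fderiv]
  have h3 : (EuclideanSpace.proj o : E n →L[ℝ] ℝ) (basisVec m) = if m = o then 1 else 0 := by
    simp [eq_comm]
  simp only [smul_apply, smul_eq_mul, h3, diagEntry]
  split_ifs <;> ring

theorem pderiv_diagMetric (m i j : Fin n) (y : E n) : pderiv m (diagMetric o c lam i j) y =
    if m = o then (if i = j then 2 * lam i * diagEntry o c lam i y else 0) else 0 := by
  by_cases h : i = j
  · have : diagMetric o c lam i j = diagEntry o c lam i := by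
      funext z; simp [diagMetric, h]
    rw [this, pderiv_diagEntry]
    simp [h]
  · have : diagMetric o c lam i j = fun _ => 0 := by
      funext z; simp [diagMetric, h]
    rw [this, pderiv_const]
    simp [h]

theorem invCoeff_diagMetric (hc : ∀ i, 0 < c i) (i j : Fin n) (y : E n) :
    invCoeff (diagMetric o c lam) i j y = if i = j then (diagEntry o c lam i y)⁻¹ else 0 := by
  have h : (gram (diagMetric o c lam) y)⁻¹ =
      Matrix.diagonal fun i => (diagEntry o c lam i y)⁻¹ := by
    refine Matrix.inv_eq_right_inv ?_
    rw [gram_diagMetric, Matrix.diagonal_mul_diagonal, ← Matrix.diagonal_one]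
    congr 1
    funext k
    exact mul_inv_cancel₀ (diagEntry_pos hc k y).ne'
  rw [invCoeff_eq, h, Matrix.diagonal_apply]

theorem diagEntry_self (ho : lam o = 0) (y : E n) : diagEntry o c lam o y = c o := by
  simp [diagEntry, ho]

/-- The entries depend on $y_o$ alone, so only $\Gamma^k_{ok}=\Gamma^k_{ko}=\lambda_k$ and
$\Gamma^o_{ii}$ survive. -/
theorem christoffel_diagMetric (hc : ∀ i, 0 < c i) (ho : lam o = 0) (k i j : Fin n) (y : E n) :
    christoffel (diagMetric o c lam) k i j y =
      (if i = o then (if j = k then lam k else 0) else 0) +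
      (if j = o then (if i = k then lam k else 0) else 0) -
      (if k = o then (if i = j then lam i / c o * diagEntry o c lam i y else 0) else 0) := by
  have hd := (diagEntry_pos (o := o) (lam := lam) hc k y).ne'
  simp only [christoffel, invCoeff_diagMetric hc, pderiv_diagMetric, ite_mul, zero_mul,
    Finset.sum_ite_eq, Finset.mem_univ, if_true]
  have e1 : (1 / 2 : ℝ) * ((diagEntry o c lam k y)⁻¹ * (2 * lam k * diagEntry o c lam k y)) =
      lam k := by
    field_simp
  rw [mul_sub, mul_add, mul_sub, mul_add]
  congr 1
  · congr 1
    · split_ifs with h1 h2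
      · rw [h2, e1]
      · simp
      · simp
    · split_ifs with h1 h2
      · rw [h2, e1]
      · simp
      · simp
  · split_ifs with h1 h2
    · rw [h1, diagEntry_self ho]
      have := (hc o).ne'
      field_simp
    · simp
    · simp

theorem pderiv_christoffel_diagMetric (hc : ∀ i, 0 < c i) (ho : lam o = 0) (m k i j : Fin n)
    (y : E n) : pderiv m (christoffel (diagMetric o c lam) k i j) y =
      -(if k = o then (if i = j then
        (if m = o then 2 * lam i ^ 2 / c o * diagEntry o c lam i y else 0) else 0) else 0) := by
  have hf : ∀ a b : ℝ, pderiv m (fun z => a - b * diagEntry o c lam i z) y =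
      -(b * (if m = o then 2 * lam i * diagEntry o c lam i y else 0)) := by
    intro a b
    have hd : DifferentiableAt ℝ (diagEntry o c lam i) y :=
      (contDiff_diagEntry i).contDiffAt.differentiableAt (by simp)
    rw [pderiv_sub (by fun_prop) (by fun_prop), pderiv_const, pderiv_const_mul b hd,
      pderiv_diagEntry, zero_sub]
  have h : christoffel (diagMetric o c lam) k i j = fun z =>
      ((if i = o then (if j = k then lam k else 0) else 0) +
      (if j = o then (if i = k then lam k else 0) else 0)) -
      (if k = o then (if i = j then lam i / c o else 0) else 0) * diagEntry o c lam i z := by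
    funext z
    rw [christoffel_diagMetric hc ho]
    congr 1
    split_ifs <;> simp
  rw [h, hf]
  split_ifs <;> ring

/-- Diagonal entries suffice, since the inverse metric is diagonal. The condition $\sum\lambda_k=0$
kills the traces $\sum_k\Gamma^k_{kl}$. For $i\ne o$ the derivative of $\Gamma^o_{ii}$ cancels
against the quadratic term; for $i=o$ only $-\sum_k(\Gamma^k_{ok})^2$ is left. -/
theorem ricci_diagMetric_self (hc : ∀ i, 0 < c i) (ho : lam o = 0) (hsum : ∑ i, lam i = 0)
    (i : Fin n) (y : E n) : ricci (diagMetric o c lam) i i y =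
      if i = o then -∑ k, lam k ^ 2 else 0 := by
  have h1 : ∀ k, pderiv i (christoffel (diagMetric o c lam) k i k) y = 0 := by
    intro k
    rw [pderiv_christoffel_diagMetric hc ho, neg_eq_zero]
    split_ifs with ha hb hd
    · rw [hd, ho]; simp
    all_goals rfl
  have h2 : ∑ k, pderiv k (christoffel (diagMetric o c lam) k i i) y =
      -(2 * lam i ^ 2 / c o * diagEntry o c lam i y) := by
    simp only [pderiv_christoffel_diagMetric hc ho, if_true, Finset.sum_neg_distrib]
    rw [Finset.sum_eq_single o (fun k _ hk => by simp [hk]) (by simp)]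
    simp
  have h3 : ∀ l, ∑ k, christoffel (diagMetric o c lam) k k l y = 0 := by
    intro l
    have : ∀ k, christoffel (diagMetric o c lam) k k l y = if l = o then lam k else 0 := by
      intro k
      rw [christoffel_diagMetric hc ho]
      by_cases hk : k = o <;> by_cases hl : l = o <;> simp [hk, hl, ho]
    simp only [this]
    split_ifs <;> simp [hsum]
  have h4 : ∑ k, ∑ l, christoffel (diagMetric o c lam) k k l y *
      christoffel (diagMetric o c lam) l i i y = 0 := by
    rw [Finset.sum_comm]
    exact Finset.sum_eq_zero fun l _ => by rw [← Finset.sum_mul, h3, zero_mul]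
  simp only [ricci, Finset.sum_sub_distrib, h1, h2, h4, sub_zero, zero_sub]
  by_cases hi : i = o
  · subst hi
    have : ∀ k l, christoffel (diagMetric i c lam) k i l y = if l = k then lam k else 0 := by
      intro k l
      rw [christoffel_diagMetric hc ho]
      simp only [ho, if_true, zero_div, zero_mul, ite_self, sub_zero, add_eq_left]
      split_ifs with ha hb
      · rw [← hb, ho]
      all_goals rfl
    simp only [this, ho]
    simp only [if_true, ite_mul, zero_mul, Finset.sum_ite_eq', Finset.mem_univ]
    simp [pow_two]
  · have h5 : ∀ k l, christoffel (diagMetric o c lam) k i l y =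
        (if l = o then (if i = k then lam i else 0) else 0) -
        (if k = o then (if i = l then lam i / c o * diagEntry o c lam i y else 0) else 0) := by
      intro k l
      rw [christoffel_diagMetric hc ho]
      simp only [hi, if_false, zero_add]
      congr 2
      split_ifs with ha
      · rw [ha]
      · rfl
    have h6 : ∑ k, ∑ l, christoffel (diagMetric o c lam) k i l y *
        christoffel (diagMetric o c lam) l i k y =
        -(2 * lam i ^ 2 / c o * diagEntry o c lam i y) := by
      have hio : o ≠ i := fun h => hi h.symm
      simp only [h5]
      rw [Finset.sum_congr rfl fun k _ => Finset.sum_eq_add o i hio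
        (fun l _ hl => by simp [hl.1, Ne.symm hl.2]) (by simp) (by simp)]
      rw [Finset.sum_eq_add o i hio (fun k _ hk => by
        simp [hk.1, Ne.symm hk.2]) (by simp) (by simp)]
      simp only [hi, if_true, if_false]
      ring
    rw [h6]
    simp [hi]

theorem scalCoord_diagMetric (hc : ∀ i, 0 < c i) (ho : lam o = 0) (hsum : ∑ i, lam i = 0)
    (y : E n) : scalCoord (diagMetric o c lam) y = -(∑ k, lam k ^ 2) / c o := by
  simp only [scalCoord, invCoeff_diagMetric hc, ite_mul, zero_mul, Finset.sum_ite_eq,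
    Finset.mem_univ, if_true, ricci_diagMetric_self hc ho hsum, mul_ite, mul_zero,
    Finset.sum_ite_eq', diagEntry_self ho]
  rw [inv_mul_eq_div]

theorem det_diagMetric (hsum : ∑ i, lam i = 0) (y : E n) :
    (gram (diagMetric o c lam) y).det = ∏ i, c i := by
  rw [gram_diagMetric, Matrix.det_diagonal]
  simp only [diagEntry, Finset.prod_mul_distrib, ← Real.exp_sum]
  rw [← Finset.sum_mul, ← Finset.mul_sum, hsum]
  simp

theorem normSqCoord_diagMetric (hc : ∀ i, 0 < c i) (f : E n → ℝ) (y : E n) :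
    normSqCoord (diagMetric o c lam) f y =
      ∑ i, (diagEntry o c lam i y)⁻¹ * pderiv i f y ^ 2 := by
  simp only [normSqCoord, invCoeff_diagMetric hc, ite_mul, zero_mul, Finset.sum_ite_eq,
    Finset.mem_univ, if_true]
  exact Finset.sum_congr rfl fun i _ => by ring

/-- The metric `∑ᵢ cᵢ exp(2 λᵢ y_o) dyᵢ²` as a family of bilinear forms. -/
def diagForm (o : Fin n) (c lam : Fin n → ℝ) (y : E n) : E n →L[ℝ] E n →L[ℝ] ℝ :=
  ∑ i, diagEntry o c lam i y •
    (EuclideanSpace.proj i : E n →L[ℝ] ℝ).smulRight (EuclideanSpace.proj i : E n →L[ℝ] ℝ)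

theorem diagForm_apply (y u w : E n) :
    diagForm o c lam y u w = ∑ i, diagEntry o c lam i y * (u i * w i) := by
  simp [diagForm]

theorem contDiff_diagForm : ContDiff ℝ ∞ (diagForm o c lam) := by
  refine contDiff_clm_apply_iff.2 fun u => contDiff_clm_apply_iff.2 fun w => ?_
  simp only [diagForm_apply]
  exact ContDiff.sum fun i _ => (contDiff_diagEntry i).mul contDiff_const

theorem diagForm_basisVec (y : E n) (i j : Fin n) :
    diagForm o c lam y (basisVec i) (basisVec j) = diagMetric o c lam i j y := by
  rw [diagForm_apply, diagMetric, Finset.sum_eq_single i]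
  · simp
  · intro b _ hb; simp [hb]
  · simp

theorem diagForm_symm (y u w : E n) : diagForm o c lam y u w = diagForm o c lam y w u := by
  simp only [diagForm_apply, mul_comm (u _)]

theorem diagForm_pos (hc : ∀ i, 0 < c i) (y : E n) {u : E n} (hu : u ≠ 0) :
    0 < diagForm o c lam y u u := by
  rw [diagForm_apply]
  obtain ⟨i, hi⟩ : ∃ i, u i ≠ 0 := by
    by_contra! h
    exact hu (by ext i; exact h i)
  refine Finset.sum_pos' (fun j _ => mul_nonneg (diagEntry_pos hc j y).le (mul_self_nonneg _))
    ⟨i, Finset.mem_univ _, mul_pos (diagEntry_pos hc i y) (mul_self_pos.2 hi)⟩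

end Model

/-! ### Local modification of a metric -/

section Modification

open Set

variable {n : ℕ}

/-- Compactness of the unit sphere gives $B(v,v)\ge m\|v\|^2$ with $m>0$. The resulting boundedness
is one of the fields in the definition of a Riemannian metric. -/
theorem isVonNBounded_of_pos (B : E n →L[ℝ] E n →L[ℝ] ℝ) (hB : ∀ v, v ≠ 0 → 0 < B v v) :
    Bornology.IsVonNBounded ℝ {v : E n | B v v < 1} := by
  obtain ⟨m, hm, hmB⟩ : ∃ m : ℝ, 0 < m ∧ ∀ v, m * ‖v‖ ^ 2 ≤ B v v := by
    have hcont : Continuous fun v : E n => B v v := B.continuous.clm_apply continuous_id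
    have hscale : ∀ m : ℝ, (∀ v ∈ Metric.sphere (0 : E n) 1, m ≤ B v v) →
        ∀ v, m * ‖v‖ ^ 2 ≤ B v v := by
      intro m hm v
      rcases eq_or_ne v 0 with rfl | hv
      · simp
      · have hn : ‖v‖ ≠ 0 := norm_ne_zero_iff.2 hv
        have h1 := hm (‖v‖⁻¹ • v) (by simp [norm_smul, hn])
        simp only [map_smul, smul_apply, smul_eq_mul] at h1
        have h2 := mul_le_mul_of_nonneg_right h1 (sq_nonneg ‖v‖)
        have h3 : ‖v‖⁻¹ * (‖v‖⁻¹ * B v v) * ‖v‖ ^ 2 = B v v := by field_simp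
        rwa [h3] at h2
    -- The sphere is empty when $n=0$, and then any $m$ works.
    rcases (Metric.sphere (0 : E n) 1).eq_empty_or_nonempty with he | hne
    · exact ⟨1, one_pos, hscale 1 (by simp [he])⟩
    · obtain ⟨w, hw, hmin⟩ := (isCompact_sphere (0 : E n) 1).exists_isMinOn hne hcont.continuousOn
      refine ⟨B w w, hB w fun h => ?_, hscale _ fun v hv => hmin hv⟩
      rw [mem_sphere_zero_iff_norm, h, norm_zero] at hw
      exact zero_ne_one hw
  refine (NormedSpace.isVonNBounded_iff ℝ).2 ?_
  refine (Metric.isBounded_closedBall (x := (0 : E n)) (r := 1 + m⁻¹)).subset fun v hv => ?_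
  rw [mem_closedBall_zero_iff]
  have h1 : m * ‖v‖ ^ 2 < 1 := (hmB v).trans_lt hv
  have h2 : ‖v‖ ^ 2 < m⁻¹ := by rwa [← one_div, lt_div_iff₀ hm, mul_comm]
  nlinarith [sq_nonneg (‖v‖ - 1), norm_nonneg v, inv_pos.2 hm]

variable {M : Type*} [TopologicalSpace M] [ChartedSpace (E n) M] [IsManifold (𝓡 n) ∞ M]

/-- The trivialization of the tangent bundle over the domain of the preferred chart at `x₀`. -/
def tangentTriv (x₀ x : M) : TangentSpace (𝓡 n) x →L[ℝ] E n :=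
  (trivializationAt (E n) (TangentSpace (𝓡 n)) x₀).continuousLinearMapAt ℝ x

/-- The pullback of a bilinear form on `ℝⁿ` under the trivialization of the tangent bundle. -/
def pullbackForm (x₀ x : M) (B : E n →L[ℝ] E n →L[ℝ] ℝ) :
    TangentSpace (𝓡 n) x →L[ℝ] TangentSpace (𝓡 n) x →L[ℝ] ℝ :=
  (ContinuousLinearMap.precomp ℝ (tangentTriv x₀ x)).comp (B.comp (tangentTriv x₀ x))

theorem pullbackForm_apply (x₀ x : M) (B : E n →L[ℝ] E n →L[ℝ] ℝ) (u w : TangentSpace (𝓡 n) x) :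
    pullbackForm x₀ x B u w = B (tangentTriv x₀ x u) (tangentTriv x₀ x w) := rfl

theorem tangentTriv_injective {x₀ x : M} (hx : x ∈ (chartAt (E n) x₀).source) :
    Function.Injective (tangentTriv (n := n) x₀ x) := by
  intro u w h
  have hb : x ∈ (trivializationAt (E n) (TangentSpace (𝓡 n) : M → Type _) x₀).baseSet := by
    simpa using hx
  have h2 := congrArg ((trivializationAt (E n) (TangentSpace (𝓡 n) : M → Type _) x₀).symmL ℝ x) h
  simpa only [tangentTriv, Bundle.Trivialization.symmL_continuousLinearMapAt _ hb] using h2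

-- Read in the trivialization over the chart domain, this section is the smooth function $H$
-- composed with the chart.
set_option synthInstance.maxHeartbeats 400000 in
theorem contMDiffOn_pullbackForm (x₀ : M) {H : E n → E n →L[ℝ] E n →L[ℝ] ℝ}
    (hH : ContDiff ℝ ∞ H) :
    ContMDiffOn (𝓡 n) ((𝓡 n).prod 𝓘(ℝ, E n →L[ℝ] E n →L[ℝ] ℝ)) ∞
      (fun x => Bundle.TotalSpace.mk' (E n →L[ℝ] E n →L[ℝ] ℝ)
        (E := fun x : M => TangentSpace (𝓡 n) x →L[ℝ] TangentSpace (𝓡 n) x →L[ℝ] ℝ) x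
        (pullbackForm x₀ x (H (chartAt (E n) x₀ x)))) (chartAt (E n) x₀).source := by
  have hs : (chartAt (E n) x₀).source ⊆ (trivializationAt (E n →L[ℝ] E n →L[ℝ] ℝ)
      (fun x : M => TangentSpace (𝓡 n) x →L[ℝ] TangentSpace (𝓡 n) x →L[ℝ]
        Bundle.Trivial M ℝ x) x₀).baseSet := by
    intro x hx
    simpa using hx
  refine ((trivializationAt (E n →L[ℝ] E n →L[ℝ] ℝ)
      (fun x : M => TangentSpace (𝓡 n) x →L[ℝ] TangentSpace (𝓡 n) x →L[ℝ]
        Bundle.Trivial M ℝ x) x₀).contMDiffOn_section_iff (chartAt (E n) x₀).open_source hs).2 ?_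
  have h1 : ContMDiffOn (𝓡 n) 𝓘(ℝ, E n →L[ℝ] E n →L[ℝ] ℝ) ∞
      (fun x : M => H (chartAt (E n) x₀ x)) (chartAt (E n) x₀).source :=
    hH.contMDiff.comp_contMDiffOn (contMDiffOn_of_mem_maximalAtlas (chartAt_mem_charts x₀))
  refine h1.congr fun x hx => ?_
  have hb : x ∈ (trivializationAt (E n) (TangentSpace (𝓡 n) : M → Type _) x₀).baseSet := by
    simpa using hx
  rw [hom_trivializationAt_apply]
  ext u w
  have := inCoordinates_apply_eq₂ (F₃ := ℝ) (E₃ := Bundle.Trivial M ℝ)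
    (ϕ := pullbackForm x₀ x (H (chartAt (E n) x₀ x))) (v := u) (w := w) hb hb (by simp)
  refine this.trans ?_
  have hinv : ∀ z : E n, tangentTriv x₀ x
      ((trivializationAt (E n) (TangentSpace (𝓡 n) : M → Type _) x₀).symm x z) = z := fun z => by
    rw [← Bundle.Trivialization.symmL_apply (R := ℝ) _ hb]
    exact (trivializationAt (E n) (TangentSpace (𝓡 n) : M → Type _) x₀).continuousLinearMapAt_symmL
      (R := ℝ) hb z
  rw [pullbackForm_apply, hinv, hinv]
  simp

/-- The convex combination of the metric `g` and of a metric on the domain of a chart. -/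
def modify (g : Metr n M) (x₀ : M) {H : E n → E n →L[ℝ] E n →L[ℝ] ℝ} (hH : ContDiff ℝ ∞ H)
    (hsymm : ∀ y u w, H y u w = H y w u) (hpos : ∀ y u, u ≠ 0 → 0 < H y u u) {χ : M → ℝ}
    (hχ : ContMDiff (𝓡 n) 𝓘(ℝ, ℝ) ∞ χ) (h0 : ∀ x, 0 ≤ χ x) (h1 : ∀ x, χ x ≤ 1)
    (hsupp : tsupport χ ⊆ (chartAt (E n) x₀).source) : Metr n M :=
  have hp : ∀ x (v : TangentSpace (𝓡 n) x), v ≠ 0 → 0 <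
      ((1 - χ x) • g.inner x + χ x • pullbackForm x₀ x (H (chartAt (E n) x₀ x))) v v := by
    intro x v hv
    have hg := g.pos x v hv
    have e : ((1 - χ x) • g.inner x + χ x • pullbackForm x₀ x (H (chartAt (E n) x₀ x))) v v =
      (1 - χ x) * g.inner x v v + χ x * pullbackForm x₀ x (H (chartAt (E n) x₀ x)) v v := rfl
    rw [e]
    -- The pulled-back form is definite only over the chart domain. Off that domain $\chi=0$ and $g$
    -- alone gives positivity.
    rcases (h0 x).eq_or_lt with h | h
    · rw [← h]; simpa using hg
    · have hx : x ∈ (chartAt (E n) x₀).source := hsupp (subset_tsupport _ h.ne')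
      have h2 : 0 < pullbackForm x₀ x (H (chartAt (E n) x₀ x)) v v := by
        rw [pullbackForm_apply]
        exact hpos _ _ fun h3 => hv (tangentTriv_injective hx (h3.trans (map_zero _).symm))
      have := mul_nonneg (sub_nonneg.2 (h1 x)) hg.le
      have := mul_pos h h2
      linarith
  { inner := fun x => (1 - χ x) • g.inner x + χ x • pullbackForm x₀ x (H (chartAt (E n) x₀ x))
    symm := fun x v w => by
      have e : ∀ v w, ((1 - χ x) • g.inner x +
        χ x • pullbackForm x₀ x (H (chartAt (E n) x₀ x))) v w = (1 - χ x) * g.inner x v w +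
          χ x * pullbackForm x₀ x (H (chartAt (E n) x₀ x)) v w := fun v w => rfl
      rw [e, e, g.symm, pullbackForm_apply, pullbackForm_apply, hsymm]
    pos := hp
    isVonNBounded := fun x => isVonNBounded_of_pos _ (hp x)
    contMDiff := by
      have h2 := ContMDiffOn.smul_section_of_tsupport (u := (chartAt (E n) x₀).source)
        hχ.contMDiffOn (chartAt (E n) x₀).open_source hsupp (contMDiffOn_pullbackForm x₀ hH)
      have h3 := ContMDiff.smul_section (f := fun x => 1 - χ x) (contMDiff_const.sub hχ) g.contMDiff
      exact h3.add_section h2 }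

end Modification

/-! ### Locality of the scalar curvature -/

section Congruence

variable {n : ℕ} {G G' : Fin n → Fin n → E n → ℝ} {y : E n}

theorem gram_congr (h : ∀ i j, G i j y = G' i j y) : gram G y = gram G' y := by
  ext i j; exact h i j

theorem christoffel_congr (h : ∀ᶠ z in 𝓝 y, ∀ i j, G i j z = G' i j z) (k i j : Fin n) :
    christoffel G k i j y = christoffel G' k i j y := by
  have hp : ∀ m i j, pderiv m (G i j) y = pderiv m (G' i j) y := fun m i j =>
    pderiv_congr (h.mono fun z hz => hz i j)
  simp only [christoffel, invCoeff_eq, gram_congr h.self_of_nhds, hp]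

theorem scalCoord_congr (h : ∀ᶠ z in 𝓝 y, ∀ i j, G i j z = G' i j z) :
    scalCoord G y = scalCoord G' y := by
  have hp : ∀ m k i j, pderiv m (christoffel G k i j) y = pderiv m (christoffel G' k i j) y :=
    fun m k i j => pderiv_congr (h.eventually_nhds.mono fun z hz => christoffel_congr hz k i j)
  simp only [scalCoord, ricci, invCoeff_eq, gram_congr h.self_of_nhds, hp, christoffel_congr h]

end Congruence

/-! ### Inserting a metric into a chart, and convergence on compact sets -/

section Modification

open Set Filter

variable {n : ℕ} {M : Type*} [TopologicalSpace M] [ChartedSpace (E n) M] [IsManifold (𝓡 n) ∞ M]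

/-- Over its own chart domain the trivialization is the derivative of the chart. Hence the inserted
form has exactly the prescribed coefficients in that chart. -/
theorem tangentTriv_symmD (x₀ : M) {y : E n} (hy : y ∈ (chartAt (E n) x₀).target) (v : E n) :
    tangentTriv x₀ ((chartAt (E n) x₀).symm y) (symmD (chartAt (E n) x₀) y v) = v := by
  rw [tangentTriv, TangentBundle.continuousLinearMapAt_trivializationAt
    ((chartAt (E n) x₀).map_target hy)]
  exact mfderiv_symmD (chartAt_mem_charts x₀) hy v

theorem exists_modification (g : Metr n M) (x₀ : M) {H : E n → E n →L[ℝ] E n →L[ℝ] ℝ}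
    (hH : ContDiff ℝ ∞ H) (hsymm : ∀ y u w, H y u w = H y w u)
    (hpos : ∀ y u, u ≠ 0 → 0 < H y u u) {χ : M → ℝ} (hχ : ContMDiff (𝓡 n) 𝓘(ℝ, ℝ) ∞ χ)
    (h0 : ∀ x, 0 ≤ χ x) (h1 : ∀ x, χ x ≤ 1) (hsupp : tsupport χ ⊆ (chartAt (E n) x₀).source) :
    ∃ g' : Metr n M, (∀ x, χ x = 0 → g'.inner x = g.inner x) ∧
      ∀ y ∈ (chartAt (E n) x₀).target, χ ((chartAt (E n) x₀).symm y) = 1 →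
        ∀ i j, coeff g' (chartAt (E n) x₀) i j y = H y (basisVec i) (basisVec j) := by
  refine ⟨modify g x₀ hH hsymm hpos hχ h0 h1 hsupp, fun x hx => ?_, fun y hy hx i j => ?_⟩
  · refine ContinuousLinearMap.ext fun u => ContinuousLinearMap.ext fun w => ?_
    have e : (modify g x₀ hH hsymm hpos hχ h0 h1 hsupp).inner x u w =
      (1 - χ x) * g.inner x u w + χ x * pullbackForm x₀ x (H (chartAt (E n) x₀ x)) u w := rfl
    rw [e, hx, sub_zero, one_mul, zero_mul, add_zero]
  · set x := (chartAt (E n) x₀).symm y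
    have e : coeff (modify g x₀ hH hsymm hpos hχ h0 h1 hsupp) (chartAt (E n) x₀) i j y =
      (1 - χ x) * coeff g (chartAt (E n) x₀) i j y +
        χ x * H (chartAt (E n) x₀ x) (tangentTriv x₀ x (symmD (chartAt (E n) x₀) y (basisVec i)))
          (tangentTriv x₀ x (symmD (chartAt (E n) x₀) y (basisVec j))) := rfl
    rw [e, hx, tangentTriv_symmD x₀ hy, tangentTriv_symmD x₀ hy,
      (chartAt (E n) x₀).right_inv hy]
    ring

/-- Metrics which agree with `g` on larger and larger compact sets converge to `g`. -/
theorem tendsto_compactOpen (K : CompactExhaustion M) (g : Metr n M) (γ : ℕ → Metr n M)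
    (h : ∀ m, ∀ x ∈ K m, (γ m).inner x = g.inner x) (k : ℕ∞) :
    Tendsto γ atTop (@nhds _ (compactOpen n M k) g) := by
  rw [nhds_iInf, tendsto_iInf]
  intro e
  rw [nhds_iInf, tendsto_iInf]
  intro he
  rw [nhds_induced, tendsto_comap_iff, ContinuousMap.tendsto_nhds_compactOpen]
  intro C hC U _ hCU
  have hC' : IsCompact ((fun y : e.target => e.symm y) '' C) :=
    hC.image (continuousOn_iff_continuous_domRestrict.1 e.continuousOn_symm)
  obtain ⟨m₀, hm₀⟩ := K.exists_superset_of_isCompact hC'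
  -- One extra step of the exhaustion puts the compact set into the interior of $K_{m_0+1}$. The
  -- metrics then agree on neighbourhoods of its points, so jets of every order coincide.
  filter_upwards [eventually_ge_atTop (m₀ + 1)] with m hm y hy
  have hint : e.symm y ∈ interior (K (m₀ + 1)) :=
    K.subset_interior_succ m₀ (hm₀ (mem_image_of_mem _ hy))
  have hev : ∀ᶠ z in 𝓝 (y : E n), e.symm z ∈ interior (K (m₀ + 1)) :=
    (e.continuousAt_symm y.2).eventually (isOpen_interior.mem_nhds hint)
  have hjet : jet k e he (γ m) y = jet k e he g y := by
    funext i j l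
    refine (Filter.EventuallyEq.iteratedFDeriv ℝ ?_ (l : ℕ)).eq_of_nhds
    filter_upwards [hev] with z hz
    simp only [coeff, h m _ (K.subset hm (interior_subset hz))]
  have := hCU hy
  rw [← hjet] at this
  exact this

end Modification

/-! ### The Yamabe functional of the model metric -/

section ModelIntegrals

open MeasureTheory Set

variable {n : ℕ} {M : Type*} [TopologicalSpace M]

/-- The chart range need not have finite volume and $F$ may blow up at its boundary, but $F$ lives
on the compact image of the support of $v$. -/
theorem integrableOn_comp_symm {e : OpenPartialHomeomorph M (E n)} {v : M → ℝ}
    (hc : HasCompactSupport v) (hve : tsupport v ⊆ e.source)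
    {F : E n → ℝ} (hF : ContinuousOn F e.target)
    (h0 : ∀ y ∈ e.target, e.symm y ∉ tsupport v → F y = 0) : IntegrableOn F e.target := by
  have hC : IsCompact (e '' tsupport v) := hc.isCompact.image_of_continuousOn
    (e.continuousOn.mono hve)
  have hCe : e '' tsupport v ⊆ e.target := by
    rintro _ ⟨x, hx, rfl⟩
    exact e.map_source (hve hx)
  refine ((hF.mono hCe).integrableOn_compact hC).of_forall_sdiff_eq_zero
    e.open_target.measurableSet fun y hy => h0 y hy.1 fun h => hy.2 ?_
  exact ⟨_, h, e.right_inv hy.1⟩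

variable [ChartedSpace (E n) M] [IsManifold (𝓡 n) ∞ M]

/-- Near the support of `v`, the metric `g` is given in the chart `e` by `∑ᵢ cᵢ exp(2 λᵢ y_o) dyᵢ²`. -/
def IsModelOn (g : Metr n M) (e : OpenPartialHomeomorph M (E n)) (v : M → ℝ) (o : Fin n)
    (c lam : Fin n → ℝ) : Prop :=
  ∀ y ∈ e.target, e.symm y ∈ tsupport v →
    ∀ᶠ z in 𝓝 y, ∀ i j, coeff g e i j z = diagMetric o c lam i j z

variable {g : Metr n M} {e : OpenPartialHomeomorph M (E n)} {v : M → ℝ} {o : Fin n}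
  {c lam : Fin n → ℝ}

variable [MeasurableSpace M] [BorelSpace M]

theorem IsModelOn.integral_eq (h : IsModelOn g e v o c lam) (he : e ∈ charts n M)
    (hve : tsupport v ⊆ e.source) (hsum : ∑ i, lam i = 0) {F : M → ℝ}
    (hF : Integrable F (riemMeasure g))
    (h0 : ∀ x ∉ tsupport v, F x = 0) :
    ∫ x, F x ∂(riemMeasure g) = Real.sqrt (∏ i, c i) * ∫ y in e.target, F (e.symm y) := by
  rw [integral_riemMeasure g he hF.aestronglyMeasurable fun x hx => h0 x fun h => hx (hve h),
    ← integral_const_mul]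
  refine setIntegral_congr_fun e.open_target.measurableSet fun y hy => ?_
  by_cases hyv : e.symm y ∈ tsupport v
  · simp only [density, gram_congr (h y hy hyv).self_of_nhds, det_diagMetric hsum]
  · simp only [h0 _ hyv, mul_zero]

/-- This makes the dependence on $c$ and $\lambda$ explicit: apart from the weights in the gradient
term, all integrals are Lebesgue integrals independent of the parameters. -/
theorem IsModelOn.functional_eq (h : IsModelOn g e v o c lam) (he : e ∈ charts n M)
    (hv : ContMDiff (𝓡 n) 𝓘(ℝ, ℝ) ∞ v) (hcs : HasCompactSupport v) (hve : tsupport v ⊆ e.source)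
    (hc : ∀ i, 0 < c i) (ho : lam o = 0) (hsum : ∑ i, lam i = 0) (hn : 3 ≤ n) :
    functional g v = Real.sqrt (∏ i, c i) * (gradConst n *
      (∫ y in e.target, ∑ i, (diagEntry o c lam i y)⁻¹ * pderiv i (v ∘ e.symm) y ^ 2) -
        (∑ i, lam i ^ 2) / c o * ∫ y in e.target, v (e.symm y) ^ 2) /
      (Real.sqrt (∏ i, c i) * ∫ y in e.target, |v (e.symm y)| ^ critExp n) ^ (2 / critExp n) := by
  have hp : 0 < critExp n := by linarith [two_lt_critExp hn]
  have hcv := hv.continuous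
  have hcs' : ∀ F : M → ℝ, (∀ x, v x = 0 → F x = 0) → HasCompactSupport F := fun F hF =>
    hcs.of_isClosed_subset (isClosed_tsupport F) (tsupport_mono_of_zero hF)
  have hv0 : ∀ x ∉ tsupport v, v x = 0 := fun x hx => image_eq_zero_of_notMem_tsupport hx
  have hcs2 : Continuous fun x => scal g x * v x ^ 2 := (continuous_scal g).mul (hcv.pow 2)
  have e1 : ∫ x, normSqD g v x ∂(riemMeasure g) = Real.sqrt (∏ i, c i) *
      ∫ y in e.target, ∑ i, (diagEntry o c lam i y)⁻¹ * pderiv i (v ∘ e.symm) y ^ 2 := by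
    rw [h.integral_eq he hve hsum (integrable_of_hasCompactSupport g (continuous_normSqD g hv)
      (hasCompactSupport_normSqD g hcs)) fun x hx => normSqD_eq_zero g hx]
    congr 1
    refine setIntegral_congr_fun e.open_target.measurableSet fun y hy => ?_
    by_cases hyv : e.symm y ∈ tsupport v
    · rw [normSqD_eq g hv he (e.map_target hy), e.right_inv hy, ← normSqCoord_diagMetric hc]
      simp only [normSqCoord, invCoeff_eq, gram_congr (h y hy hyv).self_of_nhds]
    · have h1 : (v ∘ e.symm) =ᶠ[𝓝 y] fun _ => 0 :=
        (e.continuousAt_symm hy).eventually (notMem_tsupport_iff_eventuallyEq.1 hyv)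
      simp only [normSqD_eq_zero g hyv, pderiv_congr h1, pderiv_const]
      simp
  have e2 : ∫ x, scal g x * v x ^ 2 ∂(riemMeasure g) = Real.sqrt (∏ i, c i) *
      (-((∑ i, lam i ^ 2) / c o) * ∫ y in e.target, v (e.symm y) ^ 2) := by
    rw [h.integral_eq he hve hsum (integrable_of_hasCompactSupport g hcs2
      (hcs' _ fun x hx => by simp [hx]))
      fun x hx => by simp [hv0 x hx]]
    congr 1
    rw [← integral_const_mul]
    refine setIntegral_congr_fun e.open_target.measurableSet fun y hy => ?_
    by_cases hyv : e.symm y ∈ tsupport v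
    · rw [scal_eq g he (e.map_target hy), e.right_inv hy, scalCoord_congr (h y hy hyv),
        scalCoord_diagMetric hc ho hsum, neg_div]
    · simp [hv0 _ hyv]
  have e3 : ∫ x, |v x| ^ critExp n ∂(riemMeasure g) = Real.sqrt (∏ i, c i) *
      ∫ y in e.target, |v (e.symm y)| ^ critExp n :=
    h.integral_eq he hve hsum (integrable_of_hasCompactSupport g (continuous_abs_rpow hcv hp)
      (hcs' _ fun x hx => by simp [hx, Real.zero_rpow hp.ne']))
      fun x hx => by simp [hv0 x hx, Real.zero_rpow hp.ne']
  rw [Yamabe.functional_eq g hv hcs, lpNorm_sq_eq, e1, e2, e3]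
  ring

end ModelIntegrals

/-! ### Discontinuity on noncompact manifolds -/

section Discontinuity

open MeasureTheory Set Filter

variable {n : ℕ} {M : Type*} [TopologicalSpace M] [ChartedSpace (E n) M] [IsManifold (𝓡 n) ∞ M]

/-- Away from a closed set, a metric can be replaced by any of the model metrics near the support
of a fixed test function. -/
theorem exists_testFunction_isModelOn [T2Space M] (g : Metr n M) {K : Set M} (hK : IsClosed K)
    {x₀ : M} (hx₀ : x₀ ∉ K) :
    ∃ v : TestFunction n M, tsupport v.toFun ⊆ (chartAt (E n) x₀).source ∧
      ∀ o c lam, (∀ i, 0 < c i) → ∃ g' : Metr n M, (∀ x ∈ K, g'.inner x = g.inner x) ∧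
        IsModelOn g' (chartAt (E n) x₀) v.toFun o c lam := by
  obtain ⟨f, -, hf⟩ := (SmoothBumpFunction.nhds_basis_tsupport (I := 𝓡 n) x₀).mem_iff.1
    (hK.isOpen_compl.mem_nhds hx₀)
  -- Nested bumps: `v` is supported where the cutoff `f` is locally 1, so the modified metric is the
  -- model near the support of `v`. The choice of `v` precedes that of the parameters.
  have h1 : {x | ∀ᶠ z in 𝓝 x, f z = 1} ∈ 𝓝 x₀ := eventually_eventually_nhds.2 f.eventuallyEq_one
  obtain ⟨v, -, hv⟩ := (SmoothBumpFunction.nhds_basis_tsupport (I := 𝓡 n) x₀).mem_iff.1 h1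
  refine ⟨⟨v, v.contMDiff, v.hasCompactSupport, fun _ => v.nonneg, x₀, by simp⟩,
    v.tsupport_subset_chartAt_source, fun o c lam hc => ?_⟩
  obtain ⟨g', h0, hg'⟩ := exists_modification g x₀ contDiff_diagForm
    (fun y u w => diagForm_symm (o := o) (c := c) (lam := lam) y u w)
    (fun y u hu => diagForm_pos hc y hu) f.contMDiff (fun _ => f.nonneg) (fun _ => f.le_one)
    f.tsupport_subset_chartAt_source
  refine ⟨g', fun x hx => h0 x (image_eq_zero_of_notMem_tsupport fun h => hf h hx),
    fun y hy hyv => ?_⟩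
  filter_upwards [((chartAt (E n) x₀).continuousAt_symm hy).eventually (hv hyv),
    (chartAt (E n) x₀).open_target.mem_nhds hy] with z hz hzt i j
  rw [hg' z hzt hz, diagForm_basisVec]

variable [MeasurableSpace M] [BorelSpace M]

/-- If the model metrics are available near the support of a test function, then its Yamabe energy
can be made arbitrarily negative. -/
theorem exists_functional_le (hn : 3 ≤ n) (v : TestFunction n M)
    {e : OpenPartialHomeomorph M (E n)} (he : e ∈ charts n M) (hve : tsupport v.toFun ⊆ e.source)
    {Q : Metr n M → Prop}
    (hQ : ∀ o c lam, (∀ i, 0 < c i) → ∃ g', Q g' ∧ IsModelOn g' e v.toFun o c lam)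
    {C : ℝ} (hC : 0 ≤ C) : ∃ g', Q g' ∧ functional g' v.toFun ≤ -C := by
  have hp : 0 < critExp n := by linarith [two_lt_critExp hn]
  have ha := gradConst_pos hn
  have hq : 0 ≤ 2 / critExp n := by positivity
  -- Three directions are needed: one to be shrunk and two carrying opposite exponents. This is
  -- where $n\ge3$ provides the room.
  let o : Fin n := ⟨0, by omega⟩
  let i₁ : Fin n := ⟨1, by omega⟩
  let i₂ : Fin n := ⟨2, by omega⟩
  have ho1 : o ≠ i₁ := by simp [o, i₁]
  have ho2 : o ≠ i₂ := by simp [o, i₂]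
  have h12 : i₁ ≠ i₂ := by simp [i₁, i₂]
  have hcv := v.smooth.continuous
  have hpos : ∀ F : M → ℝ, Continuous F → (∀ x, 0 ≤ F x) → (∀ x, F x = 0 ↔ v.toFun x = 0) →
      0 < ∫ y in e.target, F (e.symm y) := by
    intro F hF hF0 hFv
    -- With the flat model the coordinate integral is a Riemannian integral over $M$, whose
    -- positivity is known.
    obtain ⟨g₀, -, hg₀⟩ := hQ o (fun _ => 1) (fun _ => 0) fun _ => one_pos
    have hcs : HasCompactSupport F := v.compactSupport.of_isClosed_subset (isClosed_tsupport F)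
      (tsupport_mono_of_zero fun x => (hFv x).2)
    have h := hg₀.integral_eq he hve (by simp) (integrable_of_hasCompactSupport g₀ hF hcs)
      fun x hx => (hFv x).2 (image_eq_zero_of_notMem_tsupport hx)
    simp only [Finset.prod_const_one, Real.sqrt_one, one_mul] at h
    obtain ⟨x, hx⟩ := v.ne_zero
    rw [← h]
    exact hF.integral_pos_of_hasCompactSupport_nonneg_nonzero hcs hF0 fun h => hx ((hFv x).1 h)
  have hB := hpos (fun x => v.toFun x ^ 2) (hcv.pow 2) (fun x => by positivity) (by simp)
  have hP := hpos (fun x => |v.toFun x| ^ critExp n) (continuous_abs_rpow hcv hp)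
    (fun x => by positivity) fun x => by
      rw [Real.rpow_eq_zero (abs_nonneg _) hp.ne', abs_eq_zero]
  set B := ∫ y in e.target, v.toFun (e.symm y) ^ 2
  set P := ∫ y in e.target, |v.toFun (e.symm y)| ^ critExp n
  set ψ := v.toFun ∘ e.symm with hψ
  have hψs : ContDiffOn ℝ ∞ ψ e.target := contDiffOn_comp_symm v.smooth he
  let J : (Fin n → ℝ) → Fin n → ℝ := fun lam i =>
    ∫ y in e.target, (Real.exp (2 * lam i * y o))⁻¹ * pderiv i ψ y ^ 2
  have hJ0 : ∀ lam i, 0 ≤ J lam i := fun lam i => integral_nonneg fun y => by positivity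
  have hJi : ∀ lam : Fin n → ℝ, ∀ i, IntegrableOn
      (fun y => (Real.exp (2 * lam i * y o))⁻¹ * pderiv i ψ y ^ 2) e.target := by
    intro lam i
    refine integrableOn_comp_symm v.compactSupport hve ?_ fun y hy hyv => ?_
    · have h1 : Continuous fun y : E n => (Real.exp (2 * lam i * y o))⁻¹ :=
        Continuous.inv₀ (by fun_prop) fun y => (Real.exp_pos _).ne'
      exact h1.continuousOn.mul ((contDiffOn_pderiv e.open_target hψs i).continuousOn.pow 2)
    · have h1 : ψ =ᶠ[𝓝 y] fun _ => 0 :=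
        (e.continuousAt_symm hy).eventually (notMem_tsupport_iff_eventuallyEq.1 hyv)
      simp [pderiv_congr h1, pderiv_const]
  set A := J 0 o
  have hA : 0 ≤ A := hJ0 _ _
  have hPq : 0 ≤ P ^ (2 / critExp n) := by positivity
  -- Budget for the curvature term after factoring out $R^2$: the gradient in direction $o$, the
  -- other directions (at most $a_n$ since $W\le R^2$), and the target $-C$ times the largest
  -- possible denominator.
  set X := gradConst n * A + gradConst n + C * P ^ (2 / critExp n) with hX
  have hX0 : 0 ≤ X := by positivity
  -- Requiring $L\ge1$ gives $L\le L^2\le S$, so that $X\le SB$.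
  obtain ⟨L, hL1, hLB⟩ : ∃ L : ℝ, 1 ≤ L ∧ X ≤ L * B :=
    ⟨1 + X / B, by linarith [div_nonneg hX0 hB.le], by
      rw [add_mul, div_mul_cancel₀ _ hB.ne']; linarith⟩
  let lam : Fin n → ℝ := Pi.single i₁ L - Pi.single i₂ L
  have hlo : lam o = 0 := by simp [lam, ho1, ho2]
  have hls : ∑ i, lam i = 0 := by simp [lam, Finset.sum_sub_distrib]
  have hl2 : L ^ 2 ≤ ∑ i, lam i ^ 2 := by
    have := Finset.single_le_sum (f := fun i => lam i ^ 2) (fun i _ => sq_nonneg _)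
      (Finset.mem_univ i₁)
    simpa [lam, h12] using this
  set S := ∑ i, lam i ^ 2
  set W := ∑ i, J lam i
  have hW : 0 ≤ W := Finset.sum_nonneg fun i _ => hJ0 _ _
  -- `R` is chosen after `lam`, because the gradient weights in `W` depend on the exponents.
  let R : ℝ := 1 + W
  have hR1 : 1 ≤ R := by simp only [R]; linarith
  have hR : 0 < R := by linarith
  -- Shrinking direction $o$ multiplies the curvature and the $o$-part of the gradient by $R^2$ and
  -- leaves the other directions unchanged, so their weighted integrals `W` become negligible. The
  -- volume shrinks by $R^{-1}$, which only decreases the denominator.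
  let c : Fin n → ℝ := fun i => if i = o then (R ^ 2)⁻¹ else 1
  have hc : ∀ i, 0 < c i := fun i => by simp only [c]; split_ifs <;> positivity
  have hprod : Real.sqrt (∏ i, c i) = R⁻¹ := by
    simp only [c, Finset.prod_ite_eq', Finset.mem_univ, if_true]
    rw [← inv_pow, Real.sqrt_sq (by positivity)]
  obtain ⟨g', hg', hm⟩ := hQ o c lam hc
  refine ⟨g', hg', ?_⟩
  rw [hm.functional_eq he v.smooth v.compactSupport hve hc hlo hls hn, hprod]
  have hgrad : ∫ y in e.target, ∑ i, (diagEntry o c lam i y)⁻¹ * pderiv i ψ y ^ 2 =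
      ∑ i, (c i)⁻¹ * J lam i := by
    simp only [diagEntry, mul_inv, mul_assoc (c _)⁻¹]
    rw [integral_finsetSum _ fun i _ => (hJi lam i).const_mul _]
    exact Finset.sum_congr rfl fun i _ => integral_const_mul _ _
  have hco : c o = (R ^ 2)⁻¹ := if_pos rfl
  have hJo : J lam o = A := by simp only [A, J, hlo, Pi.zero_apply]
  have hgle : ∑ i, (c i)⁻¹ * J lam i ≤ R ^ 2 * A + W := by
    rw [← Finset.add_sum_erase _ _ (Finset.mem_univ o), hco, inv_inv, hJo]
    gcongr
    refine le_trans (Finset.sum_le_sum (g := J lam) fun i hi => ?_)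
      (Finset.sum_le_sum_of_subset_of_nonneg (Finset.erase_subset o _) fun i _ _ => hJ0 _ _)
    simp [c, (Finset.mem_erase.1 hi).1]
  have hWR : W ≤ R ^ 2 := by
    have : R ≤ R ^ 2 := by nlinarith
    have : W ≤ R := by simp only [R]; linarith
    linarith
  have hD0 : 0 < (R⁻¹ * P) ^ (2 / critExp n) := Real.rpow_pos_of_pos (by positivity) _
  have hD : (R⁻¹ * P) ^ (2 / critExp n) ≤ P ^ (2 / critExp n) := by
    refine Real.rpow_le_rpow (by positivity) ?_ hq
    exact mul_le_of_le_one_left hP.le (inv_le_one_of_one_le₀ hR1)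
  rw [div_le_iff₀ hD0]
  change R⁻¹ * (gradConst n * (∫ y in e.target, ∑ i, (diagEntry o c lam i y)⁻¹ * pderiv i ψ y ^ 2)
    - S / c o * B) ≤ _
  rw [hgrad, hco, div_inv_eq_mul]
  have hLL : L * B ≤ S * B := by
    refine mul_le_mul_of_nonneg_right (le_trans ?_ hl2) hB.le
    nlinarith
  have h1 : gradConst n * ∑ i, (c i)⁻¹ * J lam i ≤ gradConst n * (R ^ 2 * A + R ^ 2) := by
    gcongr
    linarith
  have h2 : gradConst n * ∑ i, (c i)⁻¹ * J lam i - S * R ^ 2 * B ≤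
      -(R ^ 2 * (C * P ^ (2 / critExp n))) := by
    have h3 : R ^ 2 * X ≤ R ^ 2 * (S * B) := by gcongr; linarith
    rw [hX] at h3
    linarith
  calc _ ≤ R⁻¹ * -(R ^ 2 * (C * P ^ (2 / critExp n))) := by gcongr
    _ = -(R * (C * P ^ (2 / critExp n))) := by field_simp
    _ ≤ -C * (R⁻¹ * P) ^ (2 / critExp n) := by
      have h4 : C * (R⁻¹ * P) ^ (2 / critExp n) ≤ C * P ^ (2 / critExp n) := by gcongr
      have h5 : C * P ^ (2 / critExp n) ≤ R * (C * P ^ (2 / critExp n)) :=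
        le_mul_of_one_le_left (by positivity) hR1
      linarith

/-- On a noncompact manifold, every metric is a limit of metrics whose Yamabe constants tend
to `-∞`. -/
theorem exists_seq_tendsto_yam_le [T2Space M] [SecondCountableTopology M] (hn : 3 ≤ n)
    (hM : ¬ CompactSpace M) (g : Metr n M) :
    ∃ γ : ℕ → Metr n M, (∀ k, Tendsto γ atTop (@nhds _ (compactOpen n M k) g)) ∧
      ∀ m, yam (γ m) ≤ ((-(m : ℝ) : ℝ) : EReal) := by
  have : LocallyCompactSpace M := ChartedSpace.locallyCompactSpace (E n) M
  let K := CompactExhaustion.choice M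
  have h : ∀ m, ∃ g' : Metr n M, (∀ x ∈ K m, g'.inner x = g.inner x) ∧
      yam g' ≤ ((-(m : ℝ) : ℝ) : EReal) := by
    intro m
    obtain ⟨x₀, hx₀⟩ : ∃ x₀, x₀ ∉ K m := by
      by_contra! hall
      exact hM ⟨by rw [← eq_univ_of_forall hall]; exact K.isCompact m⟩
    obtain ⟨v, hve, hv⟩ := exists_testFunction_isModelOn g (K.isCompact m).isClosed hx₀
    obtain ⟨g', hg', hle⟩ := exists_functional_le hn v (chartAt_mem_charts x₀) hve hv
      (Nat.cast_nonneg m)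
    exact ⟨g', hg', (iInf_le _ v).trans (EReal.coe_le_coe_iff.2 hle)⟩
  choose γ hγ hle using h
  exact ⟨γ, tendsto_compactOpen K g γ hγ, hle⟩

theorem not_continuousAt_yam [T2Space M] [SecondCountableTopology M] (hn : 3 ≤ n)
    (hM : ¬ CompactSpace M) {g : Metr n M} (hg : yam g ≠ ⊥) (k : ℕ∞) :
    ¬ @ContinuousAt (Metr n M) EReal (compactOpen n M k) _ yam g := by
  intro hcont
  obtain ⟨γ, hγ, hle⟩ := exists_seq_tendsto_yam_le hn hM g
  have hcont' : Tendsto (fun g' : Metr n M => yam g') (@nhds _ (compactOpen n M k) g)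
      (𝓝 (yam g)) := hcont
  have h : Tendsto (fun m => yam (γ m)) atTop (𝓝 (yam g)) := hcont'.comp (hγ k)
  refine hg (EReal.eq_bot_iff_forall_lt _ |>.2 fun y => ?_)
  obtain ⟨m₀, hm₀⟩ := exists_nat_gt (-(y - 1))
  refine (le_of_tendsto h (b := ((y - 1 : ℝ) : EReal)) ?_).trans_lt
    (EReal.coe_lt_coe_iff.2 (by linarith))
  filter_upwards [eventually_ge_atTop m₀] with m hm
  refine (hle m).trans (EReal.coe_le_coe_iff.2 ?_)
  have : (m₀ : ℝ) ≤ m := by exact_mod_cast hm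
  linarith

end Discontinuity

/-- The space of metrics with the $C^2$-topology is its own tautological family, so the results on
families become statements about that topology. -/
theorem isC2Family_id (n : ℕ) (M : Type*) [TopologicalSpace M] [ChartedSpace (E n) M]
    [IsManifold (𝓡 n) ∞ M] :
    @IsC2Family n M _ _ _ (Metr n M) (compactOpen n M 2) id := fun e he =>
  @continuous_iInf_dom _ _ _ _ _ _ e (@continuous_iInf_dom _ _ _ _ _ _ he continuous_induced_dom)

end Yamabe

end

theorem mainTheorem6 (n : ℕ) (hn : 3 ≤ n) (M : Type*) [TopologicalSpace M]
    [ChartedSpace (Yamabe.E n) M] [IsManifold (𝓡 n) ∞ M] [T2Space M]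
    [SecondCountableTopology M] [Nonempty M] [MeasurableSpace M] [BorelSpace M] :
    @UpperSemicontinuous (Yamabe.Metr n M) EReal (Yamabe.compactOpen n M 2) _ Yamabe.yam ∧
    (∀ g : Yamabe.Metr n M, (CompactSpace M ∨ Yamabe.yam g = ⊥) →
      @ContinuousAt (Yamabe.Metr n M) EReal (Yamabe.compactOpen n M 2) _ Yamabe.yam g) ∧
    (∀ g : Yamabe.Metr n M, ¬ CompactSpace M → Yamabe.yam g ≠ ⊥ → ∀ k : ℕ∞,
      ¬ @ContinuousAt (Yamabe.Metr n M) EReal (Yamabe.compactOpen n M k) _ Yamabe.yam g) := by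
  let τ : TopologicalSpace (Yamabe.Metr n M) := Yamabe.compactOpen n M 2
  have hid : Yamabe.IsC2Family (id : Yamabe.Metr n M → Yamabe.Metr n M) := Yamabe.isC2Family_id n M
  refine ⟨fun g c hc => hid.eventually_yam_lt hn g hc, fun g hg => ?_,
    fun g hM hg k => Yamabe.not_continuousAt_yam hn hM hg k⟩
  refine tendsto_order.2 ⟨fun c hc => ?_, fun c hc => hid.eventually_yam_lt hn g hc⟩
  rcases hg with hM | hg
  · exact hid.eventually_lt_yam hn g hc
  · rw [hg] at hc
    exact absurd hc not_lt_bot
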